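/- Let $p$ be a prime number and let $R$ be a commutative ring in which $p$ is invertible. **Definitions.** For finite groups $G,H$, let $B(G,H)$ be the Grothendieck group of finite $(G,H)$-bisets for disjoint unions, and $RB(G,H)=R\otimes_{\mathbb Z}B(G,H)$. Let $R\mathcal C_p$ be the $R$-linear category whose objects are the finite $p$-groups, with $\mathrm{Hom}(P,Q)=RB(Q,P)$ and composition induced by $(U,V)\mapsto U\times_QV$. Let $\mathcal F_{p,R}$ be the category of $p$-biset functors, i.e. of $R$-linear functors $R\mathcal C_p\to R\text{-Mod}$, with natural transformations as morphisms. A finite $p$-group $P$ is *atoric* if it has no decomposition $P=E\times Q$ with $E$ a non-trivial elementary abelian $p$-group; $[\mathcal At_p]$ is a set of representatives of the isomorphism classes of atoric $p$-groups. For a finite $p$-group $P$, let $P^@=P/N$, where $N$ is a normal subgroup of $P$ maximal subject to $N\cap\Phi(P)=\mathbf 1$ (here $\Phi$ is the Frattini subgroup; $P^@$ is well defined up to isomorphism). For a finite $p$-group $G$ set $$\widetilde{e_G^G}=\frac1{|G|}\sum_{X\le G}|X|\,\mu(X,G)\,[G\times(G/X)]\in RB(G,G),$$ where $\mu$ is the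 Möbius function of the poset of subgroups of $G$ and $G\times (G/X)$ is the $(G,G)$-biset with $a(g,x)b=(agb,ax)$, and $$\varphi_{\mathbf 1}^G=\sum_{M\trianglelefteq G,\ M\le\Phi(G)}\mu_{\trianglelefteq G}(\mathbf 1,M)\ \widetilde{e_G^G}\,\big[(G\times G)/\Delta_M(G)\big]\,\widetilde{e_G^G},$$ where $\mu_{\trianglelefteq G}$ is the Möbius function of the poset of normal subgroups of $G$ and $\Delta_M(G)=\{(a,b)\mid ab^{-1}\in M\}$. A minimal section of $P$ is a pair $(T,S)$ of subgroups of $P$ with $S\trianglelefteq T$ and $S\le\Phi(T)$. For such $(T,S)$ let $$\epsilon_{T,S}^P=\frac1{|N_P(T)\cap N_P(S):T|}\,[P/S]\,\varphi_{\mathbf 1}^{T/S}\,[S\backslash P]\in RB(P,P),$$ where $P/S$ is viewed as a $(P,T/S)$-biset and $S\backslash P$ as a $(T/S,P)$-biset. For an atoric $p$-group $L$, let $b_L^P\in RB(P,P)$ be the sum of the elements $\epsilon_{T,S}^P$ over representatives $(T,S)$ of the $P$-conjugacy classes of minimal sections of $P$ with $(T/S)^@\cong L$. **Statement.** 1. For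 every atoric $p$-group $L$ and every $p$-biset functor $F$, the maps $F(b_L^P):F(P)\to F(P)$, for all finite $p$-groups $P$, form an endomorphism $F(b_L)$ of $F$. 2. The endomorphisms $F(b_L)$ commute with natural transformations $F\to G$ of $p$-biset functors; hence they define an element $\widehat b_L$ of the center of the category $\mathcal F_{p,R}$, and $\widehat b_L$ is idempotent. 3. The idempotents $\widehat b_L$, for $L\in[\mathcal At_p]$, are pairwise orthogonal, and their sum is the identity (at each finite $p$-group $P$ the sum is finite: for all but finitely many $L\in[\mathcal At_p]$ the map $F(b_L^P)$ is zero for every $F$). 4. For a $p$-biset functor $F$, let $\widehat b_LF\subseteq F$ be the image of $F(b_L)$. Then $F=\bigoplus_{L\in[\mathcal At_p]}\widehat b_LF$. 5. Let $\widehat b_L\mathcal F_{p,R}$ be the full subcategory of $\mathcal F_{p,R}$ consisting of the functors $F$ with $F=\widehat b_LF$. It is an abelian subcategory of $\mathcal F_{p,R}$ (it is abelian and its inclusion in $\mathcal F_{p,R}$ preserves finite limits and finite colimits), and the functor $$\mathcal F_{p,R}\to\prod_{L\in[\mathcal At_p]}\widehat b_L\mathcal F_{p,R},\qquad F\mapsto(\widehat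 b_LF)_{L\in[\mathcal At_p]},$$ is an equivalence of categories. -/

import Mathlib

namespace BisetFun

open CategoryTheory Limits MulOpposite TensorProduct

universe w u v

noncomputable section

/-! ### Finite bisets and the Burnside group -/

/-- A finite `(G, H)`-biset: a finite set with a left action of `G` and a right action of `H`
(that is, a left action of `Hᵐᵒᵖ`) which commute. We write `op h • x` for `x · h`. -/
structure FinBiset (G H : Type w) [Group G] [Group H] where
  carrier : Type w
  [finite : Finite carrier]
  [left : MulAction G carrier]
  [right : MulAction Hᵐᵒᵖ carrier]
  [comm : SMulCommClass G Hᵐᵒᵖ carrier]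

attribute [instance] FinBiset.finite FinBiset.left FinBiset.right FinBiset.comm

namespace FinBiset

variable {G H K M : Type w} [Group G] [Group H] [Group K] [Group M]

/-- Two finite bisets are isomorphic. -/
def Iso (X Y : FinBiset G H) : Prop :=
  ∃ e : X.carrier ≃ Y.carrier,
    (∀ (g : G) (x : X.carrier), e (g • x) = g • e x) ∧
      ∀ (h : H) (x : X.carrier), e (op h • x) = op h • e x

theorem Iso.rfl (X : FinBiset G H) : Iso X X :=
  ⟨Equiv.refl _, fun _ _ => Eq.refl _, fun _ _ => Eq.refl _⟩

theorem Iso.symm {X Y : FinBiset G H} (h : Iso X Y) : Iso Y X := by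
  obtain ⟨e, h1, h2⟩ := h
  refine ⟨e.symm, fun g x => ?_, fun g x => ?_⟩
  · rw [Equiv.symm_apply_eq, h1, Equiv.apply_symm_apply]
  · rw [Equiv.symm_apply_eq, h2, Equiv.apply_symm_apply]

theorem Iso.trans {X Y Z : FinBiset G H} (h : Iso X Y) (h' : Iso Y Z) : Iso X Z := by
  obtain ⟨e, h1, h2⟩ := h
  obtain ⟨f, k1, k2⟩ := h'
  exact ⟨e.trans f, fun g x => by simp [h1, k1], fun g x => by simp [h2, k2]⟩

instance setoid (G H : Type w) [Group G] [Group H] : Setoid (FinBiset G H) where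
  r := Iso
  iseqv := ⟨Iso.rfl, Iso.symm, Iso.trans⟩

/-- The empty biset. -/
def empty (G H : Type w) [Group G] [Group H] : FinBiset G H where
  carrier := PEmpty
  left := { smul := fun _ x => x, one_smul := fun _ => rfl, mul_smul := fun _ _ _ => rfl }
  right := { smul := fun _ x => x, one_smul := fun _ => rfl, mul_smul := fun _ _ _ => rfl }
  comm := @SMulCommClass.mk _ _ _ (_) (_) fun _ _ x => nomatch x

/-- The disjoint union of two bisets. -/
def sum (X Y : FinBiset G H) : FinBiset G H where
  carrier := X.carrier ⊕ Y.carrier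

theorem sum_congr {X X' Y Y' : FinBiset G H} (h : Iso X X') (h' : Iso Y Y') :
    Iso (sum X Y) (sum X' Y') := by
  obtain ⟨e, h1, h2⟩ := h
  obtain ⟨f, k1, k2⟩ := h'
  refine ⟨Equiv.sumCongr e f, ?_, ?_⟩
  · rintro g (x | x)
    · exact congrArg Sum.inl (h1 g x)
    · exact congrArg Sum.inr (k1 g x)
  · rintro g (x | x)
    · exact congrArg Sum.inl (h2 g x)
    · exact congrArg Sum.inr (k2 g x)

/-- The group `G` as a `(G, G)`-biset, by left and right multiplication. -/
def regular (G : Type w) [Group G] [Finite G] : FinBiset G G where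
  carrier := G

/-- The equivalence relation on `U × V` whose classes are the orbits of the right action
`(u, v) · h = (u h, h⁻¹ v)` of `H`. -/
def tensorRel (U : FinBiset G H) (V : FinBiset H K) : Setoid (U.carrier × V.carrier) where
  r x y := ∃ h : H, y = (op h • x.1, h⁻¹ • x.2)
  iseqv :=
    { refl := fun x => ⟨1, by simp⟩
      symm := by
        rintro x y ⟨h, rfl⟩
        exact ⟨h⁻¹, by simp [smul_smul]⟩
      trans := by
        rintro x y z ⟨h, rfl⟩ ⟨k, rfl⟩
        exact ⟨h * k, by simp [smul_smul]⟩ }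

/-- The product `U ×_H V = (U × V) / H` of bisets. -/
def tensor (U : FinBiset G H) (V : FinBiset H K) : FinBiset G K where
  carrier := Quotient (tensorRel U V)
  finite := Quotient.finite _
  left :=
    { smul := fun g => Quotient.map' (fun x => (g • x.1, x.2)) (by
        rintro x y ⟨h, rfl⟩
        exact ⟨h, by simp [smul_comm g (op h)]⟩)
      one_smul := by
        rintro ⟨x⟩
        exact congrArg (Quotient.mk _) (by simp)
      mul_smul := by
        rintro a b ⟨x⟩
        exact congrArg (Quotient.mk _) (by simp [mul_smul]) }
  right :=
    { smul := fun k => Quotient.map' (fun x => (x.1, k • x.2)) (by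
        rintro x y ⟨h, rfl⟩
        exact ⟨h, by simp [smul_comm h⁻¹ k]⟩)
      one_smul := by
        rintro ⟨x⟩
        exact congrArg (Quotient.mk _) (by simp)
      mul_smul := by
        rintro a b ⟨x⟩
        exact congrArg (Quotient.mk _) (by simp [mul_smul]) }
  comm := @SMulCommClass.mk _ _ _ (_) (_) (by
    rintro g k ⟨x⟩
    rfl)

/-- The class of `(u, v)` in `U ×_H V`. -/
def tmk (U : FinBiset G H) (V : FinBiset H K) (u : U.carrier) (v : V.carrier) :
    (tensor U V).carrier := Quotient.mk (tensorRel U V) (u, v)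

theorem tmk_smul (U : FinBiset G H) (V : FinBiset H K) (u : U.carrier) (h : H) (v : V.carrier) :
    tmk U V (op h • u) v = tmk U V u (h • v) :=
  (Quotient.sound (s := tensorRel U V) ⟨h, by simp⟩ : tmk U V u (h • v) = _).symm

theorem smul_tmk (U : FinBiset G H) (V : FinBiset H K) (g : G) (u : U.carrier) (v : V.carrier) :
    g • tmk U V u v = tmk U V (g • u) v := rfl

theorem op_smul_tmk (U : FinBiset G H) (V : FinBiset H K) (k : K) (u : U.carrier)
    (v : V.carrier) : op k • tmk U V u v = tmk U V u (op k • v) := rfl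

/-- A function out of `U ×_H V`. -/
def tlift (U : FinBiset G H) (V : FinBiset H K) {A : Sort*} (f : U.carrier → V.carrier → A)
    (hf : ∀ u (h : H) v, f (op h • u) v = f u (h • v)) : (tensor U V).carrier → A :=
  Quotient.lift (fun x => f x.1 x.2) (by
    rintro x y ⟨h, rfl⟩
    simp [hf])

theorem tlift_tmk (U : FinBiset G H) (V : FinBiset H K) {A : Sort*}
    (f : U.carrier → V.carrier → A) (hf : ∀ u (h : H) v, f (op h • u) v = f u (h • v))
    (u : U.carrier) (v : V.carrier) : tlift U V f hf (tmk U V u v) = f u v := rfl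

theorem tind {U : FinBiset G H} {V : FinBiset H K} {P : (tensor U V).carrier → Prop}
    (h : ∀ u v, P (tmk U V u v)) (x : (tensor U V).carrier) : P x := by
  obtain ⟨u, v⟩ := x
  exact h u v

theorem tensor_congr {U U' : FinBiset G H} {V V' : FinBiset H K} (h : Iso U U') (h' : Iso V V') :
    Iso (tensor U V) (tensor U' V') := by
  obtain ⟨e, e1, e2⟩ := h
  obtain ⟨f, f1, f2⟩ := h'
  have e2' : ∀ (k : H) x, e.symm (op k • x) = op k • e.symm x := fun k x => by
    rw [Equiv.symm_apply_eq, e2, Equiv.apply_symm_apply]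
  have f1' : ∀ (k : H) x, f.symm (k • x) = k • f.symm x := fun k x => by
    rw [Equiv.symm_apply_eq, f1, Equiv.apply_symm_apply]
  refine ⟨⟨tlift U V (fun u v => tmk U' V' (e u) (f v)) ?_,
    tlift U' V' (fun u v => tmk U V (e.symm u) (f.symm v)) ?_, ?_, ?_⟩, ?_, ?_⟩
  · intro u k v
    rw [e2, f1, tmk_smul]
  · intro u k v
    rw [e2', f1', tmk_smul]
  · exact tind fun u v => by simp [tlift_tmk]
  · exact tind fun u v => by simp [tlift_tmk]
  · exact fun g => tind fun u v => by simp [tlift_tmk, smul_tmk, e1]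
  · exact fun g => tind fun u v => by simp [tlift_tmk, op_smul_tmk, f2]

theorem tensor_assoc (U : FinBiset G H) (V : FinBiset H K) (W : FinBiset K M) :
    Iso (tensor (tensor U V) W) (tensor U (tensor V W)) := by
  refine ⟨⟨tlift _ _ (fun x w => tlift U V (fun u v => tmk U (tensor V W) u (tmk V W v w)) ?_ x) ?_,
    tlift _ _ (fun u x => tlift V W (fun v w => tmk (tensor U V) W (tmk U V u v) w) ?_ x) ?_,
    ?_, ?_⟩, ?_, ?_⟩
  · intro u h v
    rw [tmk_smul, smul_tmk]
  · intro x k w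
    revert x
    exact tind fun u v => by simp only [op_smul_tmk, tlift_tmk, tmk_smul]
  · intro v k w
    rw [← tmk_smul, op_smul_tmk]
  · intro u h x
    revert x
    exact tind fun v w => by simp only [smul_tmk, tlift_tmk, tmk_smul]
  · refine tind fun x w => ?_
    revert x
    exact tind fun u v => rfl
  · refine tind fun u x => ?_
    revert x
    exact tind fun v w => rfl
  · refine fun g => tind fun x w => ?_
    revert x
    exact tind fun u v => rfl
  · refine fun g => tind fun x w => ?_
    revert x
    exact tind fun u v => rfl

theorem regular_tensor [Finite G] (U : FinBiset G H) : Iso (tensor (regular G) U) U := by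
  have key : ∀ (g : G) (u : U.carrier),
      tmk (regular G) U (1 : G) (g • u) = tmk (regular G) U g u := fun g u =>
    (tmk_smul (regular G) U (1 : G) g u).symm.trans
      (congrArg (fun a => tmk (regular G) U a u) (one_mul g))
  refine ⟨⟨tlift (regular G) U (fun (g : G) u => g • u) ?_,
    fun u => tmk (regular G) U (1 : G) u, ?_, ?_⟩, ?_, ?_⟩
  · exact fun (g : G) (h : G) u => mul_smul g h u
  · exact tind fun (g : G) u => key g u
  · exact fun u => one_smul G u
  · exact fun g => tind fun (x : G) u => mul_smul g x u
  · exact fun h => tind fun (x : G) u => smul_comm x (op h) u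

theorem tensor_regular [Finite H] (U : FinBiset G H) : Iso (tensor U (regular H)) U := by
  have key : ∀ (h : H) (u : U.carrier),
      tmk U (regular H) (op h • u) (1 : H) = tmk U (regular H) u h := fun h u =>
    (tmk_smul U (regular H) u h (1 : H)).trans
      (congrArg (fun a => tmk U (regular H) u a) (mul_one h))
  refine ⟨⟨tlift U (regular H) (fun u (h : H) => op h • u) ?_,
    fun u => tmk U (regular H) u (1 : H), ?_, ?_⟩, ?_, ?_⟩
  · exact fun u (g : H) (h : H) => (mul_smul (op h) (op g) u).symm
  · exact tind fun u (h : H) => key h u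
  · exact fun u => one_smul Hᵐᵒᵖ u
  · exact fun g => tind fun u (x : H) => (smul_comm g (op x) u).symm
  · exact fun h => tind fun u (x : H) => mul_smul (op h) (op x) u

theorem sum_tensor (U U' : FinBiset G H) (V : FinBiset H K) :
    Iso (tensor (sum U U') V) (sum (tensor U V) (tensor U' V)) := by
  refine ⟨⟨tlift _ _ (fun x v => Sum.elim (fun u => Sum.inl (tmk U V u v))
      (fun u => Sum.inr (tmk U' V u v)) x) ?_,
    Sum.elim (tlift U V (fun u v => tmk (sum U U') V (Sum.inl u) v) ?_)
      (tlift U' V (fun u v => tmk (sum U U') V (Sum.inr u) v) ?_), ?_, ?_⟩, ?_, ?_⟩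
  · rintro (u | u) h v
    · exact congrArg Sum.inl (tmk_smul U V u h v)
    · exact congrArg Sum.inr (tmk_smul U' V u h v)
  · exact fun u h v => tmk_smul (sum U U') V (Sum.inl u) h v
  · exact fun u h v => tmk_smul (sum U U') V (Sum.inr u) h v
  · refine tind ?_
    rintro (u | u) v <;> rfl
  · rintro (x | x)
    · revert x
      exact tind fun u v => rfl
    · revert x
      exact tind fun u v => rfl
  · intro g
    refine tind ?_
    rintro (u | u) v <;> rfl
  · intro g
    refine tind ?_
    rintro (u | u) v <;> rfl

theorem tensor_sum (U : FinBiset G H) (V V' : FinBiset H K) :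
    Iso (tensor U (sum V V')) (sum (tensor U V) (tensor U V')) := by
  refine ⟨⟨tlift _ _ (fun u x => Sum.elim (fun v => Sum.inl (tmk U V u v))
      (fun v => Sum.inr (tmk U V' u v)) x) ?_,
    Sum.elim (tlift U V (fun u v => tmk U (sum V V') u (Sum.inl v)) ?_)
      (tlift U V' (fun u v => tmk U (sum V V') u (Sum.inr v)) ?_), ?_, ?_⟩, ?_, ?_⟩
  · rintro u h (v | v)
    · exact congrArg Sum.inl (tmk_smul U V u h v)
    · exact congrArg Sum.inr (tmk_smul U V' u h v)
  · exact fun u h v => tmk_smul U (sum V V') u h (Sum.inl v)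
  · exact fun u h v => tmk_smul U (sum V V') u h (Sum.inr v)
  · refine tind ?_
    rintro u (v | v) <;> rfl
  · rintro (x | x)
    · revert x
      exact tind fun u v => rfl
    · revert x
      exact tind fun u v => rfl
  · intro g
    refine tind ?_
    rintro u (v | v) <;> rfl
  · intro g
    refine tind ?_
    rintro u (v | v) <;> rfl

theorem empty_tensor (V : FinBiset H K) : Iso (tensor (empty G H) V) (empty G K) := by
  have h1 : (tensor (empty G H) V).carrier → False := tind fun u _ => nomatch u
  exact ⟨⟨fun x => (h1 x).elim, fun x => (nomatch x), fun x => (h1 x).elim, fun x => nomatch x⟩,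
    fun _ x => (h1 x).elim, fun _ x => (h1 x).elim⟩

theorem tensor_empty (U : FinBiset G H) : Iso (tensor U (empty H K)) (empty G K) := by
  have h1 : (tensor U (empty H K)).carrier → False := tind fun _ v => nomatch v
  exact ⟨⟨fun x => (h1 x).elim, fun x => (nomatch x), fun x => (h1 x).elim, fun x => nomatch x⟩,
    fun _ x => (h1 x).elim, fun _ x => (h1 x).elim⟩

end FinBiset

/-- Isomorphism classes of finite `(G, H)`-bisets. -/
def BisetClass (G H : Type w) [Group G] [Group H] : Type (w + 1) :=
  Quotient (FinBiset.setoid G H)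

namespace BisetClass

variable {G H K M : Type w} [Group G] [Group H] [Group K] [Group M]

/-- The isomorphism class of a finite biset. -/
def mk (X : FinBiset G H) : BisetClass G H := Quotient.mk _ X

theorem mk_eq {X Y : FinBiset G H} (h : FinBiset.Iso X Y) : mk X = mk Y := Quotient.sound h

theorem ind {P : BisetClass G H → Prop} (h : ∀ X, P (mk X)) (x : BisetClass G H) : P x :=
  Quotient.ind h x

instance : Zero (BisetClass G H) := ⟨mk (FinBiset.empty G H)⟩

instance : Add (BisetClass G H) :=
  ⟨Quotient.map₂ FinBiset.sum fun _ _ h _ _ h' => FinBiset.sum_congr h h'⟩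

/-- Isomorphism classes form a commutative monoid under disjoint union. -/
instance : AddCommMonoid (BisetClass G H) where
  nsmul := nsmulRec
  add_assoc := by
    rintro ⟨X⟩ ⟨Y⟩ ⟨Z⟩
    refine mk_eq ⟨Equiv.sumAssoc _ _ _, ?_, ?_⟩
    · rintro g ((x | x) | x) <;> rfl
    · rintro g ((x | x) | x) <;> rfl
  zero_add := by
    rintro ⟨X⟩
    refine mk_eq ⟨Equiv.emptySum PEmpty _, ?_, ?_⟩
    · rintro g (x | x)
      · exact x.elim
      · rfl
    · rintro g (x | x)
      · exact x.elim
      · rfl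
  add_zero := by
    rintro ⟨X⟩
    refine mk_eq ⟨Equiv.sumEmpty _ PEmpty, ?_, ?_⟩
    · rintro g (x | x)
      · rfl
      · exact x.elim
    · rintro g (x | x)
      · rfl
      · exact x.elim
  add_comm := by
    rintro ⟨X⟩ ⟨Y⟩
    refine mk_eq ⟨Equiv.sumComm _ _, ?_, ?_⟩
    · rintro g (x | x) <;> rfl
    · rintro g (x | x) <;> rfl
/-- The biadditive product of isomorphism classes induced by `(U, V) ↦ U ×_H V`. -/
def mul : BisetClass G H →+ BisetClass H K →+ BisetClass G K :=
  { toFun := fun x =>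
      { toFun := fun y => Quotient.map₂ FinBiset.tensor
          (fun _ _ h _ _ h' => FinBiset.tensor_congr h h') x y
        map_zero' := by
          revert x
          exact ind fun U => mk_eq (FinBiset.tensor_empty U)
        map_add' := by
          revert x
          refine ind fun U => ?_
          rintro ⟨V⟩ ⟨V'⟩
          exact mk_eq (FinBiset.tensor_sum U V V') }
    map_zero' := by
      ext y
      revert y
      exact ind fun V => mk_eq (FinBiset.empty_tensor V)
    map_add' := by
      rintro ⟨U⟩ ⟨U'⟩
      ext y
      revert y
      exact ind fun V => mk_eq (FinBiset.sum_tensor U U' V) }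

end BisetClass
/-- The Burnside group `B(G, H)`: the Grothendieck group of finite `(G, H)`-bisets for disjoint
unions. -/
def Burnside (G H : Type w) [Group G] [Group H] : Type (w + 1) :=
  Algebra.GrothendieckAddGroup (BisetClass G H)

instance (G H : Type w) [Group G] [Group H] : AddCommGroup (Burnside G H) :=
  inferInstanceAs (AddCommGroup (Algebra.GrothendieckAddGroup (BisetClass G H)))

section Burnside

variable {G H K M : Type w} [Group G] [Group H] [Group K] [Group M]

/-- The class in `B(G, H)` of an isomorphism class of bisets. -/
def Burnside.of : BisetClass G H →+ Burnside G H :=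
  Algebra.GrothendieckAddGroup.of

/-- The universal property of the Grothendieck group. -/
def Burnside.lift {A : Type*} [AddCommGroup A] (f : BisetClass G H →+ A) : Burnside G H →+ A :=
  Algebra.GrothendieckAddGroup.lift f

theorem Burnside.lift_of {A : Type*} [AddCommGroup A] (f : BisetClass G H →+ A)
    (x : BisetClass G H) : Burnside.lift f (Burnside.of x) = f x :=
  DFunLike.congr_fun (Algebra.GrothendieckAddGroup.lift.symm_apply_apply f) x

theorem Burnside.hom_ext {A : Type*} [AddCommGroup A] {f g : Burnside G H →+ A}
    (h : ∀ U : FinBiset G H, f (of (BisetClass.mk U)) = g (of (BisetClass.mk U))) : f = g :=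
  Algebra.GrothendieckAddGroup.lift.symm.injective (AddMonoidHom.ext (BisetClass.ind h))

/-- The biadditive product `×_H : B(G, H) × B(H, K) → B(G, K)`. -/
def burnsideMul : Burnside G H →+ Burnside H K →+ Burnside G K :=
  Burnside.lift
    { toFun := fun x => Burnside.lift (Burnside.of.comp (BisetClass.mul x))
      map_zero' := Burnside.hom_ext fun V => by simp [Burnside.lift_of]
      map_add' := fun x y => Burnside.hom_ext fun V => by simp [Burnside.lift_of] }

theorem burnsideMul_of (x : BisetClass G H) (y : BisetClass H K) :
    burnsideMul (Burnside.of x) (Burnside.of y) = Burnside.of (BisetClass.mul x y) := by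
  simp [burnsideMul, Burnside.lift_of]

/-- `RB(G, H) = R ⊗_ℤ B(G, H)`. -/
abbrev RBurnside (R : Type u) [CommRing R] (G H : Type w) [Group G] [Group H] :
    Type (max u (w + 1)) :=
  R ⊗[ℤ] Burnside G H

variable (R : Type u) [CommRing R]

/-- The class of a finite biset `U` in `RB(G, H)`. -/
def cls (U : FinBiset G H) : RBurnside R G H :=
  1 ⊗ₜ[ℤ] (Burnside.of (BisetClass.mk U))

theorem cls_eq {U V : FinBiset G H} (h : FinBiset.Iso U V) : cls R U = cls R V := by
  rw [cls, BisetClass.mk_eq h, cls]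

theorem RBurnside.hom_ext {A : Type*} [AddCommGroup A] [Module R A]
    {f g : RBurnside R G H →ₗ[R] A} (h : ∀ U : FinBiset G H, f (cls R U) = g (cls R U)) :
    f = g := by
  apply (LinearMap.liftBaseChangeEquiv (M := Burnside G H) (R := ℤ) R).symm.injective
  have h2 := Burnside.hom_ext (f := ((LinearMap.liftBaseChangeEquiv R).symm f).toAddMonoidHom)
    (g := ((LinearMap.liftBaseChangeEquiv R).symm g).toAddMonoidHom) h
  exact LinearMap.ext fun x => DFunLike.congr_fun h2 x

/-- The `R`-bilinear product `×_H : RB(G, H) × RB(H, K) → RB(G, K)`. -/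
def rbMul : RBurnside R G H →ₗ[R] RBurnside R H K →ₗ[R] RBurnside R G K :=
  LinearMap.liftBaseChange R
    (LinearMap.baseChangeHom ℤ R (Burnside H K) (Burnside G K) ∘ₗ
      (addMonoidHomLequivInt ℤ).toLinearMap ∘ₗ
        (burnsideMul (G := G) (H := H) (K := K)).toIntLinearMap)

theorem rbMul_cls (U : FinBiset G H) (V : FinBiset H K) :
    rbMul R (cls R U) (cls R V) = cls R (U.tensor V) := by
  simp [rbMul, cls, burnsideMul_of]
  rfl

theorem rbMul_assoc (a : RBurnside R G H) (b : RBurnside R H K) (c : RBurnside R K M) :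
    rbMul R (rbMul R a b) c = rbMul R a (rbMul R b c) := by
  have h1 : ∀ (U : FinBiset G H) (V : FinBiset H K) (c : RBurnside R K M),
      rbMul R (rbMul R (cls R U) (cls R V)) c = rbMul R (cls R U) (rbMul R (cls R V) c) :=
    fun U V c => DFunLike.congr_fun (f := rbMul R (rbMul R (cls R U) (cls R V)))
      (g := rbMul R (cls R U) ∘ₗ rbMul R (cls R V)) (RBurnside.hom_ext R fun W => by
        simp only [LinearMap.comp_apply, rbMul_cls]
        exact cls_eq R (FinBiset.tensor_assoc U V W)) c
  have h2 : ∀ (U : FinBiset G H) (b : RBurnside R H K) (c : RBurnside R K M),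
      rbMul R (rbMul R (cls R U) b) c = rbMul R (cls R U) (rbMul R b c) :=
    fun U b c => DFunLike.congr_fun (f := (rbMul R).flip c ∘ₗ rbMul R (cls R U))
      (g := rbMul R (cls R U) ∘ₗ (rbMul R).flip c) (RBurnside.hom_ext R fun V => h1 U V c) b
  exact DFunLike.congr_fun (f := (rbMul R).flip c ∘ₗ (rbMul R).flip b)
    (g := (rbMul R).flip (rbMul R b c)) (RBurnside.hom_ext R fun U => h2 U b c) a

theorem one_rbMul [Finite G] (a : RBurnside R G H) : rbMul R (cls R (FinBiset.regular G)) a = a := by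
  have h : rbMul R (cls R (FinBiset.regular G)) = (LinearMap.id : RBurnside R G H →ₗ[R] _) :=
    RBurnside.hom_ext R fun U => by
      rw [rbMul_cls, cls_eq R (FinBiset.regular_tensor U)]
      rfl
  rw [h]
  rfl

theorem rbMul_one [Finite H] (a : RBurnside R G H) : rbMul R a (cls R (FinBiset.regular H)) = a := by
  have h : (rbMul R).flip (cls R (FinBiset.regular H)) = (LinearMap.id : RBurnside R G H →ₗ[R] _) :=
    RBurnside.hom_ext R fun U => by
      rw [LinearMap.flip_apply, rbMul_cls, cls_eq R (FinBiset.tensor_regular U)]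
      rfl
  exact DFunLike.congr_fun h a

end Burnside

/-! ### The biset category -/

/-- The objects of the biset category `RC`: finite groups. -/
structure BisetCat (R : Type u) : Type (w + 1) where
  carrier : Type w
  [group : Group carrier]
  [finite : Finite carrier]

attribute [instance] BisetCat.group BisetCat.finite

variable (R : Type u) [CommRing R]

/-- The biset category `RC`: `Hom(G, H) = RB(H, G)`, and composition is the product `×_H`. -/
instance : Category.{max u (w + 1)} (BisetCat.{w} R) where
  Hom G H := RBurnside R H.carrier G.carrier
  id G := cls R (FinBiset.regular G.carrier)
  comp f g := rbMul R g f
  id_comp f := rbMul_one R f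
  comp_id f := one_rbMul R f
  assoc f g h := (rbMul_assoc R h g f).symm

instance : Preadditive (BisetCat.{w} R) where
  homGroup G H := inferInstanceAs (AddCommGroup (RBurnside R H.carrier G.carrier))
  add_comp G H K f f' g :=
    (rbMul R (show RBurnside R K.carrier H.carrier from g)).map_add
      (show RBurnside R H.carrier G.carrier from f) f'
  comp_add G H K f g g' :=
    LinearMap.map_add₂ (rbMul R) (show RBurnside R K.carrier H.carrier from g) g'
      (show RBurnside R H.carrier G.carrier from f)

instance : Linear R (BisetCat.{w} R) where
  homModule G H := inferInstanceAs (Module R (RBurnside R H.carrier G.carrier))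
  smul_comp G H K r f g :=
    (rbMul R (show RBurnside R K.carrier H.carrier from g)).map_smul r
      (show RBurnside R H.carrier G.carrier from f)
  comp_smul G H K f r g :=
    LinearMap.map_smul₂ (rbMul R) r (show RBurnside R K.carrier H.carrier from g)
      (show RBurnside R H.carrier G.carrier from f)

/-- The full subcategory `RC_p` of `RC` consisting of the finite `p`-groups. -/
abbrev PBisetCat (p : ℕ) : Type (w + 1) :=
  ObjectProperty.FullSubcategory fun G : BisetCat.{w} R => IsPGroup p G.carrier

set_option linter.checkUnivs false in
/-- The category `F_{p,R}` of `p`-biset functors over `R`: the `R`-linear functors from `RC_p` to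
`R`-modules, with natural transformations as morphisms. -/
abbrev PBisetFunctor (p : ℕ) :=
  ObjectProperty.FullSubcategory
    fun F : PBisetCat.{w} R p ⥤ ModuleCat.{v} R => F.Additive ∧ F.Linear R

/-! ### Some bisets -/

section Bisets

variable {G H : Type w} [Group G] [Group H] [Finite G] [Finite H]

/-- The transitive `(G, H)`-biset `(G × H) / L`, with `a · (g, h) L · b = (a g, b⁻¹ h) L`. -/
def transitive (L : Subgroup (G × H)) : FinBiset G H where
  carrier := (G × H) ⧸ L
  left := MulAction.compHom _ (MonoidHom.inl G H)
  right :=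
    { smul := fun b x => ((1 : G), b.unop⁻¹) • x
      one_smul := fun x => by
        change ((1 : G), (1 : H)⁻¹) • x = x
        rw [inv_one, ← Prod.one_eq_mk, one_smul]
      mul_smul := fun b c x => by
        change ((1 : G), (c.unop * b.unop)⁻¹) • x
          = ((1 : G), b.unop⁻¹) • ((1 : G), c.unop⁻¹) • x
        rw [smul_smul, Prod.mk_mul_mk, mul_inv_rev, one_mul] }
  comm := @SMulCommClass.mk _ _ _ (_) (_) fun a b x => by
    change (a, (1 : H)) • ((1 : G), b.unop⁻¹) • x = ((1 : G), b.unop⁻¹) • (a, (1 : H)) • x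
    simp [smul_smul]

/-- For a finite `G`-set `X`, the `(G, G)`-biset `G × X` with `a (g, x) b = (a g b, a x)`. -/
def tilde (X : Type w) [Finite X] [MulAction G X] : FinBiset G G where
  carrier := G × X
  right :=
    { smul := fun b y => (y.1 * b.unop, y.2)
      one_smul := fun y => Prod.ext (mul_one y.1) rfl
      mul_smul := fun b c y => Prod.ext (mul_assoc y.1 c.unop b.unop).symm rfl }
  comm := @SMulCommClass.mk _ _ _ (_) (_) fun a b y =>
    Prod.ext (mul_assoc a y.1 b.unop).symm rfl

end Bisets

/-- A section `(T, S)` of `G`: subgroups `S ⊴ T ≤ G`. -/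
@[ext]
structure Sec (G : Type w) [Group G] where
  T : Subgroup G
  S : Subgroup G
  le : S ≤ T
  normal : (S.subgroupOf T).Normal

namespace Sec

variable {G : Type w} [Group G]

instance (s : Sec G) : (s.S.subgroupOf s.T).Normal := s.normal

/-- The quotient group `T / S`. -/
abbrev Quot (s : Sec G) : Type w := s.T ⧸ s.S.subgroupOf s.T

theorem conj_mem (s : Sec G) {t x : G} (ht : t ∈ s.T) (hx : x ∈ s.S) : t * x * t⁻¹ ∈ s.S :=
  Subgroup.mem_subgroupOf.mp
    (s.normal.conj_mem ⟨x, s.le hx⟩ (Subgroup.mem_subgroupOf.mpr hx) ⟨t, ht⟩)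

theorem conj_mem' (s : Sec G) {t x : G} (ht : t ∈ s.T) (hx : x ∈ s.S) : t⁻¹ * x * t ∈ s.S := by
  simpa using s.conj_mem (s.T.inv_mem ht) hx

variable [Finite G]

/-- The `(G, T/S)`-biset `G / S`, with `a · g S · t S = a g t S`. -/
def indinf (s : Sec G) : FinBiset G s.Quot where
  carrier := G ⧸ s.S
  right :=
    { smul := fun q x => Quotient.map₂ (fun (t : s.T) (g : G) => g * t) (by
        intro t t' ht g g' hg
        rw [← Quotient.eq_iff_equiv] at ht hg ⊢
        have ht' : (t : G)⁻¹ * t' ∈ s.S := Subgroup.mem_subgroupOf.mp (QuotientGroup.eq.mp ht)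
        have hg' : g⁻¹ * g' ∈ s.S := QuotientGroup.eq.mp hg
        refine QuotientGroup.eq.mpr ?_
        have := s.S.mul_mem (s.conj_mem' t.2 hg') ht'
        simpa [mul_assoc] using this) q.unop x
      one_smul := by
        rintro ⟨x⟩
        exact congrArg (Quotient.mk _) (mul_one x)
      mul_smul := by
        rintro ⟨⟨a⟩⟩ ⟨⟨b⟩⟩ ⟨x⟩
        exact congrArg (Quotient.mk _) (mul_assoc x (b : G) (a : G)).symm }
  comm := @SMulCommClass.mk _ _ _ (_) (_) (by
    rintro a ⟨⟨t⟩⟩ ⟨x⟩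
    exact congrArg (Quotient.mk _) (mul_assoc a x (t : G)).symm)

/-- The `(T/S, G)`-biset `S \ G`, with `t S · S g · a = S t g a`. -/
def defres (s : Sec G) : FinBiset s.Quot G where
  carrier := Quotient (QuotientGroup.rightRel s.S)
  finite := Quotient.finite _
  left :=
    { smul := fun q x => Quotient.map₂ (fun (t : s.T) (g : G) => (t : G) * g) (by
        intro t t' ht g g' hg
        have ht' : (t : G)⁻¹ * t' ∈ s.S :=
          Subgroup.mem_subgroupOf.mp (QuotientGroup.leftRel_apply.mp ht)
        have hg' : g' * g⁻¹ ∈ s.S := QuotientGroup.rightRel_apply.mp hg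
        refine QuotientGroup.rightRel_apply.mpr ?_
        have := s.conj_mem t.2 (s.S.mul_mem ht' hg')
        have h2 := s.conj_mem t'.2 hg'
        have h3 := s.conj_mem t.2 ht'
        have := s.S.mul_mem h2 h3
        simpa [mul_assoc] using this) q x
      one_smul := by
        rintro ⟨x⟩
        exact congrArg (Quotient.mk _) (one_mul x)
      mul_smul := by
        rintro ⟨a⟩ ⟨b⟩ ⟨x⟩
        exact congrArg (Quotient.mk _) (mul_assoc (a : G) (b : G) x) }
  right :=
    { smul := fun b x => Quotient.map (fun g : G => g * b.unop) (by
        intro g g' hg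
        have hg' : g' * g⁻¹ ∈ s.S := QuotientGroup.rightRel_apply.mp hg
        refine QuotientGroup.rightRel_apply.mpr ?_
        simpa [mul_assoc] using hg') x
      one_smul := by
        rintro ⟨x⟩
        exact congrArg (Quotient.mk _) (mul_one x)
      mul_smul := by
        rintro a b ⟨x⟩
        exact congrArg (Quotient.mk _) (mul_assoc x b.unop a.unop).symm }
  comm := @SMulCommClass.mk _ _ _ (_) (_) (by
    rintro ⟨t⟩ b ⟨x⟩
    exact congrArg (Quotient.mk _) (mul_assoc (t : G) x b.unop).symm)

end Sec

/-! ### The idempotents `φ_1^G`, `ε_{T,S}^G` and `b_L^P` -/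

/-- The Möbius function of a finite poset. -/
def moebius {α : Type*} [PartialOrder α] [Finite α] (x y : α) : ℤ := by
  classical
  letI := Fintype.ofFinite α
  letI : LocallyFiniteOrder α := Fintype.toLocallyFiniteOrder
  exact IncidenceAlgebra.mu ℤ x y

section Idempotents

variable (G : Type w) [Group G] [Finite G]

instance : Fintype (Subgroup G) := Fintype.ofFinite _

instance : Fintype {N : Subgroup G // N.Normal} := Fintype.ofFinite _

/-- The image in `RB(G, G)` of the idempotent
`e_G^G = |G|⁻¹ ∑_{X ≤ G} |X| μ(X, G) [G/X]` of `RB(G)` under the linear map induced by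
`X ↦ tilde X`. The scalar `|G|⁻¹` is meaningful if `|G|` is invertible in `R`. -/
def eTilde : RBurnside R G G :=
  Ring.inverse (Nat.card G : R) •
    ∑ X : Subgroup G, ((Nat.card X : ℤ) * moebius X ⊤) • cls R (tilde (G := G) (G ⧸ X))

/-- The element `Y_L` of `RB(G, G)`. -/
def Y {G : Type w} [Group G] [Finite G] (L : Subgroup (G × G)) : RBurnside R G G :=
  rbMul R (rbMul R (eTilde R G) (cls R (transitive L))) (eTilde R G)

/-- The subgroup `Δ_N(G) = {(a, b) | a b⁻¹ ∈ N}` of `G × G`. -/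
def Delta {G : Type w} [Group G] (N : Subgroup G) (hN : N.Normal) : Subgroup (G × G) where
  carrier := {x | x.1 * x.2⁻¹ ∈ N}
  one_mem' := by simp
  mul_mem' := by
    rintro ⟨a, b⟩ ⟨c, d⟩ h h'
    have := N.mul_mem (hN.conj_mem _ h' a) h
    simpa [mul_assoc] using this
  inv_mem' := by
    rintro ⟨a, b⟩ h
    have := hN.conj_mem _ (N.inv_mem h) a⁻¹
    simpa [mul_assoc] using this

open Classical in
/-- The idempotent `φ_1^G`: the sum of `μ(1, M) Y_{Δ_M(G)}` over the normal subgroups `M` of `G`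
contained in the Frattini subgroup, where `μ` is the Möbius function of the poset of normal
subgroups of `G`. -/
def phiOne : RBurnside R G G :=
  ∑ M : {N : Subgroup G // N.Normal} with M.1 ≤ frattini G,
    moebius (⟨⊥, inferInstance⟩ : {N : Subgroup G // N.Normal}) M • Y R (Delta M.1 M.2)

/-- Minimal sections: sections `(T, S)` with `S ≤ Φ(T)`. -/
def MinSec : Type w := {s : Sec G // s.S.subgroupOf s.T ≤ frattini s.T}

instance : Finite (MinSec G) :=
  Finite.of_injective (fun s : MinSec G => (s.1.T, s.1.S)) fun _ _ h =>
    Subtype.ext (Sec.ext (congrArg Prod.fst h) (congrArg Prod.snd h))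

/-- Conjugacy of minimal sections: `(T', S') = (g T g⁻¹, g S g⁻¹)` for some `g` in `G`. -/
instance MinSec.conj : Setoid (MinSec G) where
  r s t := ∃ g : G, (∀ x, x ∈ t.1.T ↔ g⁻¹ * x * g ∈ s.1.T) ∧
    ∀ x, x ∈ t.1.S ↔ g⁻¹ * x * g ∈ s.1.S
  iseqv :=
    { refl := fun s => ⟨1, by simp, by simp⟩
      symm := by
        rintro s t ⟨g, h1, h2⟩
        exact ⟨g⁻¹, fun x => by simp [h1, mul_assoc], fun x => by simp [h2, mul_assoc]⟩
      trans := by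
        rintro s t u ⟨g, h1, h2⟩ ⟨k, h3, h4⟩
        exact ⟨k * g, fun x => by simp [h1, h3, mul_assoc],
          fun x => by simp [h2, h4, mul_assoc]⟩ }

instance : Fintype (Quotient (MinSec.conj G)) := Fintype.ofFinite _

variable {G} in
/-- The idempotent `ε_{T,S}^G = |N_G(T, S) : T|⁻¹ Indinf_{T/S}^G φ_1^{T/S} Defres_{T/S}^G` of
`RB(G, G)`, where `N_G(T, S) = N_G(T) ∩ N_G(S)`. -/
def eps (s : Sec G) : RBurnside R G G :=
  Ring.inverse ((s.T.relIndex (Subgroup.normalizer (s.T : Set G) ⊓ Subgroup.normalizer (s.S : Set G)) : ℕ) : R) •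
    rbMul R (rbMul R (cls R s.indinf) (phiOne R s.Quot)) (cls R s.defres)

end Idempotents

section Atoric

/-- A subgroup is an elementary abelian `p`-group. -/
def IsElemAb (p : ℕ) {G : Type w} [Group G] (E : Subgroup G) : Prop :=
  (∀ x ∈ E, ∀ y ∈ E, x * y = y * x) ∧ ∀ x ∈ E, x ^ p = 1

/-- `G` is the (internal) direct product of its subgroups `E` and `Q`. -/
def IsInternalProd {G : Type w} [Group G] (E Q : Subgroup G) : Prop :=
  (∀ x ∈ E, ∀ y ∈ Q, x * y = y * x) ∧ E ⊓ Q = ⊥ ∧ E ⊔ Q = ⊤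

/-- The class of atoric `p`-groups: finite `p`-groups `P` which do not admit any decomposition
`P = E × Q` with `E` a non-trivial elementary abelian `p`-group. -/
structure AtoricGroup (p : ℕ) : Type (w + 1) where
  carrier : Type w
  [group : Group carrier]
  [finite : Finite carrier]
  isPGroup : IsPGroup p carrier
  atoric : ¬ ∃ E Q : Subgroup carrier, E ≠ ⊥ ∧ IsElemAb p E ∧ IsInternalProd E Q

attribute [instance] AtoricGroup.group AtoricGroup.finite

variable (P : Type w) [Group P] [Finite P]

theorem exists_atKernel :
    ∃ N : Subgroup P, Maximal (fun N : Subgroup P => N.Normal ∧ N ⊓ frattini P = ⊥) N :=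
  (Set.toFinite {N : Subgroup P | N.Normal ∧ N ⊓ frattini P = ⊥}).exists_maximal
    ⟨⊥, inferInstance, bot_inf_eq _⟩

/-- A normal subgroup `N` of `P` which is maximal subject to `N ∩ Φ(P) = 1`. -/
def atKernel : Subgroup P := (exists_atKernel P).choose

instance : (atKernel P).Normal := (exists_atKernel P).choose_spec.prop.1

/-- The group `P^@ = P / N`, where `N` is a normal subgroup of `P` maximal subject to
`N ∩ Φ(P) = 1`. -/
abbrev At : Type w := P ⧸ atKernel P

open Classical in
/-- `b_L^P`: the sum of the idempotents `ε_{T,S}^P` over representatives `(T, S)` of the conjugacy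
classes of minimal sections of `P` such that `(T/S)^@ ≅ L`. -/
def bElem (L : Type w) [Group L] : RBurnside R P P :=
  ∑ c : Quotient (MinSec.conj P) with Nonempty (At c.out.1.Quot ≃* L), eps R c.out.1

/-- `b_L^P` as an endomorphism of `P` in `RC_p`. -/
def bEnd {p : ℕ} (L : AtoricGroup.{w} p) (P : PBisetCat.{w} R p) : P ⟶ P :=
  ObjectProperty.homMk (bElem R P.obj.carrier L.carrier)

end Atoric

/-! ### Images of endomorphisms of `p`-biset functors, and the subcategories `b̂_L F_{p,R}` -/

section Image

variable {R} {p : ℕ}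

/-- The submodule `Im(η_P)` of `F(P)`, for an endomorphism `η` of a `p`-biset functor `F`. -/
abbrev imageSub {F : PBisetFunctor.{w, u, v} R p} (η : F ⟶ F) (P : PBisetCat.{w} R p) :
    Submodule R (F.obj.obj P) :=
  LinearMap.range (η.hom.app P).hom

theorem map_mem_imageSub {F F' : PBisetFunctor.{w, u, v} R p} {η : F ⟶ F} {η' : F' ⟶ F'}
    {P Q : PBisetCat.{w} R p} (f : F.obj.obj P ⟶ F'.obj.obj Q)
    (hf : η.hom.app P ≫ f = f ≫ η'.hom.app Q) (x : F.obj.obj P) (hx : x ∈ imageSub η P) :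
    f.hom x ∈ imageSub η' Q := by
  obtain ⟨y, rfl⟩ := hx
  exact ⟨f.hom y, (congrArg (fun k => k.hom y) hf).symm⟩

/-- The image of an endomorphism of a `p`-biset functor, a subfunctor of `F`. -/
def image {F : PBisetFunctor.{w, u, v} R p} (η : F ⟶ F) : PBisetFunctor.{w, u, v} R p where
  obj :=
    { obj := fun P => ModuleCat.of R (imageSub η P)
      map := fun {P Q} f => ModuleCat.ofHom ((F.obj.map f).hom.restrict
        (map_mem_imageSub (F.obj.map f) (η.hom.naturality f).symm))
      map_id := fun P => ModuleCat.hom_ext (LinearMap.ext fun (x : imageSub η P) =>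
        Subtype.ext (congrArg (fun k => k.hom x.1) (F.obj.map_id P)))
      map_comp := fun {P _ _} f g => ModuleCat.hom_ext (LinearMap.ext fun (x : imageSub η P) =>
        Subtype.ext (congrArg (fun k => k.hom x.1) (F.obj.map_comp f g))) }
  property := by
    obtain ⟨h1, h2⟩ := F.property
    refine ⟨⟨fun {P Q f g} => ?_⟩, ⟨fun {P Q} f r => ?_⟩⟩
    · exact ModuleCat.hom_ext (LinearMap.ext fun (x : imageSub η P) =>
        Subtype.ext (congrArg (fun k => k.hom x.1) (F.obj.map_add (f := f) (g := g))))
    · exact ModuleCat.hom_ext (LinearMap.ext fun (x : imageSub η P) =>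
        Subtype.ext (congrArg (fun k => k.hom x.1) (F.obj.map_smul r f)))

/-- The inclusion of the image of `η` in `F`. -/
def imageι {F : PBisetFunctor.{w, u, v} R p} (η : F ⟶ F) : image η ⟶ F :=
  ObjectProperty.homMk { app := fun P => ModuleCat.ofHom (imageSub η P).subtype }

/-- For an element `e` of the center of `F_{p,R}`, the full subcategory of `F_{p,R}` consisting of
the functors `F` which are equal to the image of `e` on `F`. -/
abbrev Summand (e : CatCenter (PBisetFunctor.{w, u, v} R p)) :=
  ObjectProperty.FullSubcategory fun F : PBisetFunctor.{w, u, v} R p =>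
    ∀ P : PBisetCat.{w} R p, imageSub (e.app F) P = ⊤

/-- The pointwise addition of natural transformations on `Summand e`. -/
abbrev summandPreadditive (e : CatCenter (PBisetFunctor.{w, u, v} R p)) :
    Preadditive (Summand e) := inferInstance

/-- The inclusion of `Summand e` in `F_{p,R}`. -/
abbrev Summand.ι (e : CatCenter (PBisetFunctor.{w, u, v} R p)) :
    Summand e ⥤ PBisetFunctor.{w, u, v} R p :=
  ObjectProperty.ι _

theorem image_summand (e : CatCenter (PBisetFunctor.{w, u, v} R p)) (he : IsIdempotentElem e)
    (F : PBisetFunctor.{w, u, v} R p) (P : PBisetCat.{w} R p) :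
    imageSub (e.app (image (e.app F))) P = ⊤ := by
  rw [eq_top_iff]
  intro x _
  obtain ⟨y, hy⟩ := x.2
  refine ⟨x, Subtype.ext ?_⟩
  have h1 := congrArg (fun k => (k.hom.app P).hom x) (e.naturality (imageι (e.app F)))
  have h2 := congrArg (fun z : CatCenter (PBisetFunctor.{w, u, v} R p) =>
    ((z.app F).hom.app P).hom y) he.eq
  change ((e.app F).hom.app P).hom (((e.app F).hom.app P).hom y)
    = ((e.app F).hom.app P).hom y at h2
  change ((e.app F).hom.app P).hom x.1 = _ at h1
  refine h1.symm.trans ?_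
  rw [← hy, h2]

/-- For an idempotent `e` of the center of `F_{p,R}`, the functor sending `F` to the image of `e`
on `F`, and a natural transformation to its restriction. -/
def toSummand (e : CatCenter (PBisetFunctor.{w, u, v} R p)) (he : IsIdempotentElem e) :
    PBisetFunctor.{w, u, v} R p ⥤ Summand e where
  obj F := ⟨image (e.app F), image_summand e he F⟩
  map {F F'} θ := ObjectProperty.homMk (ObjectProperty.homMk
    { app := fun P => ModuleCat.ofHom ((θ.hom.app P).hom.restrict
        (map_mem_imageSub (θ.hom.app P)
          (congrArg (fun k => k.hom.app P) (e.naturality θ)).symm))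
      naturality := fun P Q f => by
        ext x
        exact Subtype.ext (congrArg (fun k => k.hom x.1) (θ.hom.naturality f)) })

end Image

end
end BisetFun

open CategoryTheory Limits BisetFun

universe u v w t

/-! Everything rests on two facts about the elements `eps`: their sum over conjugacy classes of
minimal sections is the identity (`sum_eps`), and for `p`-groups `H`, `G` and any `V` in `RB(H, G)`
the product `ε_{T,S} V ε_{T',S'}` vanishes unless `(T/S)^@ ≅ (T'/S')^@` (`eps_mul_mul_eps`). Put `b'
= 1 - b_L`. Then `b_L V b' = 0 = b' V b_L`, hence `V b_L = b_L V b_L = b_L V`: the `b_L` are central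
(`mul_bElem`). Taking `V = 1` gives idempotence and orthogonality. Idempotence of a single `ε_{T,S}`
is never needed.

Sum. The order of a `p`-group is invertible in `R`. Möbius inversion in the subgroup lattice writes
`|G| · 1` as the sum of `|T| Ind_T ẽ_T Res_T` (`card_smul_regular`); Möbius inversion among normal
subgroups writes `ẽ_T` as the sum of the `φ_S^T` with `S ≤ Φ(T)` (`sum_phiAt`); and `φ_S^T` is
`φ_1^{T/S}` deflated and inflated back (`resB_mul_phiOne_mul_indB`). So `|G| · 1` is a sum over all
minimal sections, and orbit counting turns it into a sum over conjugacy classes.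

Vanishing. It reduces to `φ_1^H V φ_1^G` (`phiOne_mul_mul_phiOne`) with `V` the transitive biset of
some `X ≤ H × G`. The factors `ẽ` kill `V` unless `X` projects onto `H` and `G` (`eTilde_mul_indB`);
`φ_1` kills it unless both Goursat kernels of `X` meet the Frattini subgroups trivially
(`phiOne_mul_cls`, `cls_mul_phiOne`). In the remaining case Goursat's lemma identifies a quotient of
`H` with a quotient of `G`, and dividing by a normal subgroup that avoids the Frattini subgroup does
not change `P^@` (`At_equiv_of_surjective`).

Categories. A family of orthogonal central idempotents, finite at each `P` with sum `1`, allows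
morphisms to be glued (`IsLocallyFinitePartition.exists_glue`), which gives the direct sum and full
faithfulness; essential surjectivity comes from products, which are finite at every `P`. On a
summand the idempotent is the identity, a condition stable under subobjects, quotients, limits and
colimits. -/

namespace BisetFun

open CategoryTheory Limits MulOpposite TensorProduct

noncomputable section

/-! ### Explicit products of bisets -/

namespace FinBiset

variable {G H K M : Type w} [Group G] [Group H] [Group K] [Group M]

theorem tmk_eq_iff (U : FinBiset G H) (V : FinBiset H K) (u u' : U.carrier) (v v' : V.carrier) :
    tmk U V u v = tmk U V u' v' ↔ ∃ h : H, u' = op h • u ∧ v' = h⁻¹ • v := by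
  refine ⟨fun h => ?_, ?_⟩
  · obtain ⟨k, hk⟩ := Quotient.exact (s := tensorRel U V) h
    exact ⟨k, congrArg Prod.fst hk, congrArg Prod.snd hk⟩
  · rintro ⟨k, rfl, rfl⟩
    rw [tmk_smul, smul_inv_smul]

/-- A bijective equivariant map of bisets is an isomorphism. -/
theorem Iso.of_bijective {X Y : FinBiset G H} (f : X.carrier → Y.carrier)
    (hf : Function.Bijective f) (h1 : ∀ (g : G) x, f (g • x) = g • f x)
    (h2 : ∀ (h : H) x, f (op h • x) = op h • f x) : Iso X Y :=
  ⟨Equiv.ofBijective f hf, h1, h2⟩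

/-- A balanced, equivariant map `U × V → W` whose fibres are the `H`-orbits and which is surjective
induces an isomorphism `U ×_H V ≅ W`. -/
theorem tensor_iso {U : FinBiset G H} {V : FinBiset H K} {W : FinBiset G K}
    (f : U.carrier → V.carrier → W.carrier)
    (bal : ∀ u (h : H) v, f (op h • u) v = f u (h • v))
    (left : ∀ (g : G) u v, f (g • u) v = g • f u v)
    (right : ∀ (k : K) u v, f u (op k • v) = op k • f u v)
    (inj : ∀ u v u' v', f u v = f u' v' → ∃ h : H, u' = op h • u ∧ v' = h⁻¹ • v)
    (surj : ∀ w, ∃ u v, f u v = w) : Iso (tensor U V) W := by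
  refine Iso.of_bijective (tlift U V f bal) ⟨?_, ?_⟩ (fun g => tind fun u v => left g u v)
    (fun k => tind fun u v => right k u v)
  · refine fun x => tind (fun u' v' => ?_)
    revert x
    refine tind (fun u v => ?_)
    exact fun h => (tmk_eq_iff U V u u' v v').2 (inj u v u' v' h)
  · intro w
    obtain ⟨u, v, h⟩ := surj w
    exact ⟨tmk U V u v, h⟩

/-- The group `H` as a `(G, K)`-biset by means of homomorphisms `G → H` and `K → H`. -/
def bi [Finite H] (f : G →* H) (g : K →* H) : FinBiset G K where
  carrier := H
  left := MulAction.compHom H f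
  right := MulAction.compHom H (MonoidHom.op g)
  comm := @SMulCommClass.mk _ _ _ (_) (_) fun a b x => (mul_assoc (f a) x (g b.unop)).symm

/-- Induction along `f`: the group `G` as a `(G, K)`-biset. -/
abbrev indB [Finite G] (f : K →* G) : FinBiset G K := bi (MonoidHom.id G) f

/-- Restriction along `f`: the group `G` as a `(K, G)`-biset. -/
abbrev resB [Finite G] (f : K →* G) : FinBiset K G := bi f (MonoidHom.id G)

theorem regular_eq_bi [Finite G] :
    regular G = bi (MonoidHom.id G) (MonoidHom.id G) := rfl

theorem resB_tensor_indB [Finite H] (f : G →* H) (g : K →* H) :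
    Iso (tensor (resB f) (indB g)) (bi f g) := by
  refine tensor_iso (fun (x y : H) => (x * y : H)) ?_ ?_ ?_ ?_ ?_
  · exact fun (x h y : H) => mul_assoc x h y
  · exact fun a (x y : H) => mul_assoc (f a) x y
  · exact fun a (x y : H) => (mul_assoc x y (g a)).symm
  · intro (x : H) (y : H) (x' : H) (y' : H) h
    refine ⟨x⁻¹ * x', ?_, ?_⟩
    · change x' = x * (x⁻¹ * x'); group
    · change y' = (x⁻¹ * x')⁻¹ * y
      rw [mul_inv_rev, inv_inv, mul_assoc]; exact eq_inv_mul_of_mul_eq h.symm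
  · exact fun (x : H) => ⟨(1 : H), x, one_mul x⟩

theorem indB_tensor_indB [Finite G] [Finite H] (f : H →* G) (g : K →* H) :
    Iso (tensor (indB f) (indB g)) (indB (f.comp g)) := by
  refine tensor_iso (fun (x : G) (y : H) => (x * f y : G)) ?_ ?_ ?_ ?_ ?_
  · intro (x : G) (h : H) (y : H)
    change x * f h * f y = x * f (h * y)
    rw [map_mul, mul_assoc]
  · exact fun a (x : G) (y : H) => mul_assoc a x (f y)
  · intro a (x : G) (y : H)
    change x * f (y * g a) = x * f y * f (g a)
    rw [map_mul, mul_assoc]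
  · intro (x : G) (y : H) (x' : G) (y' : H) h
    refine ⟨y * y'⁻¹, ?_, ?_⟩
    · change x' = x * f (y * y'⁻¹)
      rw [map_mul, ← mul_assoc, map_inv]
      exact eq_mul_inv_of_mul_eq h.symm
    · change y' = (y * y'⁻¹)⁻¹ * y; group
  · intro (x : G)
    refine ⟨x, (1 : H), ?_⟩
    change x * f 1 = x
    rw [map_one, mul_one]

/-- The pair `(x, y)` goes to `(x y, x X)`. Thus `ẽ_G` is a combination of composites of a
restriction with an induction. -/
theorem tilde_iso [Finite G] (X : Subgroup G) :
    Iso (tensor (indB X.subtype) (resB X.subtype)) (tilde (G := G) (G ⧸ X)) := by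
  refine tensor_iso (fun (x y : G) => (x * y, (x : G ⧸ X))) ?_ ?_ ?_ ?_ ?_
  · intro (x : G) (h : X) (y : G)
    refine Prod.ext (mul_assoc x h y) ?_
    refine QuotientGroup.eq.2 ?_
    change (x * h.1)⁻¹ * x ∈ X
    rw [mul_inv_rev, inv_mul_cancel_right]
    exact X.inv_mem h.2
  · exact fun a (x : G) (y : G) => Prod.ext (mul_assoc a x y) rfl
  · exact fun a (x : G) (y : G) => Prod.ext (mul_assoc x y a).symm rfl
  · intro (x : G) (y : G) (x' : G) (y' : G) h
    have h1 : x * y = x' * y' := congrArg Prod.fst h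
    have h2 := QuotientGroup.eq.1 (congrArg Prod.snd h)
    refine ⟨⟨x⁻¹ * x', h2⟩, ?_, ?_⟩
    · change x' = x * (x⁻¹ * x'); group
    · change y' = (x⁻¹ * x')⁻¹ * y
      rw [mul_inv_rev, inv_inv, mul_assoc]; exact eq_inv_mul_of_mul_eq h1.symm
  · rintro ⟨x, ⟨y⟩⟩
    refine ⟨y, y⁻¹ * x, ?_⟩
    exact Prod.ext (by simp) rfl

/-- Every transitive biset factors through the group `X` itself, along its two projections; a
non-surjective projection then lets `ẽ` kill the biset. -/
theorem transitive_iso [Finite G] [Finite H] (X : Subgroup (G × H)) :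
    Iso (tensor (indB ((MonoidHom.fst G H).comp X.subtype))
      (resB ((MonoidHom.snd G H).comp X.subtype))) (transitive X) := by
  refine tensor_iso (fun (x : G) (y : H) => (((x, @Inv.inv H _ y) : G × H) : (G × H) ⧸ X)) ?_ ?_ ?_ ?_ ?_
  · intro (x : G) (h : X) (y : H)
    refine (QuotientGroup.eq.2 ?_).symm
    change ((x, (h.1.2 * y)⁻¹) : G × H)⁻¹ * (x * h.1.1, y⁻¹) ∈ X
    convert h.2 using 1
    ext <;> simp
  · exact fun a (x : G) (y : H) => congrArg (Quotient.mk _) (Prod.ext rfl (one_mul y⁻¹).symm)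
  · intro a (x : G) (y : H)
    exact congrArg (Quotient.mk _) (Prod.ext (one_mul x).symm (mul_inv_rev y a))
  · intro (x : G) (y : H) (x' : G) (y' : H) h
    refine ⟨⟨_, QuotientGroup.eq.1 h⟩, ?_, ?_⟩
    · change x' = x * (x⁻¹ * x'); group
    · change y' = ((y⁻¹)⁻¹ * y'⁻¹)⁻¹ * y; group
  · rintro ⟨x, y⟩
    exact ⟨x, @Inv.inv H _ y, congrArg (Quotient.mk _) (Prod.ext rfl (inv_inv y))⟩

/-- The class of `(a, b)` is determined by `f a * (f b)⁻¹`. Hence `Δ_N` is a deflation to `G/N`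
followed by inflation. -/
theorem transitive_Delta_iso [Finite G] [Finite H] (f : G →* H) (hf : Function.Surjective f)
    {N : Subgroup G} (hN : N.Normal) (h : f.ker = N) :
    Iso (transitive (Delta N hN)) (bi f f) := by
  subst h
  refine Iso.of_bijective (Quotient.lift (fun x : G × G => (f x.1 * (f x.2)⁻¹ : H)) ?_)
    ⟨?_, ?_⟩ ?_ ?_
  · rintro ⟨a, b⟩ ⟨c, d⟩ h
    have h1 : (a⁻¹ * c) * (b⁻¹ * d)⁻¹ ∈ f.ker :=
      QuotientGroup.leftRel_apply.1 h
    rw [MonoidHom.mem_ker] at h1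
    simp only [map_mul, map_inv] at h1 ⊢
    have h2 : (f a)⁻¹ * f c = (f b)⁻¹ * f d := mul_inv_eq_one.1 h1
    have h3 : f d = f b * ((f a)⁻¹ * f c) := by rw [h2]; group
    have h4 : f a * (f b)⁻¹ = f c * (f d)⁻¹ := by rw [h3]; group
    exact h4
  · rintro ⟨a, b⟩ ⟨c, d⟩ h
    refine QuotientGroup.eq.2 ?_
    change (a⁻¹ * c) * (b⁻¹ * d)⁻¹ ∈ f.ker
    have h : f a * (f b)⁻¹ = f c * (f d)⁻¹ := h
    rw [MonoidHom.mem_ker]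
    simp only [map_mul, map_inv]
    have h3 : f c = f a * (f b)⁻¹ * f d := by rw [h]; group
    rw [h3]; group
  · intro (x : H)
    obtain ⟨a, rfl⟩ := hf x
    refine ⟨Quotient.mk _ (a, 1), ?_⟩
    change f a * (f 1)⁻¹ = f a
    rw [map_one, inv_one, mul_one]
  · rintro g ⟨a, b⟩
    change f (g * a) * (f (1 * b))⁻¹ = f g * (f a * (f b)⁻¹)
    rw [map_mul, one_mul, mul_assoc]
  · rintro g ⟨a, b⟩
    change f (1 * a) * (f (g⁻¹ * b))⁻¹ = (f a * (f b)⁻¹) * f g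
    simp [mul_assoc]

/-- Base change for the square formed by `f` and the inclusion of `X`: inflation commutes with
induction. -/
theorem bi_comap_iso [Finite G] [Finite H] (f : G →* H) (hf : Function.Surjective f)
    (X : Subgroup H) :
    Iso (tensor (indB (X.comap f).subtype) (resB (f.subgroupComap X))) (bi f X.subtype) := by
  refine tensor_iso (fun (x : G) (y : X) => (f x * y : H)) ?_ ?_ ?_ ?_ ?_
  · intro (x : G) h (y : X)
    change f (x * h) * y = f x * (f h * y)
    rw [map_mul, mul_assoc]
  · intro (a : G) (x : G) (y : X)
    change f (a * x) * y = f a * (f x * y)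
    rw [map_mul, mul_assoc]
  · exact fun a (x : G) (y : X) => (mul_assoc (f x) y.1 a.1).symm
  · intro (x : G) (y : X) (x' : G) (y' : X) h
    have h : f x * y = f x' * y' := h
    have h2 : f (x⁻¹ * x') = y * (y' : H)⁻¹ := by
      rw [map_mul, map_inv, inv_mul_eq_iff_eq_mul, ← mul_assoc, h]; group
    refine ⟨⟨x⁻¹ * x', ?_⟩, ?_, ?_⟩
    · rw [Subgroup.mem_comap, h2]
      exact X.mul_mem y.2 (X.inv_mem y'.2)
    · change x' = x * (x⁻¹ * x'); group
    · refine Subtype.ext ?_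
      change (y' : H) = f (x⁻¹ * x')⁻¹ * y
      rw [map_inv, h2]; group
  · intro (y : H)
    obtain ⟨x, rfl⟩ := hf y
    exact ⟨x, (1 : X), mul_one (f x)⟩

/-- Conjugate homomorphisms define isomorphic induction bisets. -/
theorem indB_conj [Finite G] {f f' : K →* G} (g : G) (h : ∀ k, f' k = g * f k * g⁻¹) :
    Iso (indB f') (indB f) := by
  refine Iso.of_bijective (fun x : G => (x * g : G)) (Group.mulRight_bijective g) ?_ ?_
  · exact fun a (x : G) => mul_assoc a x g
  · intro a (x : G)
    change x * f' a * g = x * g * f a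
    rw [h]; group

/-- The `(G, K)`-biset `G × U` for a `G`-set `U` and a homomorphism `f : K → G`. -/
def tildeBi [Finite G] (f : K →* G) (U : Type w) [Finite U] [MulAction G U] : FinBiset G K where
  carrier := G × U
  right :=
    { smul := fun b y => (y.1 * f b.unop, y.2)
      one_smul := fun y => Prod.ext (by simp [HSMul.hSMul]) rfl
      mul_smul := fun b c y => Prod.ext (by simp [HSMul.hSMul, mul_assoc]) rfl }
  comm := @SMulCommClass.mk _ _ _ (_) (_) fun a b y =>
    Prod.ext (mul_assoc a y.1 (f b.unop)).symm rfl

/-- With `indB_tensor_tilde` this yields the projection formula: `tilde U` can be moved past an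
induction, `U` being restricted to the subgroup. -/
theorem tilde_tensor_indB [Finite G] (f : K →* G) (U : Type w) [Finite U] [MulAction G U] :
    Iso (tensor (tilde (G := G) U) (indB f)) (tildeBi f U) := by
  refine tensor_iso (fun (x : G × U) (y : G) => (x.1 * y, x.2)) ?_ ?_ ?_ ?_ ?_
  · exact fun (x : G × U) h (y : G) => Prod.ext (mul_assoc x.1 h y) rfl
  · exact fun (a : G) (x : G × U) (y : G) => Prod.ext (mul_assoc a x.1 y) rfl
  · exact fun a (x : G × U) (y : G) => Prod.ext (mul_assoc x.1 y (f a)).symm rfl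
  · rintro ⟨x, s⟩ (y : G) ⟨x', s'⟩ (y' : G) h
    have h1 : x * y = x' * y' := congrArg Prod.fst h
    have h2 : s = s' := congrArg Prod.snd h
    refine ⟨x⁻¹ * x', Prod.ext ?_ h2.symm, ?_⟩
    · change x' = x * (x⁻¹ * x'); group
    · change y' = (x⁻¹ * x')⁻¹ * y
      rw [mul_inv_rev, inv_inv, mul_assoc]; exact eq_inv_mul_of_mul_eq h1.symm
  · exact fun x => ⟨x, (1 : G), Prod.ext (mul_one x.1) rfl⟩

theorem indB_tensor_tilde [Finite G] (X : Subgroup G) (U : Type w) [Finite U] [MulAction G U] :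
    Iso (tensor (indB X.subtype) (tilde (G := X) U)) (tildeBi X.subtype U) := by
  refine tensor_iso (fun (y : G) (x : X × U) => (y * x.1, y • x.2)) ?_ ?_ ?_ ?_ ?_
  · exact fun (y : G) (h : X) (x : X × U) => Prod.ext (mul_assoc y h x.1.1) (mul_smul y h.1 x.2)
  · exact fun (a : G) (y : G) (x : X × U) => Prod.ext (mul_assoc a y x.1) (mul_smul a y x.2)
  · exact fun a (y : G) (x : X × U) => Prod.ext (mul_assoc y x.1.1 a).symm rfl
  · rintro (y : G) ⟨x, s⟩ (y' : G) ⟨x', s'⟩ h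
    have h1 : y * x = y' * x' := congrArg Prod.fst h
    have h2 : y • s = y' • s' := congrArg Prod.snd h
    refine ⟨x * x'⁻¹, ?_, Prod.ext ?_ ?_⟩
    · change y' = y * (x * (x' : G)⁻¹)
      rw [← mul_assoc]; exact eq_mul_inv_of_mul_eq h1.symm
    · change x' = (x * x'⁻¹)⁻¹ * x; group
    · change s' = (x * x'⁻¹)⁻¹ • s
      rw [eq_inv_smul_iff]
      change (x * (x' : G)⁻¹) • s' = s
      have h3 : (x : G) * (x' : G)⁻¹ = y⁻¹ * y' := by
        rw [eq_inv_mul_iff_mul_eq, ← mul_assoc, h1]; group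
      rw [h3, mul_smul, ← h2, inv_smul_smul]
  · rintro ⟨y, s⟩
    exact ⟨y, ((1 : X), y⁻¹ • s), Prod.ext (mul_one y) (smul_inv_smul y s)⟩

/-- If `ker f` acts trivially on the left of `U`, then `Δ_{ker f} ×_G U ≅ U`. -/
theorem bi_tensor_of_trivial [Finite G] [Finite H] (f : G →* H) (hf : Function.Surjective f)
    (U : FinBiset G K) (hU : ∀ x ∈ f.ker, ∀ u : U.carrier, x • u = u) :
    Iso (tensor (bi f f) U) U := by
  -- Since the kernel acts trivially, an element of `H` acts on `U` through any of its preimages;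
  -- `Function.surjInv` selects one.
  have key : ∀ a b : G, f a = f b → ∀ u : U.carrier, a • u = b • u := fun a b h u => by
    rw [← inv_smul_eq_iff, smul_smul]
    exact hU _ (by rw [MonoidHom.mem_ker, map_mul, map_inv, h, inv_mul_cancel]) u
  have hinv := Function.surjInv_eq hf
  refine tensor_iso (fun (x : H) u => Function.surjInv hf x • u) ?_ ?_ ?_ ?_ ?_
  · intro (x : H) h u
    rw [smul_smul]
    refine key (Function.surjInv hf (x * f h)) _ ?_ u
    rw [hinv, map_mul, hinv]
  · intro a (x : H) u
    rw [smul_smul]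
    refine key (Function.surjInv hf (f a * x)) _ ?_ u
    rw [hinv, map_mul, hinv]
  · exact fun k (x : H) u => (smul_comm _ (op k) u)
  · intro (x : H) u (x' : H) u' h
    refine ⟨(Function.surjInv hf x)⁻¹ * Function.surjInv hf x', ?_, ?_⟩
    · change x' = x * f ((Function.surjInv hf x)⁻¹ * Function.surjInv hf x')
      rw [map_mul, map_inv, hinv, hinv]; group
    · rw [mul_inv_rev, inv_inv, mul_smul, h, inv_smul_smul]
  · intro u
    exact ⟨(1 : H), u, (key _ 1 (by rw [hinv, map_one]) u).trans (one_smul G u)⟩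

/-- The opposite biset. -/
def opp (U : FinBiset G H) : FinBiset H G where
  carrier := U.carrier
  left := MulAction.compHom U.carrier (MulEquiv.inv' H).toMonoidHom
  right := MulAction.compHom U.carrier (MulEquiv.inv' G).symm.toMonoidHom
  comm := @SMulCommClass.mk _ _ _ (_) (_) fun a b x =>
    (smul_comm (b.unop⁻¹ : G) (op (a⁻¹ : H)) (show U.carrier from x)).symm

theorem opp_congr {U V : FinBiset G H} (h : Iso U V) : Iso (opp U) (opp V) := by
  obtain ⟨e, h1, h2⟩ := h
  exact ⟨e, fun h x => h2 h⁻¹ x, fun g x => h1 g⁻¹ x⟩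

theorem opp_sum (U V : FinBiset G H) : Iso (opp (sum U V)) (sum (opp U) (opp V)) := by
  refine ⟨Equiv.refl (U.carrier ⊕ V.carrier), ?_, ?_⟩
  · rintro h (x | x) <;> rfl
  · rintro h (x | x) <;> rfl

theorem opp_empty : Iso (opp (empty G H)) (empty H G) :=
  ⟨Equiv.refl PEmpty, fun _ x => x.elim, fun _ x => x.elim⟩

/-- Taking opposites reverses products, so each statement about left multiplication by `ẽ_G` or
`φ_1^G` gives its right-handed version. -/
theorem opp_tensor (U : FinBiset G H) (V : FinBiset H K) :
    Iso (opp (tensor U V)) (tensor (opp V) (opp U)) := by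
  refine Iso.symm (tensor_iso (U := opp V) (V := opp U) (W := opp (tensor U V))
    (fun v u => tmk U V u v) ?_ ?_ ?_ ?_ ?_)
  · intro v h u
    exact (tmk_smul U V u h⁻¹ v).symm
  · intro k v u
    rfl
  · intro k v u
    rfl
  · intro v (u : U.carrier) v' (u' : U.carrier) h
    obtain ⟨k, h1, h2⟩ := (tmk_eq_iff U V u u' v v').1 h
    exact ⟨k, h2, h1.trans (congrArg (fun z : H => op z • u) (inv_inv k).symm)⟩
  · refine tind fun u v => ⟨v, u, rfl⟩

theorem opp_bi [Finite H] (f : G →* H) (g : K →* H) : Iso (opp (bi f g)) (bi g f) := by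
  refine Iso.of_bijective (fun x : H => (x⁻¹ : H)) (Equiv.inv H).bijective ?_ ?_
  · intro k (x : H)
    change (x * g k⁻¹)⁻¹ = g k * x⁻¹
    rw [mul_inv_rev, map_inv, inv_inv]
  · intro k (x : H)
    change (f k⁻¹ * x)⁻¹ = x⁻¹ * f k
    rw [mul_inv_rev, map_inv, inv_inv]

end FinBiset

end

end BisetFun

namespace BisetFun

open CategoryTheory Limits MulOpposite TensorProduct

/-! ### Möbius functions of finite posets and of subgroup lattices -/

section Moebius

variable {α β : Type*} [PartialOrder α] [Finite α] [PartialOrder β] [Finite β]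

theorem moebius_eq_zero_of_not_le {a b : α} (h : ¬ a ≤ b) : moebius a b = 0 := by
  classical
  let := Fintype.ofFinite α
  let : LocallyFiniteOrder α := Fintype.toLocallyFiniteOrder
  exact IncidenceAlgebra.apply_eq_zero_of_not_le h _

theorem moebius_self (a : α) : moebius a a = 1 := by
  classical
  let := Fintype.ofFinite α
  let : LocallyFiniteOrder α := Fintype.toLocallyFiniteOrder
  exact IncidenceAlgebra.mu_self a

open Classical in
theorem sum_moebius_left [Fintype α] (a b : α) :
    ∑ x with a ≤ x, moebius x b = if a = b then 1 else 0 := by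
  have e : ‹Fintype α› = Fintype.ofFinite α := Subsingleton.elim _ _
  subst e
  let := Fintype.ofFinite α
  let : LocallyFiniteOrder α := Fintype.toLocallyFiniteOrder
  rw [← IncidenceAlgebra.sum_Icc_mu_left (𝕜 := ℤ) a b]
  symm
  refine Finset.sum_subset_zero_on_sdiff (fun x hx => ?_) (fun x hx => ?_) (fun x _ => ?_)
  · simpa using (Finset.mem_Icc.1 hx).1
  · refine moebius_eq_zero_of_not_le fun h => ?_
    simp only [Finset.mem_sdiff, Finset.mem_filter, Finset.mem_univ, true_and,
      Finset.mem_Icc] at hx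
    exact hx.2 ⟨hx.1, h⟩
  · unfold moebius; congr!

open Classical in
theorem sum_moebius_right [Fintype α] (a b : α) :
    ∑ x with x ≤ b, moebius a x = if a = b then 1 else 0 := by
  have e : ‹Fintype α› = Fintype.ofFinite α := Subsingleton.elim _ _
  subst e
  let := Fintype.ofFinite α
  let : LocallyFiniteOrder α := Fintype.toLocallyFiniteOrder
  rw [← IncidenceAlgebra.sum_Icc_mu_right (𝕜 := ℤ) a b]
  symm
  refine Finset.sum_subset_zero_on_sdiff (fun x hx => ?_) (fun x hx => ?_) (fun x _ => ?_)
  · simpa using (Finset.mem_Icc.1 hx).2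
  · refine moebius_eq_zero_of_not_le fun h => ?_
    simp only [Finset.mem_sdiff, Finset.mem_filter, Finset.mem_univ, true_and,
      Finset.mem_Icc] at hx
    exact hx.2 ⟨h, hx.1⟩
  · unfold moebius; congr!

open Classical in
theorem moebius_eq_sub [Fintype α] (a b : α) :
    moebius a b = (if a = b then 1 else 0) - ∑ x with x < b, moebius a x := by
  rw [← sum_moebius_right a b, eq_sub_iff_add_eq, add_comm, ← Finset.sum_erase_add _ _ (show b ∈ Finset.univ.filter (· ≤ b) by simp)]
  congr 1
  refine Finset.sum_congr (Finset.ext fun x => ?_) fun _ _ => rfl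
  simp [lt_iff_le_and_ne, and_comm]

/-- The Möbius function only depends on the interval. -/
theorem moebius_map (e : α → β) (he : ∀ x y, e x ≤ e y ↔ x ≤ y) (a : α) (b : α)
    (hr : ∀ z, e a ≤ z → z ≤ e b → z ∈ Set.range e) : moebius (e a) (e b) = moebius a b := by
  classical
  let := Fintype.ofFinite α
  let := Fintype.ofFinite β
  have hinj : Function.Injective e := fun x y h =>
    le_antisymm ((he x y).1 h.le) ((he y x).1 h.ge)
  have hlt : ∀ x y, e x < e y ↔ x < y := fun x y => by
    rw [lt_iff_le_not_ge, lt_iff_le_not_ge, he, he]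
  induction b using WellFoundedLT.induction with
  | ind b ih =>
    rw [moebius_eq_sub, moebius_eq_sub]
    simp only [hinj.eq_iff]
    congr 1
    symm
    refine Finset.sum_of_injOn e hinj.injOn ?_ ?_ ?_
    · intro x hx
      simpa [hlt] using hx
    -- Elements outside the range of `e` are not above `e a`, so they contribute nothing to the
    -- recursion for the Möbius function.
    · intro z hz hz'
      refine moebius_eq_zero_of_not_le fun h => hz' ?_
      simp only [Finset.mem_filter, Finset.mem_univ, true_and] at hz
      obtain ⟨x, rfl⟩ := hr z h hz.le
      exact ⟨x, by simpa [hlt] using hz, rfl⟩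
    · intro x hx
      simp only [Finset.mem_filter, Finset.mem_univ, true_and] at hx
      exact (ih x hx fun z h1 h2 => hr z h1 (h2.trans ((he _ _).2 hx.le))).symm

open Classical in
/-- If the sums of `f` over all the sets `{y | z ≤ j y}` vanish, then so do all the sums
`∑ y, f y • w (j y)`. -/
theorem sum_smul_comp_eq_zero {γ M : Type*} [Fintype γ] [AddCommGroup M] (j : γ → β) (f : γ → ℤ)
    (h : ∀ z, ∑ y with z ≤ j y, f y = 0) (w : β → M) : ∑ y, f y • w (j y) = 0 := by
  let := Fintype.ofFinite β
  -- The total of `f` on each fibre of `j` vanishes, by downward induction: the upper-set sum at `z`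
  -- is the fibre sum plus fibre sums strictly above `z`.
  have h1 : ∀ z, ∑ y with j y = z, f y = 0 := by
    intro z
    induction z using WellFoundedGT.induction with
    | ind z ih =>
      have h2 : ∑ y with z ≤ j y, f y = ∑ y with j y = z, f y + ∑ y with z < j y, f y := by
        rw [← Finset.sum_filter_add_sum_filter_not _ (fun y => j y = z), Finset.filter_filter,
          Finset.filter_filter]
        congr 1 <;> refine Finset.sum_congr (Finset.ext fun y => ?_) fun _ _ => rfl
        · simp only [Finset.mem_filter, Finset.mem_univ, true_and]
          exact ⟨fun h => h.2, fun h => ⟨h.ge, h⟩⟩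
        · simp only [Finset.mem_filter, Finset.mem_univ, true_and]
          exact ⟨fun h => lt_of_le_of_ne h.1 (Ne.symm h.2), fun h => ⟨h.le, h.ne'⟩⟩
      have h3 : ∑ y with z < j y, f y = 0 := by
        rw [← Finset.sum_fiberwise _ j]
        refine Finset.sum_eq_zero fun z' _ => ?_
        rw [Finset.filter_filter]
        by_cases hz : z < z'
        · rw [← ih z' hz]
          refine Finset.sum_congr (Finset.ext fun y => ?_) fun _ _ => rfl
          simp only [Finset.mem_filter, Finset.mem_univ, true_and]
          exact ⟨fun h => h.2, fun h => ⟨h ▸ hz, h⟩⟩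
        · refine Finset.sum_eq_zero fun y hy => ?_
          simp only [Finset.mem_filter, Finset.mem_univ, true_and] at hy
          exact (hz (hy.2 ▸ hy.1)).elim
      rw [h, h3, add_zero] at h2
      exact h2.symm
  rw [← Finset.sum_fiberwise _ j]
  refine Finset.sum_eq_zero fun z _ => ?_
  rw [← zero_smul ℤ (w z), ← h1 z, Finset.sum_smul]
  refine Finset.sum_congr rfl fun y hy => ?_
  rw [(Finset.mem_filter.1 hy).2]

end Moebius

/-- The sums of `μ(Y, G)` over `Y ≥ X` and over `Y ≥ X Φ(G)` both vanish, the latter because `Φ(G)`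
consists of non-generators, so `X Φ(G) ≠ G`. Apart from `X`, the difference only involves `Y > X`
not containing `Φ(G)`, which vanish by induction. -/
theorem moebius_top_eq_zero {G : Type w} [Group G] [Finite G] {X : Subgroup G}
    (h : ¬ frattini G ≤ X) : moebius X ⊤ = 0 := by
  classical
  induction X using WellFoundedGT.induction with
  | ind X ih =>
    have h1 := sum_moebius_left X (⊤ : Subgroup G)
    have hX : X ≠ ⊤ := by rintro rfl; exact h le_top
    rw [if_neg hX, ← Finset.sum_erase_add (a := X) _ _ (by simp)] at h1
    have h2 := sum_moebius_left (X ⊔ frattini G) (⊤ : Subgroup G)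
    rw [if_neg fun h => hX (frattini_nongenerating h)] at h2
    suffices h3 : ∑ x ∈ ({x | X ≤ x} : Finset (Subgroup G)).erase X, moebius x ⊤ = 0 by
      rwa [h3, zero_add] at h1
    rw [← h2]
    symm
    refine Finset.sum_subset_zero_on_sdiff (fun Y hY => ?_) (fun Y hY => ?_) (fun x _ => rfl)
    · simp only [Finset.mem_filter, Finset.mem_univ, true_and] at hY
      simp only [Finset.mem_erase, Finset.mem_filter, Finset.mem_univ, true_and]
      refine ⟨?_, le_sup_left.trans hY⟩
      rintro rfl
      exact h (le_sup_right.trans hY)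
    · simp only [Finset.mem_sdiff, Finset.mem_erase, Finset.mem_filter, Finset.mem_univ,
        true_and] at hY
      exact ih Y (lt_of_le_of_ne hY.1.2 (Ne.symm hY.1.1)) fun h => hY.2 (sup_le hY.1.2 h)

/-! ### Duality, and decomposition of bisets into orbits -/

noncomputable section

variable {G H K : Type w} [Group G] [Group H] [Group K]

/-- The homomorphism on isomorphism classes induced by taking opposite bisets. -/
def BisetClass.opp : BisetClass G H →+ BisetClass H G where
  toFun := Quotient.map FinBiset.opp fun _ _ h => FinBiset.opp_congr h
  map_zero' := BisetClass.mk_eq FinBiset.opp_empty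
  map_add' := by
    rintro ⟨U⟩ ⟨V⟩
    exact BisetClass.mk_eq (FinBiset.opp_sum U V)

variable (R : Type u) [CommRing R]

/-- The linear map `RB(G, H) → RB(H, G)` induced by taking opposite bisets. -/
def rbOpp : RBurnside R G H →ₗ[R] RBurnside R H G :=
  LinearMap.baseChange R (Burnside.lift (Burnside.of.comp BisetClass.opp)).toIntLinearMap

theorem rbOpp_cls (U : FinBiset G H) : rbOpp R (cls R U) = cls R U.opp := by
  simp [rbOpp, cls, Burnside.lift_of]
  rfl

variable {R}

/-- The product `×_H`. -/
local infixl:70 " ⊙ " => rbMul _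

theorem rbOpp_rbMul (a : RBurnside R G H) (b : RBurnside R H K) :
    rbOpp R (a ⊙ b) = rbOpp R b ⊙ rbOpp R a := by
  have h1 : ∀ (U : FinBiset G H) (b : RBurnside R H K),
      rbOpp R (cls R U ⊙ b) = rbOpp R b ⊙ rbOpp R (cls R U) := fun U b =>
    DFunLike.congr_fun (f := rbOpp R ∘ₗ rbMul R (cls R U))
      (g := (rbMul R).flip (rbOpp R (cls R U)) ∘ₗ rbOpp R) (RBurnside.hom_ext R fun V => by
        simp only [LinearMap.comp_apply, rbMul_cls, rbOpp_cls, LinearMap.flip_apply]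
        exact cls_eq R (FinBiset.opp_tensor U V)) b
  exact DFunLike.congr_fun (f := rbOpp R ∘ₗ (rbMul R).flip b)
      (g := rbMul R (rbOpp R b) ∘ₗ rbOpp R) (RBurnside.hom_ext R fun U => h1 U b) a

variable (R)

theorem rbOpp_bi [Finite H] (f : G →* H) (g : K →* H) :
    rbOpp R (cls R (FinBiset.bi f g)) = cls R (FinBiset.bi g f) := by
  rw [rbOpp_cls, cls_eq R (FinBiset.opp_bi f g)]

/-- The part of a biset on which an invariant function takes its values in `s`. -/
def FinBiset.fiber (U : FinBiset G H) {ι : Type*} (c : U.carrier → ι)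
    (h1 : ∀ (g : G) x, c (g • x) = c x) (h2 : ∀ (h : H) x, c (op h • x) = c x) (s : Set ι) :
    FinBiset G H where
  carrier := {x // c x ∈ s}
  left :=
    { smul := fun g x => ⟨g • x.1, (h1 g x.1).symm ▸ x.2⟩
      one_smul := fun x => Subtype.ext (one_smul G x.1)
      mul_smul := fun a b x => Subtype.ext (mul_smul a b x.1) }
  right :=
    { smul := fun h x => ⟨h • x.1, (h2 h.unop x.1).symm ▸ x.2⟩
      one_smul := fun x => Subtype.ext (one_smul Hᵐᵒᵖ x.1)
      mul_smul := fun a b x => Subtype.ext (mul_smul a b x.1) }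
  comm := @SMulCommClass.mk _ _ _ (_) (_) fun a b x => Subtype.ext (smul_comm a b x.1)

theorem cls_empty : cls R (FinBiset.empty G H) = 0 := by
  change (1 : R) ⊗ₜ[ℤ] Burnside.of (0 : BisetClass G H) = 0
  rw [map_zero, tmul_zero]

theorem cls_sum (U V : FinBiset G H) : cls R (U.sum V) = cls R U + cls R V := by
  change (1 : R) ⊗ₜ[ℤ] Burnside.of (BisetClass.mk U + BisetClass.mk V : BisetClass G H) = _
  rw [map_add, tmul_add]
  rfl

theorem cls_fiber (U : FinBiset G H) {ι : Type*} (c : U.carrier → ι)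
    (h1 : ∀ (g : G) x, c (g • x) = c x) (h2 : ∀ (h : H) x, c (op h • x) = c x) (s : Finset ι) :
    cls R (U.fiber c h1 h2 s) = ∑ i ∈ s, cls R (U.fiber c h1 h2 {i}) := by
  classical
  induction s using Finset.induction_on with
  | empty =>
    rw [Finset.sum_empty, ← cls_empty R]
    refine cls_eq R ⟨⟨fun x => ?_, fun x => x.elim, fun x => ?_, fun x => x.elim⟩,
      fun _ x => ?_, fun _ x => ?_⟩
    all_goals exact absurd x.2 (by simp)
  | insert a s ha ih =>
    rw [Finset.sum_insert ha, ← ih, ← cls_sum]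
    symm
    refine cls_eq R (FinBiset.Iso.of_bijective
      (Sum.elim (fun x => ⟨x.1, ?_⟩) (fun x => ⟨x.1, ?_⟩)) ⟨?_, ?_⟩ ?_ ?_)
    · have := x.2
      simp only [Set.mem_singleton_iff] at this
      simp [this]
    · have := x.2
      simp only [Finset.mem_coe] at this
      simp [this]
    · rintro (x | x) (y | y) h
      · exact congrArg Sum.inl (Subtype.ext (congrArg (fun z => z.1) h :))
      · have h3 : x.1 = y.1 := congrArg Subtype.val h
        have h4 : c y.1 = a := h3 ▸ x.2
        exact (ha (h4 ▸ y.2)).elim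
      · have h3 : x.1 = y.1 := congrArg Subtype.val h
        have h4 : c x.1 = a := h3 ▸ y.2
        exact (ha (h4 ▸ x.2)).elim
      · exact congrArg Sum.inr (Subtype.ext (congrArg (fun z => z.1) h :))
    · rintro ⟨x, hx⟩
      by_cases h : c x = a
      · exact ⟨Sum.inl ⟨x, h⟩, rfl⟩
      · refine ⟨Sum.inr ⟨x, ?_⟩, rfl⟩
        simpa [h] using hx
    · rintro g (x | x) <;> rfl
    · rintro g (x | x) <;> rfl

theorem cls_eq_sum_fiber (U : FinBiset G H) {ι : Type*} [Fintype ι] (c : U.carrier → ι)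
    (h1 : ∀ (g : G) x, c (g • x) = c x) (h2 : ∀ (h : H) x, c (op h • x) = c x) :
    cls R U = ∑ i, cls R (U.fiber c h1 h2 {i}) := by
  rw [← cls_fiber]
  refine cls_eq R (FinBiset.Iso.symm (FinBiset.Iso.of_bijective (fun x => x.1) ⟨?_, ?_⟩ ?_ ?_))
  · exact Subtype.val_injective
  · exact fun x => ⟨⟨x, by simp⟩, rfl⟩
  · exact fun _ _ => rfl
  · exact fun _ _ => rfl

/-- The equivalence relation whose classes are the orbits of `G × H` on a `(G, H)`-biset. -/
def FinBiset.orbitRel (U : FinBiset G H) : Setoid U.carrier where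
  r x y := ∃ (g : G) (h : H), g • op h • x = y
  iseqv :=
    { refl := fun x => ⟨1, 1, by simp⟩
      symm := by
        rintro x y ⟨g, h, rfl⟩
        exact ⟨g⁻¹, h⁻¹, by rw [← smul_comm g (op h⁻¹)]; simp⟩
      trans := by
        rintro x y z ⟨g, h, rfl⟩ ⟨g', h', rfl⟩
        exact ⟨g' * g, h * h', by rw [op_mul, mul_smul, mul_smul, ← smul_comm g (op h')]⟩ }

/-- The stabilizer in `G × H` of a point of a `(G, H)`-biset. -/
def FinBiset.stab (U : FinBiset G H) (x : U.carrier) : Subgroup (G × H) where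
  carrier := {a | a.1 • x = op a.2 • x}
  one_mem' := by simp
  mul_mem' := by
    rintro ⟨a, b⟩ ⟨c, d⟩ (h : a • x = op b • x) (h' : c • x = op d • x)
    change (a * c) • x = op (b * d) • x
    rw [mul_smul, h', op_mul, mul_smul, ← h, smul_comm]
  inv_mem' := by
    rintro ⟨a, b⟩ (h : a • x = op b • x)
    change a⁻¹ • x = op b⁻¹ • x
    rw [inv_smul_eq_iff, smul_comm, h, smul_smul, ← op_mul]
    simp

theorem FinBiset.fiber_orbit_iso [Finite G] [Finite H] (U : FinBiset G H) (x : U.carrier)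
    (h1 h2) : Iso (transitive (U.stab x))
      (U.fiber (ι := Quotient U.orbitRel) (Quotient.mk _) h1 h2 {Quotient.mk _ x}) := by
  have key : ∀ a b : G × H, a.1 • op a.2⁻¹ • x = b.1 • op b.2⁻¹ • x ↔ a⁻¹ * b ∈ U.stab x := by
    intro a b
    change _ ↔ (a.1⁻¹ * b.1) • x = op (a.2⁻¹ * b.2) • x
    rw [mul_smul, inv_smul_eq_iff, op_mul, mul_smul, smul_comm b.1 (op b.2⁻¹) x,
      smul_comm a.1 (op b.2) (op a.2⁻¹ • x), MulOpposite.op_inv b.2, eq_inv_smul_iff]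
    exact eq_comm
  refine Iso.of_bijective (Quotient.lift (fun a : G × H => ⟨a.1 • op a.2⁻¹ • x, ?_⟩) ?_)
    ⟨?_, ?_⟩ ?_ ?_
  · exact Quotient.sound (s := U.orbitRel) (U.orbitRel.symm ⟨a.1, a.2⁻¹, rfl⟩)
  · exact fun a b h => Subtype.ext ((key a b).2 (QuotientGroup.leftRel_apply.1 h))
  · rintro ⟨a⟩ ⟨b⟩ h
    exact QuotientGroup.eq.2 ((key a b).1 (congrArg Subtype.val h))
  · rintro ⟨y, hy⟩
    obtain ⟨g, h, e⟩ := U.orbitRel.symm (Quotient.exact hy)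
    refine ⟨Quotient.mk _ (g, h⁻¹), Subtype.ext ?_⟩
    change g • op (h⁻¹)⁻¹ • x = y
    rw [inv_inv, e]
  · rintro g ⟨a⟩
    refine Subtype.ext ?_
    change (g * a.1) • op (1 * a.2)⁻¹ • x = g • a.1 • op a.2⁻¹ • x
    rw [one_mul, mul_smul]
  · rintro h ⟨a⟩
    refine Subtype.ext ?_
    change (1 * a.1) • op (h⁻¹ * a.2)⁻¹ • x = op h • a.1 • op a.2⁻¹ • x
    rw [one_mul, mul_inv_rev, inv_inv, op_mul, mul_smul, smul_comm]

/-- `RB(G, H)` is generated by the transitive bisets. -/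
theorem RBurnside.hom_ext_transitive [Finite G] [Finite H] {A : Type*} [AddCommGroup A]
    [Module R A] {f g : RBurnside R G H →ₗ[R] A}
    (h : ∀ X : Subgroup (G × H), f (cls R (transitive X)) = g (cls R (transitive X))) :
    f = g := by
  refine RBurnside.hom_ext R fun U => ?_
  have h1 : ∀ (a : G) x, (Quotient.mk U.orbitRel (a • x)) = Quotient.mk _ x := fun a x =>
    Quotient.sound (s := U.orbitRel) (U.orbitRel.symm ⟨a, 1, by simp⟩)
  have h2 : ∀ (a : H) x, (Quotient.mk U.orbitRel (op a • x)) = Quotient.mk _ x := fun a x =>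
    Quotient.sound (s := U.orbitRel) (U.orbitRel.symm ⟨1, a, by simp⟩)
  let := Fintype.ofFinite (Quotient U.orbitRel)
  rw [cls_eq_sum_fiber R U _ h1 h2, map_sum, map_sum]
  refine Finset.sum_congr rfl fun ω _ => ?_
  obtain ⟨x, rfl⟩ := Quotient.exists_rep ω
  have := cls_eq R (U.fiber_orbit_iso x h1 h2)
  exact this ▸ h _

theorem fiber_tilde_iso [Finite G] (U : Type w) [Finite U] [MulAction G U] (x : U) (h1 h2) :
    FinBiset.Iso (tilde (G := G) (G ⧸ MulAction.stabilizer G x))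
      ((tilde (G := G) U).fiber (ι := MulAction.orbitRel.Quotient G U)
        (fun y => Quotient.mk _ y.2) h1 h2 {Quotient.mk _ x}) := by
  refine FinBiset.Iso.of_bijective (fun y : G × (G ⧸ MulAction.stabilizer G x) =>
    ⟨(y.1, MulAction.ofQuotientStabilizer G x y.2), ?_⟩) ⟨?_, ?_⟩ ?_ ?_
  · exact Quotient.sound (s := MulAction.orbitRel G U)
      (MulAction.ofQuotientStabilizer_mem_orbit G x y.2)
  · rintro ⟨a, b⟩ ⟨c, d⟩ h
    have h : (a, MulAction.ofQuotientStabilizer G x b) =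
      (c, MulAction.ofQuotientStabilizer G x d) := congrArg Subtype.val h
    exact Prod.ext (Prod.mk.inj h).1
      (MulAction.injective_ofQuotientStabilizer G x (Prod.mk.inj h).2)
  · rintro ⟨⟨g, y⟩, hy⟩
    obtain ⟨a, rfl⟩ : y ∈ MulAction.orbit G x := Quotient.exact hy
    exact ⟨(g, (a : G ⧸ _)), rfl⟩
  · rintro g ⟨a, b⟩
    exact Subtype.ext (Prod.ext rfl (MulAction.ofQuotientStabilizer_smul G x g b))
  · rintro g ⟨a, b⟩
    rfl

/-- By orbit counting, the factor `|G|` trades the sum over orbits for a sum over points weighted by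
stabilizers. No orbit representatives are chosen, and this takes the place of the double-coset
Mackey formula. -/
theorem card_smul_cls_tilde [Finite G] (U : Type w) [Fintype U] [MulAction G U] :
    Nat.card G • cls R (tilde (G := G) U) = ∑ x : U, Nat.card (MulAction.stabilizer G x) •
      cls R (tilde (G := G) (G ⧸ MulAction.stabilizer G x)) := by
  classical
  have h1 : ∀ (g : G) (x : G × U), (Quotient.mk (MulAction.orbitRel G U) (g • x).2) =
      Quotient.mk _ x.2 := fun g x => Quotient.sound (s := MulAction.orbitRel G U) ⟨g, rfl⟩
  let := Fintype.ofFinite (MulAction.orbitRel.Quotient G U)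
  let := Fintype.ofFinite G
  rw [cls_eq_sum_fiber R (tilde (G := G) U) (ι := MulAction.orbitRel.Quotient G U)
    (fun y => Quotient.mk _ y.2) h1 fun _ _ => rfl,
    ← Finset.sum_fiberwise _ (Quotient.mk (MulAction.orbitRel G U)), Finset.smul_sum]
  refine Finset.sum_congr rfl fun ω _ => ?_
  obtain ⟨x, rfl⟩ := Quotient.exists_rep ω
  rw [Finset.sum_congr (g := fun y => Nat.card (MulAction.stabilizer G x) •
    cls R ((tilde (G := G) U).fiber (ι := MulAction.orbitRel.Quotient G U)
    (fun y => Quotient.mk _ y.2) h1 (fun _ _ => rfl) {Quotient.mk _ x})) rfl]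
  · rw [Finset.sum_const, smul_smul]
    congr 1
    rw [Nat.card_eq_fintype_card (α := G),
      ← MulAction.card_orbit_mul_card_stabilizer_eq_card_group G x, ← Nat.card_eq_fintype_card,
      ← Nat.card_eq_fintype_card]
    congr 1
    rw [Nat.card_eq_fintype_card, Fintype.card_subtype]
    congr 1
    ext y
    simp only [Finset.mem_filter, Finset.mem_univ, true_and]
    exact ⟨fun h => Quotient.sound (s := MulAction.orbitRel G U) h, fun h => Quotient.exact h⟩
  · intro y hy
    have hy := (Finset.mem_filter.1 hy).2
    rw [cls_eq R (fiber_tilde_iso U y h1 fun _ _ => rfl), hy]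
    congr 1
    obtain ⟨a, rfl⟩ : y ∈ MulAction.orbit G x := Quotient.exact hy
    exact (Nat.card_congr (MulAction.stabilizerEquivStabilizer (g := a) rfl).toEquiv).symm

end

end BisetFun

/-! ### The idempotent `ẽ_G` -/

namespace BisetFun

open CategoryTheory Limits MulOpposite TensorProduct FinBiset

noncomputable section

/-- The product `×_H`. -/
local infixl:70 " ⊙ " => rbMul _

variable (R : Type u) [CommRing R] {G H K : Type w} [Group G] [Group H] [Group K]

theorem cls_indB_mul [Finite G] [Finite H] (f : H →* G) (g : K →* H) :
    cls R (indB f) ⊙ cls R (indB g) = cls R (indB (f.comp g)) := by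
  rw [rbMul_cls, cls_eq R (indB_tensor_indB f g)]

theorem cls_resB_mul [Finite G] [Finite H] (f : H →* G) (g : K →* H) :
    cls R (resB g) ⊙ cls R (resB f) = cls R (resB (f.comp g)) := by
  rw [← rbOpp_bi R (MonoidHom.id H) g, ← rbOpp_bi R (MonoidHom.id G) f, ← rbOpp_rbMul, cls_indB_mul,
    rbOpp_bi]

theorem cls_resB_mul_indB [Finite H] (f : G →* H) (g : K →* H) :
    cls R (resB f) ⊙ cls R (indB g) = cls R (bi f g) := by
  rw [rbMul_cls, cls_eq R (resB_tensor_indB f g)]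

variable {R}

theorem isUnit_card_of_dvd {m n : ℕ} (h : IsUnit (n : R)) (hd : m ∣ n) : IsUnit (m : R) :=
  isUnit_of_dvd_unit (Nat.cast_dvd_cast hd) h

theorem isUnit_card_subgroup (h : IsUnit (Nat.card G : R)) (T : Subgroup G) :
    IsUnit (Nat.card T : R) :=
  isUnit_card_of_dvd h T.card_subgroup_dvd_card

theorem isUnit_card_of_surjective (h : IsUnit (Nat.card G : R)) (f : G →* H)
    (hf : Function.Surjective f) : IsUnit (Nat.card H : R) :=
  isUnit_card_of_dvd h (Subgroup.card_dvd_of_surjective f hf)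

theorem sum_mk_eq_card_smul [Fintype G] (Y : Subgroup G) [Fintype (G ⧸ Y)] {A : Type*}
    [AddCommGroup A] (F : G ⧸ Y → A) : ∑ g : G, F (g : G ⧸ Y) = Nat.card Y • ∑ x, F x := by
  classical
  rw [← Finset.sum_fiberwise _ (fun g : G => (g : G ⧸ Y)), Finset.smul_sum]
  refine Finset.sum_congr rfl fun ω _ => ?_
  obtain ⟨x, rfl⟩ := QuotientGroup.mk_surjective ω
  rw [Finset.sum_congr (g := fun _ => F x) rfl (fun g hg => by rw [(Finset.mem_filter.1 hg).2]),
    Finset.sum_const]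
  congr 1
  rw [← Fintype.card_subtype, ← Nat.card_eq_fintype_card]
  refine Nat.card_congr ⟨fun g => ⟨x⁻¹ * g.1, QuotientGroup.eq.1 g.2.symm⟩,
    fun y => ⟨x * y.1, (QuotientGroup.eq.2 (by simp)).symm⟩, fun g => ?_, fun y => ?_⟩
  · simp
  · simp

variable (R) [Finite G] [Finite H]

theorem cls_tilde (X : Subgroup G) :
    cls R (tilde (G := G) (G ⧸ X)) = cls R (indB X.subtype) ⊙ cls R (resB X.subtype) := by
  rw [rbMul_cls, cls_eq R (tilde_iso X)]

theorem rbOpp_tilde (X : Subgroup G) :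
    rbOpp R (cls R (tilde (G := G) (G ⧸ X))) = cls R (tilde (G := G) (G ⧸ X)) := by
  rw [cls_tilde, rbOpp_rbMul, rbOpp_bi, rbOpp_bi]

theorem rbOpp_eTilde : rbOpp R (eTilde R G) = eTilde R G := by
  simp only [eTilde, map_smul, map_sum, map_zsmul, rbOpp_tilde]

theorem cls_tilde_top : cls R (tilde (G := G) (G ⧸ (⊤ : Subgroup G))) = cls R (regular G) := by
  refine cls_eq R (Iso.of_bijective (fun x : G × (G ⧸ (⊤ : Subgroup G)) => (x.1 : G))
    ⟨?_, ?_⟩ ?_ ?_)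
  · rintro ⟨a, b⟩ ⟨c, d⟩ h
    have := QuotientGroup.subsingleton_quotient_top (G := G)
    exact Prod.ext h (Subsingleton.elim b d)
  · exact fun x : G => ⟨(x, QuotientGroup.mk x), rfl⟩
  · exact fun _ _ => rfl
  · exact fun _ _ => rfl

variable {R}

theorem card_smul_eTilde (h : IsUnit (Nat.card G : R)) :
    (Nat.card G : R) • eTilde R G =
      ∑ X : Subgroup G, ((Nat.card X : ℤ) * moebius X ⊤) • cls R (tilde (G := G) (G ⧸ X)) := by
  rw [eTilde, smul_smul, Ring.mul_inverse_cancel _ h, one_smul]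

/-- This says that `e_G^G` restricts to zero on a proper subgroup, up to the factors `|G|` and
`|X|`. For a fixed `g`, the stabilizer in `X` of the coset `g Y` depends on `Y`, and the
coefficients `μ(Y, G)` cancel along this dependence. -/
theorem sum_moebius_smul_tilde_subgroup (X : Subgroup G) (hX : X ≠ ⊤) :
    ∑ Y : Subgroup G, ((Nat.card Y : ℤ) * moebius Y ⊤) •
      Nat.card X • cls R (tilde (G := X) (G ⧸ Y)) = 0 := by
  classical
  let := Fintype.ofFinite G
  have h1 : ∀ Y : Subgroup G, ((Nat.card Y : ℤ) * moebius Y ⊤) •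
      Nat.card X • cls R (tilde (G := X) (G ⧸ Y)) =
      ∑ g : G, moebius Y ⊤ • (Nat.card (MulAction.stabilizer X (g : G ⧸ Y)) •
        cls R (tilde (G := X) (X ⧸ MulAction.stabilizer X (g : G ⧸ Y)))) := by
    intro Y
    let := Fintype.ofFinite (G ⧸ Y)
    rw [card_smul_cls_tilde, mul_comm, mul_smul, natCast_zsmul, ← Finset.smul_sum,
      sum_mk_eq_card_smul Y (fun x => Nat.card (MulAction.stabilizer X x) •
        cls R (tilde (G := X) (X ⧸ MulAction.stabilizer X x)))]
  rw [Finset.sum_congr rfl fun Y _ => h1 Y, Finset.sum_comm]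
  refine Finset.sum_eq_zero fun g _ => ?_
  refine sum_smul_comp_eq_zero (fun Y : Subgroup G => MulAction.stabilizer X (g : G ⧸ Y)) _
    (fun Z => ?_) (fun Z => Nat.card Z • cls R (tilde (G := X) (X ⧸ Z)))
  -- `Z` fixes `g Y` exactly when `g⁻¹ Z g ≤ Y`, so the sum to be shown zero runs over an upper
  -- interval of the subgroup lattice. It vanishes because `g⁻¹ Z g = G` would force `X = G`.
  have h2 : ∀ Y : Subgroup G, Z ≤ MulAction.stabilizer X (g : G ⧸ Y) ↔
      (Z.map X.subtype).map (MulAut.conj g⁻¹).toMonoidHom ≤ Y := by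
    intro Y
    rw [Subgroup.map_map, Subgroup.map_le_iff_le_comap]
    refine forall_congr' fun x => imp_congr_right fun _ => ?_
    rw [MulAction.mem_stabilizer_iff, Subgroup.mem_comap]
    change ((x.1 * g : G) : G ⧸ Y) = g ↔ _
    rw [eq_comm, QuotientGroup.eq]
    simp [mul_assoc]
  simp only [h2]
  rw [sum_moebius_left, if_neg]
  intro h
  apply hX
  rw [eq_top_iff]
  intro x _
  have h3 : g⁻¹ * x * g ∈ (Z.map X.subtype).map (MulAut.conj g⁻¹).toMonoidHom := h ▸ trivial
  obtain ⟨y, ⟨z, hz, rfl⟩, h4⟩ := h3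
  have h5 : g⁻¹ * (z : G) * g = g⁻¹ * x * g := by simpa using h4
  have h6 : (z : G) = x := by simpa using h5
  exact h6 ▸ z.2

/-- The projection formula moves `ẽ_G` past the induction, where it becomes the vanishing
restriction to `X`. The units `|G|` and `|X|` are introduced to clear denominators. -/
theorem eTilde_mul_indB_subtype (h : IsUnit (Nat.card G : R)) (X : Subgroup G) (hX : X ≠ ⊤) :
    eTilde R G ⊙ cls R (indB X.subtype) = 0 := by
  rw [← h.smul_left_cancel, smul_zero, ← LinearMap.map_smul₂, card_smul_eTilde h,
    ← (isUnit_card_subgroup h X).smul_left_cancel, smul_zero]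
  have h1 : ∀ Y : Subgroup G, cls R (tilde (G := G) (G ⧸ Y)) ⊙ cls R (indB X.subtype) =
      cls R (indB X.subtype) ⊙ cls R (tilde (G := X) (G ⧸ Y)) := fun Y => by
    rw [rbMul_cls, rbMul_cls, cls_eq R (tilde_tensor_indB _ _)]
    exact (cls_eq R (indB_tensor_tilde X (G ⧸ Y))).symm
  have h2 := congrArg (rbMul R (cls R (indB X.subtype)))
    (sum_moebius_smul_tilde_subgroup (R := R) X hX)
  rw [map_zero, map_sum] at h2
  rw [map_sum, LinearMap.sum_apply, Finset.smul_sum, ← h2]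
  refine Finset.sum_congr rfl fun Y _ => ?_
  rw [map_zsmul, map_zsmul, LinearMap.smul_apply, h1, map_nsmul, smul_comm, Nat.cast_smul_eq_nsmul]

theorem eTilde_mul_indB (h : IsUnit (Nat.card G : R)) [Finite K] (f : K →* G)
    (hf : ¬ Function.Surjective f) : eTilde R G ⊙ cls R (indB f) = 0 := by
  have h1 : f = f.range.subtype.comp f.rangeRestrict := rfl
  rw [h1, ← cls_indB_mul, ← rbMul_assoc, eTilde_mul_indB_subtype h, LinearMap.map_zero₂]
  exact fun h2 => hf (MonoidHom.range_eq_top.1 h2)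

theorem resB_mul_eTilde (h : IsUnit (Nat.card G : R)) [Finite K] (f : K →* G)
    (hf : ¬ Function.Surjective f) : cls R (resB f) ⊙ eTilde R G = 0 := by
  rw [← rbOpp_bi R (MonoidHom.id G) f, ← rbOpp_eTilde, ← rbOpp_rbMul, eTilde_mul_indB h f hf, map_zero]

/-- In the expansion of the right factor, every term with `X` proper begins with an induction from
`X` and is killed; the term `X = G` is the identity with coefficient `|G|`. -/
theorem eTilde_mul_self (h : IsUnit (Nat.card G : R)) :
    eTilde R G ⊙ eTilde R G = eTilde R G := by
  rw [← h.smul_left_cancel, ← map_smul]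
  nth_rewrite 1 [card_smul_eTilde h]
  rw [map_sum, Finset.sum_eq_single ⊤]
  · rw [moebius_self, mul_one, map_zsmul, cls_tilde_top, rbMul_one, Subgroup.card_top, natCast_zsmul,
      Nat.cast_smul_eq_nsmul]
  · intro X _ hX
    rw [map_zsmul, cls_tilde, ← rbMul_assoc, eTilde_mul_indB_subtype h X hX, LinearMap.map_zero₂,
      smul_zero]
  · simp

variable (R) in
theorem cls_indB_mul_resB_equiv {G : Type w} [Group G] (e : G ≃* H) :
    cls R (indB e.toMonoidHom) ⊙ cls R (resB e.toMonoidHom) = cls R (regular H) := by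
  rw [rbMul_cls]
  refine cls_eq R (tensor_iso (fun x y : H => (x * y : H)) ?_ ?_ ?_ ?_ ?_)
  · exact fun (x : H) h (y : H) => mul_assoc x (e h) y
  · exact fun g (x y : H) => mul_assoc g x y
  · exact fun g (x y : H) => (mul_assoc x y g).symm
  · intro (x : H) (y : H) (x' : H) (y' : H) h
    refine ⟨e.symm (x⁻¹ * x'), ?_, ?_⟩
    · change x' = x * e (e.symm (x⁻¹ * x'))
      rw [e.apply_symm_apply]; group
    · change y' = e (e.symm (x⁻¹ * x'))⁻¹ * y
      rw [map_inv, e.apply_symm_apply, mul_inv_rev, inv_inv, mul_assoc]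
      exact eq_inv_mul_of_mul_eq h.symm
  · exact fun x : H => ⟨(1 : H), x, one_mul x⟩

variable (R) in
theorem ind_tilde_res (T : Subgroup G) (X : Subgroup T) :
    cls R (indB T.subtype) ⊙ cls R (tilde (G := T) (T ⧸ X)) ⊙ cls R (resB T.subtype) =
      cls R (tilde (G := G) (G ⧸ X.map T.subtype)) := by
  let e := X.equivMapOfInjective T.subtype T.subtype_injective
  have h1 : T.subtype.comp X.subtype = (X.map T.subtype).subtype.comp e.toMonoidHom := by
    ext; rfl
  rw [cls_tilde, ← rbMul_assoc, cls_indB_mul, rbMul_assoc, cls_resB_mul, h1, ← cls_indB_mul,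
    ← cls_resB_mul, rbMul_assoc, ← rbMul_assoc R (cls R (indB e.toMonoidHom)), cls_tilde,
    cls_indB_mul_resB_equiv, one_rbMul]

/-- Every finite group `G` satisfies `|G| · 1 = ∑ |T| Ind_T^G ẽ_T Res_T^G` in `RB(G, G)`. -/
theorem card_smul_regular (h : IsUnit (Nat.card G : R)) :
    (Nat.card G : R) • cls R (regular G) = ∑ T : Subgroup G, (Nat.card T : R) •
      (cls R (indB T.subtype) ⊙ eTilde R T ⊙ cls R (resB T.subtype)) := by
  classical
  have h1 : ∀ T : Subgroup G, (Nat.card T : R) •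
      (cls R (indB T.subtype) ⊙ eTilde R T ⊙ cls R (resB T.subtype)) =
      ∑ X : Subgroup G,
        moebius X T • (Nat.card X • cls R (tilde (G := G) (G ⧸ X))) := by
    intro T
    rw [← LinearMap.map_smul₂, ← map_smul, card_smul_eTilde (isUnit_card_subgroup h T), map_sum,
      map_sum, LinearMap.sum_apply]
    refine Finset.sum_of_injOn (fun X => X.map T.subtype)
      (Subgroup.map_injective T.subtype_injective).injOn ?_ ?_ ?_
    · simp
    · intro X _ hX
      rw [moebius_eq_zero_of_not_le, zero_smul]
      intro hXT
      refine hX ⟨X.subgroupOf T, by simp, ?_⟩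
      simpa using hXT
    · intro X _
      rw [map_zsmul, map_zsmul, LinearMap.smul_apply, ind_tilde_res, mul_comm, mul_smul,
        natCast_zsmul]
      congr 1
      · have h2 := moebius_map (fun Z : Subgroup T => Z.map T.subtype)
          (fun Y Z => Subgroup.map_le_map_iff_of_injective T.subtype_injective) X ⊤ (fun Z _ hZ => by
            refine ⟨Z.subgroupOf T, Subgroup.map_subgroupOf_eq_of_le ?_⟩
            rwa [← MonoidHom.range_eq_map, Subgroup.range_subtype] at hZ)
        rw [← h2, ← MonoidHom.range_eq_map, Subgroup.range_subtype]
      · congr 1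
        exact Nat.card_congr (X.equivMapOfInjective T.subtype T.subtype_injective).toEquiv
  rw [Finset.sum_congr rfl fun T _ => h1 T, Finset.sum_comm]
  simp only [← Finset.sum_smul]
  -- The coefficient of `|X| [G × G/X]` is now the sum of `μ(X, T)` over all `T`, which is nonzero
  -- only for `X = G`.
  have h3 : ∀ X : Subgroup G, ∑ T, moebius X T = if X = ⊤ then 1 else 0 := fun X => by
    rw [← sum_moebius_right]
    simp
  simp only [h3, ite_smul, one_smul, zero_smul]
  rw [Finset.sum_ite_eq' Finset.univ ⊤]
  simp [cls_tilde_top, Nat.cast_smul_eq_nsmul]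

end

end BisetFun

/-! ### Passage to quotients by subgroups of the Frattini subgroup, and `φ_1^G` -/

namespace BisetFun

open CategoryTheory Limits MulOpposite TensorProduct FinBiset

noncomputable section

/-- The product `×_H`. -/
local infixl:70 " ⊙ " => rbMul _

/-- When the kernel lies in `Φ(G)`, every maximal subgroup of `G` contains it, so its image is a
maximal subgroup of `H`. -/
theorem comap_frattini {G H : Type*} [Group G] [Group H] (f : G →* H)
    (hf : Function.Surjective f) (hk : f.ker ≤ frattini G) :
    (frattini H).comap f = frattini G := by
  refine le_antisymm ?_ (frattini_le_comap_frattini_of_surjective hf)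
  simp_rw [frattini, Order.radical, le_iInf_iff]
  intro K hK x hx
  have h1 : f.ker ≤ K := hk.trans (frattini_le_coatom hK)
  have h2 : IsCoatom (K.map f) := by
    refine ⟨fun h => hK.1 ?_, fun L hL => ?_⟩
    · rw [← Subgroup.comap_map_eq_self h1, h, Subgroup.comap_top]
    · have h3 : K < L.comap f := by
        rw [← Subgroup.comap_map_eq_self h1]
        exact (Subgroup.comap_lt_comap_of_surjective hf).2 hL
      have h4 := hK.2 _ h3
      rwa [← Subgroup.comap_top f, (Subgroup.comap_injective hf).eq_iff] at h4
  have h3 : f x ∈ K.map f := frattini_le_coatom h2 hx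
  rwa [← Subgroup.mem_comap, Subgroup.comap_map_eq_self h1] at h3

variable {R : Type u} [CommRing R] {G H K : Type w} [Group G] [Group H] [Group K]

theorem card_comap_mul (f : G →* H) (hf : Function.Surjective f) (X : Subgroup H) :
    Nat.card H * Nat.card (X.comap f) = Nat.card G * Nat.card X := by
  rw [← X.card_mul_index, ← (X.comap f).card_mul_index, X.index_comap_of_surjective hf]
  ring

variable [Finite G] [Finite H]

theorem tilde_comap_mul_resB (f : G →* H) (hf : Function.Surjective f) (X : Subgroup H) :
    cls R (tilde (G := G) (G ⧸ X.comap f)) ⊙ cls R (resB f) =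
      cls R (resB f) ⊙ cls R (tilde (G := H) (H ⧸ X)) := by
  have h1 : f.comp (X.comap f).subtype = X.subtype.comp (f.subgroupComap X) := rfl
  rw [cls_tilde, cls_tilde, rbMul_assoc, cls_resB_mul, h1, ← cls_resB_mul, ← rbMul_assoc,
    ← rbMul_assoc, cls_resB_mul_indB, rbMul_cls, cls_eq R (bi_comap_iso f hf X)]

/-- Only subgroups containing `Φ(G)`, hence `ker f`, contribute to `ẽ_G` (`moebius_top_eq_zero`).
They are preimages of subgroups of `H`, with the same Möbius values, and `|H| |f⁻¹(X)| = |G| |X|`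
matches the scalars. -/
theorem eTilde_mul_resB (h : IsUnit (Nat.card G : R)) (f : G →* H) (hf : Function.Surjective f)
    (hk : f.ker ≤ frattini G) :
    eTilde R G ⊙ cls R (resB f) = cls R (resB f) ⊙ eTilde R H := by
  have hH := isUnit_card_of_surjective h f hf
  rw [← h.smul_left_cancel, ← hH.smul_left_cancel, ← LinearMap.map_smul₂, card_smul_eTilde h,
    smul_comm (Nat.card H : R) (Nat.card G : R) (cls R (resB f) ⊙ eTilde R H),
    ← (rbMul R (cls R (resB f))).map_smul, card_smul_eTilde hH, map_sum, LinearMap.sum_apply, Finset.smul_sum,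
    map_sum, Finset.smul_sum]
  symm
  refine Finset.sum_of_injOn (fun X => X.comap f) (Subgroup.comap_injective hf).injOn ?_ ?_ ?_
  · simp
  · intro X _ hX
    rw [moebius_top_eq_zero, mul_zero, zero_smul, map_zero, LinearMap.zero_apply, smul_zero]
    intro hXT
    exact hX ⟨X.map f, by simp, Subgroup.comap_map_eq_self (hk.trans hXT)⟩
  · intro X _
    have h2 := moebius_map (fun Z : Subgroup H => Z.comap f)
      (fun Y Z => Subgroup.comap_le_comap_of_surjective hf) X ⊤ (fun Z hZ _ =>
        ⟨Z.map f, Subgroup.comap_map_eq_self ((Subgroup.ker_le_comap f X).trans hZ)⟩)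
    have h2 : moebius (X.comap f) ⊤ = moebius X ⊤ := h2
    have h3 := card_comap_mul f hf X
    rw [map_zsmul, map_zsmul, LinearMap.smul_apply, tilde_comap_mul_resB f hf, h2,
      Nat.cast_smul_eq_nsmul, Nat.cast_smul_eq_nsmul, ← natCast_zsmul, ← natCast_zsmul,
      smul_smul, smul_smul, ← mul_assoc, ← mul_assoc]
    norm_cast
    rw [h3]

theorem indB_mul_eTilde (h : IsUnit (Nat.card G : R)) (f : G →* H) (hf : Function.Surjective f)
    (hk : f.ker ≤ frattini G) :
    cls R (indB f) ⊙ eTilde R G = eTilde R H ⊙ cls R (indB f) := by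
  have h1 := congrArg (rbOpp R) (eTilde_mul_resB h f hf hk)
  rwa [rbOpp_rbMul, rbOpp_rbMul, rbOpp_eTilde, rbOpp_eTilde, rbOpp_bi] at h1

variable (R) in
theorem cls_Delta (f : G →* H) (hf : Function.Surjective f) {N : Subgroup G} (hN : N.Normal)
    (h : f.ker = N) :
    cls R (transitive (Delta N hN)) = cls R (resB f) ⊙ cls R (indB f) := by
  rw [cls_resB_mul_indB, cls_eq R (transitive_Delta_iso f hf hN h)]

theorem eTilde_mul_Delta (h : IsUnit (Nat.card G : R)) (N : Subgroup G) (hN : N.Normal)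
    (hk : N ≤ frattini G) : eTilde R G ⊙ cls R (transitive (Delta N hN)) =
      cls R (transitive (Delta N hN)) ⊙ eTilde R G := by
  have hf := QuotientGroup.mk'_surjective N
  have hk' : (QuotientGroup.mk' N).ker ≤ frattini G := by rwa [QuotientGroup.ker_mk']
  rw [cls_Delta R (QuotientGroup.mk' N) hf hN (QuotientGroup.ker_mk' N), ← rbMul_assoc,
    eTilde_mul_resB h _ hf hk', rbMul_assoc, rbMul_assoc, indB_mul_eTilde h _ hf hk']

variable (R) in
theorem Delta_mul_Delta (M N : Subgroup G) (hM : M.Normal) (hN : N.Normal)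
    (hMN : (M ⊔ N).Normal) :
    cls R (transitive (Delta M hM)) ⊙ cls R (transitive (Delta N hN)) =
      cls R (transitive (Delta (M ⊔ N) hMN)) := by
  rw [cls_eq R (transitive_Delta_iso _ (QuotientGroup.mk'_surjective M) hM (QuotientGroup.ker_mk' M)),
    cls_eq R (transitive_Delta_iso _ (QuotientGroup.mk'_surjective N) hN (QuotientGroup.ker_mk' N)),
    cls_eq R (transitive_Delta_iso _ (QuotientGroup.mk'_surjective (M ⊔ N)) hMN
      (QuotientGroup.ker_mk' _)), rbMul_cls]
  let h := QuotientGroup.map M (M ⊔ N) (MonoidHom.id G) le_sup_left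
  let k := QuotientGroup.map N (M ⊔ N) (MonoidHom.id G) le_sup_right
  refine cls_eq R (tensor_iso (fun (x : G ⧸ M) (y : G ⧸ N) => (h x * k y : G ⧸ (M ⊔ N)))
    ?_ ?_ ?_ ?_ ?_)
  · intro (x : G ⧸ M) g (y : G ⧸ N)
    change h (x * (g : G ⧸ M)) * k y = h x * k ((g : G ⧸ N) * y)
    rw [map_mul, map_mul, mul_assoc]
    rfl
  · intro g (x : G ⧸ M) (y : G ⧸ N)
    change h ((g : G ⧸ M) * x) * k y = (g : G ⧸ (M ⊔ N)) * (h x * k y)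
    rw [map_mul, mul_assoc]
    rfl
  · intro g (x : G ⧸ M) (y : G ⧸ N)
    change h x * k (y * (g : G ⧸ N)) = (h x * k y) * (g : G ⧸ (M ⊔ N))
    rw [map_mul, mul_assoc]
    rfl
  · intro (x : G ⧸ M) (y : G ⧸ N) (x' : G ⧸ M) (y' : G ⧸ N) e
    obtain ⟨a, rfl⟩ := QuotientGroup.mk_surjective x
    obtain ⟨b, rfl⟩ := QuotientGroup.mk_surjective y
    obtain ⟨a', rfl⟩ := QuotientGroup.mk_surjective x'
    obtain ⟨b', rfl⟩ := QuotientGroup.mk_surjective y'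
    have e : ((a * b : G) : G ⧸ (M ⊔ N)) = ((a' * b' : G) : G ⧸ (M ⊔ N)) := e
    have e2 := hMN.conj_mem _ (QuotientGroup.eq.1 e) b
    have e3 : b * ((a * b)⁻¹ * (a' * b')) * b⁻¹ = a⁻¹ * a' * (b' * b⁻¹) := by group
    rw [e3] at e2
    -- Two pairs with the same product modulo `M N` differ by some `m * n`. The component `m` is
    -- absorbed modulo `M`, the component `n` modulo `N`, and this determines the element of `G`
    -- relating the pairs.
    obtain ⟨m, hm, n, hn, e4⟩ := Subgroup.mem_sup_of_normal_left.1 e2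
    refine ⟨m⁻¹ * (a⁻¹ * a'), ?_, ?_⟩
    · change (a' : G ⧸ M) = ((a * (m⁻¹ * (a⁻¹ * a')) : G) : G ⧸ M)
      rw [eq_comm, QuotientGroup.eq]
      convert hM.conj_mem _ hm (a'⁻¹ * a) using 1
      group
    · change (b' : G ⧸ N) = (((m⁻¹ * (a⁻¹ * a'))⁻¹ * b : G) : G ⧸ N)
      have e5 : b' = (a⁻¹ * a')⁻¹ * (m * n) * b := by rw [e4]; group
      rw [eq_comm, QuotientGroup.eq, e5]
      convert hN.conj_mem _ hn b⁻¹ using 1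
      group
  · intro (x : G ⧸ (M ⊔ N))
    obtain ⟨a, rfl⟩ := QuotientGroup.mk_surjective x
    exact ⟨(a : G ⧸ M), ((1 : G) : G ⧸ N), mul_one (a : G ⧸ (M ⊔ N))⟩

variable (R)

open Classical in
/-- The element `φ_N^G = ∑ μ(N, M) Y_{Δ_M(G)}` of `RB(G, G)`, for a normal subgroup `N` of `G`. -/
def phiAt (N : {N : Subgroup G // N.Normal}) : RBurnside R G G :=
  ∑ M : {N : Subgroup G // N.Normal} with M.1 ≤ frattini G, moebius N M • Y R (Delta M.1 M.2)

theorem rbOpp_Y_Delta (N : Subgroup G) (hN : N.Normal) :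
    rbOpp R (Y R (Delta N hN)) = Y R (Delta N hN) := by
  have h : rbOpp R (cls R (transitive (Delta N hN))) = cls R (transitive (Delta N hN)) := by
    rw [cls_Delta R (QuotientGroup.mk' N) (QuotientGroup.mk'_surjective N) hN
      (QuotientGroup.ker_mk' N), rbOpp_rbMul, rbOpp_bi, rbOpp_bi]
  rw [Y, rbOpp_rbMul, rbOpp_rbMul, h, rbOpp_eTilde, rbMul_assoc]

theorem rbOpp_phiOne : rbOpp R (phiOne R G) = phiOne R G := by
  simp only [phiOne, map_sum, map_zsmul, rbOpp_Y_Delta]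

variable {R}

theorem resB_mul_Y_Delta_mul_indB (h : IsUnit (Nat.card G : R)) (f : G →* H)
    (hf : Function.Surjective f) (hk : f.ker ≤ frattini G) (M : Subgroup H) (hM : M.Normal) :
    cls R (resB f) ⊙ Y R (Delta M hM) ⊙ cls R (indB f) =
      Y R (Delta (M.comap f) (hM.comap f)) := by
  have h1 : ((QuotientGroup.mk' M).comp f).ker = M.comap f := by
    rw [← MonoidHom.comap_ker, QuotientGroup.ker_mk']
  have h2 : Function.Surjective ((QuotientGroup.mk' M).comp f) :=
    (QuotientGroup.mk'_surjective M).comp hf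
  rw [Y, Y, cls_Delta R _ h2 (hM.comap f) h1,
    cls_Delta R _ (QuotientGroup.mk'_surjective M) hM (QuotientGroup.ker_mk' M), ← cls_resB_mul,
    ← cls_indB_mul]
  simp only [rbMul_assoc]
  rw [← indB_mul_eTilde h f hf hk]
  simp only [← rbMul_assoc]
  rw [eTilde_mul_resB h f hf hk]

/-- Normal subgroups of `H` correspond to normal subgroups of `G` above `ker f`, compatibly with
Möbius values and with the bound by the Frattini subgroup; each `Y` term is transported by
`resB_mul_Y_Delta_mul_indB`. -/
theorem resB_mul_phiOne_mul_indB (h : IsUnit (Nat.card G : R)) (f : G →* H)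
    (hf : Function.Surjective f) (hk : f.ker ≤ frattini G) :
    cls R (resB f) ⊙ phiOne R H ⊙ cls R (indB f) = phiAt R ⟨f.ker, inferInstance⟩ := by
  let e : {N : Subgroup H // N.Normal} → {N : Subgroup G // N.Normal} :=
    fun M => ⟨M.1.comap f, M.2.comap f⟩
  have he : ∀ M N, e M ≤ e N ↔ M ≤ N := fun M N => Subgroup.comap_le_comap_of_surjective hf
  have hr : ∀ M : {N : Subgroup G // N.Normal}, f.ker ≤ M.1 → M ∈ Set.range e := fun M hM =>
    ⟨⟨M.1.map f, M.2.map f hf⟩, Subtype.ext (Subgroup.comap_map_eq_self hM)⟩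
  have h0 : e ⟨⊥, inferInstance⟩ = ⟨f.ker, inferInstance⟩ := Subtype.ext (MonoidHom.comap_bot f)
  rw [phiOne, phiAt, map_sum, map_sum, LinearMap.sum_apply]
  refine Finset.sum_of_injOn e (fun M _ N _ hMN =>
    le_antisymm ((he M N).1 hMN.le) ((he N M).1 hMN.ge)) ?_ ?_ ?_
  · intro M hM
    simp only [Finset.coe_filter, Finset.mem_univ, true_and, Set.mem_ofPred_eq] at hM ⊢
    rw [← comap_frattini f hf hk]
    exact Subgroup.comap_mono hM
  · intro M hM hM'
    rw [moebius_eq_zero_of_not_le, zero_smul]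
    intro hle
    obtain ⟨N, rfl⟩ := hr M hle
    refine hM' ⟨N, ?_, rfl⟩
    simp only [Finset.coe_filter, Finset.mem_filter, Finset.mem_univ, true_and,
      Set.mem_ofPred_eq] at hM ⊢
    rwa [← comap_frattini f hf hk, Subgroup.comap_le_comap_of_surjective hf] at hM
  · intro M _
    rw [map_zsmul, map_zsmul, LinearMap.smul_apply, resB_mul_Y_Delta_mul_indB h f hf hk, ← h0,
      moebius_map e he _ M fun z hz _ => hr z (by rw [h0] at hz; exact hz)]

open Classical in
-- After exchanging the sums, the coefficient of `Y_{Δ_M}` is the sum of `μ(N, M)` over all normal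
-- `N ≤ M`, since such `N` automatically lie in `Φ(G)`. Only `M = 1` survives, and there `Y` is `ẽ_G
-- ẽ_G = ẽ_G`.
theorem sum_phiAt (h : IsUnit (Nat.card G : R)) :
    ∑ N : {N : Subgroup G // N.Normal} with N.1 ≤ frattini G, phiAt R N = eTilde R G := by
  simp only [phiAt]
  rw [Finset.sum_comm]
  simp only [← Finset.sum_smul]
  have h1 : ∀ M : {N : Subgroup G // N.Normal}, M.1 ≤ frattini G →
      ∑ N : {N : Subgroup G // N.Normal} with N.1 ≤ frattini G, moebius N M =
        if ⟨⊥, inferInstance⟩ = M then 1 else 0 := by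
    intro M hM
    refine Eq.trans ?_ ((sum_moebius_left (⟨⊥, inferInstance⟩ : {N : Subgroup G // N.Normal}) M).trans
      (by congr))
    refine Finset.sum_subset (fun N _ => ?_) (fun N _ hN => ?_)
    · exact Finset.mem_filter.2 ⟨Finset.mem_univ _, (bot_le : ⊥ ≤ N.1)⟩
    · refine moebius_eq_zero_of_not_le fun hle => hN ?_
      simpa using (show N.1 ≤ M.1 from hle).trans hM
  rw [Finset.sum_congr rfl fun M hM => by rw [h1 M (Finset.mem_filter.1 hM).2]]
  simp only [ite_smul, one_smul, zero_smul]
  rw [Finset.sum_ite_eq, if_pos (by simp), Y, cls_eq R (transitive_Delta_iso (MonoidHom.id G)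
    Function.surjective_id _ (by simp)), ← regular_eq_bi, rbMul_one, eTilde_mul_self h]

theorem phiOne_mul_eTilde (h : IsUnit (Nat.card G : R)) :
    phiOne R G ⊙ eTilde R G = phiOne R G := by
  simp only [phiOne, map_sum, map_zsmul, LinearMap.sum_apply, LinearMap.smul_apply, Y, rbMul_assoc,
    eTilde_mul_self h]

theorem eTilde_mul_phiOne (h : IsUnit (Nat.card G : R)) :
    eTilde R G ⊙ phiOne R G = phiOne R G := by
  rw [← rbOpp_phiOne, ← rbOpp_eTilde, ← rbOpp_rbMul, phiOne_mul_eTilde h]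

theorem Y_Delta_mul_Delta (h : IsUnit (Nat.card G : R)) (M N : Subgroup G) (hM : M.Normal)
    (hN : N.Normal) (hMN : (M ⊔ N).Normal) (hN' : N ≤ frattini G) :
    Y R (Delta M hM) ⊙ cls R (transitive (Delta N hN)) = Y R (Delta (M ⊔ N) hMN) := by
  rw [Y, rbMul_assoc, eTilde_mul_Delta h N hN hN', ← rbMul_assoc, rbMul_assoc R (eTilde R G),
    Delta_mul_Delta R M N hM hN hMN, Y]

/-- The product is the sum of `μ(1, M) Y_{Δ_{MN}}`. Collecting the `M` with a given `M N` gives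
coefficient zero: the sum of `μ(1, M)` over `M N ≤ z` is either empty or runs over all `M ≤ z`, with
`z ≠ 1` because `z` contains `N ≠ 1`. -/
theorem phiOne_mul_Delta (h : IsUnit (Nat.card G : R)) (N : Subgroup G) (hN : N.Normal)
    (hN' : N ≤ frattini G) (hN1 : N ≠ ⊥) :
    phiOne R G ⊙ cls R (transitive (Delta N hN)) = 0 := by
  classical
  -- The target is the order dual because `sum_smul_comp_eq_zero` is phrased with upper sets,
  -- whereas here the sums run over `M N ≤ z`.
  let j : {M : Subgroup G // M.Normal} → {M : Subgroup G // M.Normal}ᵒᵈ := fun M =>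
    OrderDual.toDual ⟨M.1 ⊔ N, by have := M.2; infer_instance⟩
  have h1 : ∀ z, ∑ M with z ≤ j M,
      moebius (⟨⊥, inferInstance⟩ : {M : Subgroup G // M.Normal}) M = 0 := by
    intro z
    induction z using OrderDual.rec with
    | toDual z =>
    have h2 : ∀ M, OrderDual.toDual z ≤ j M ↔ M ≤ z ∧ N ≤ z.1 := fun M => sup_le_iff (α := Subgroup G)
    by_cases hz : N ≤ z.1
    · simp only [h2, hz, and_true]
      rw [sum_moebius_right, if_neg]
      rintro rfl
      exact hN1 (le_bot_iff.1 hz)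
    · simp [h2, hz]
  -- The weight is set to zero outside `Φ(G)`, so that the sum may run over all normal subgroups. As
  -- `N ≤ Φ(G)`, the product `M N` lies in `Φ(G)` exactly when `M` does.
  have h2 := sum_smul_comp_eq_zero j _ h1 (fun z => if (OrderDual.ofDual z).1 ≤ frattini G then
    Y R (Delta (OrderDual.ofDual z).1 (OrderDual.ofDual z).2) else 0)
  rw [← h2, phiOne, map_sum, LinearMap.sum_apply, Finset.sum_filter]
  refine Finset.sum_congr rfl fun M _ => ?_
  have h3 : ((OrderDual.ofDual (j M)).1 ≤ frattini G) ↔ M.1 ≤ frattini G :=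
    ⟨fun h => le_sup_left.trans h, fun h => sup_le h hN'⟩
  by_cases hM : M.1 ≤ frattini G
  · rw [if_pos hM, if_pos (h3.2 hM), map_zsmul, LinearMap.smul_apply,
      Y_Delta_mul_Delta h M.1 N M.2 hN _ hN']
    rfl
  · rw [if_neg hM, if_neg (mt h3.1 hM), smul_zero]

/-- If a non-trivial normal subgroup of `G` contained in the Frattini subgroup acts trivially on
the left of a biset `U`, then `φ_1^G U = 0`. -/
theorem phiOne_mul_cls (h : IsUnit (Nat.card G : R)) (N : Subgroup G) (hN : N.Normal)
    (hN' : N ≤ frattini G) (hN1 : N ≠ ⊥) (U : FinBiset G K)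
    (hU : ∀ x ∈ N, ∀ u : U.carrier, x • u = u) : phiOne R G ⊙ cls R U = 0 := by
  rw [← cls_eq R (bi_tensor_of_trivial _ (QuotientGroup.mk'_surjective N) U (by simpa using hU)),
    ← rbMul_cls, ← cls_eq R (transitive_Delta_iso _ (QuotientGroup.mk'_surjective N) hN
    (QuotientGroup.ker_mk' N)), ← rbMul_assoc, phiOne_mul_Delta h N hN hN' hN1, LinearMap.map_zero₂]

/-- If a non-trivial normal subgroup of `G` contained in the Frattini subgroup acts trivially on
the right of a biset `U`, then `U φ_1^G = 0`. -/
theorem cls_mul_phiOne (h : IsUnit (Nat.card G : R)) (N : Subgroup G) (hN : N.Normal)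
    (hN' : N ≤ frattini G) (hN1 : N ≠ ⊥) (U : FinBiset K G)
    (hU : ∀ x ∈ N, ∀ u : U.carrier, op x • u = u) : cls R U ⊙ phiOne R G = 0 := by
  have h1 := phiOne_mul_cls h N hN hN' hN1 U.opp fun x hx u => hU x⁻¹ (N.inv_mem hx) u
  have h2 := congrArg (rbOpp R) h1
  have h3 : Iso U.opp.opp U := by
    refine ⟨Equiv.refl U.carrier, fun g (x : U.carrier) => ?_, fun g (x : U.carrier) => ?_⟩
    · exact congrArg (fun z : K => z • x) (inv_inv g)
    · exact congrArg (fun z : G => op z • x) (inv_inv g)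
  rwa [rbOpp_rbMul, rbOpp_phiOne, rbOpp_cls, cls_eq R h3, map_zero] at h2

end

end BisetFun

/-! ### Minimal sections, and the decomposition of the identity -/

namespace BisetFun

open CategoryTheory Limits MulOpposite TensorProduct FinBiset

noncomputable section

/-- The product `×_H`. -/
local infixl:70 " ⊙ " => rbMul _

variable (R : Type u) [CommRing R]

theorem mem_map_conj {G : Type*} [Group G] (g x : G) (X : Subgroup G) :
    x ∈ X.map (MulAut.conj g).toMonoidHom ↔ g⁻¹ * x * g ∈ X := by
  refine ⟨?_, fun h => ⟨_, h, by simp [mul_assoc]⟩⟩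
  rintro ⟨y, hy, rfl⟩
  simpa [mul_assoc] using hy

variable {G : Type w} [Group G]

/-- The conjugate of a minimal section. -/
def MinSec.smul (g : G) (s : MinSec G) : MinSec G :=
  ⟨{ T := s.1.T.map (MulAut.conj g).toMonoidHom
     S := s.1.S.map (MulAut.conj g).toMonoidHom
     le := Subgroup.map_mono s.1.le
     normal := by
      refine ⟨?_⟩
      rintro ⟨_, x, hx, rfl⟩ h ⟨_, y, hy, rfl⟩
      obtain ⟨z, hz, hzx⟩ := Subgroup.mem_subgroupOf.1 h
      have hzx : z = x := (MulAut.conj g).injective hzx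
      subst hzx
      exact Subgroup.mem_subgroupOf.2 ⟨y * z * y⁻¹, s.1.conj_mem hy hz, by
        rw [map_mul, map_mul, map_inv]; rfl⟩ }, by
    rintro ⟨_, x, hx, rfl⟩ h
    obtain ⟨z, hz, hzx⟩ := Subgroup.mem_subgroupOf.1 h
    have hzx : z = x := (MulAut.conj g).injective hzx
    subst hzx
    let f : s.1.T →* s.1.T.map (MulAut.conj g).toMonoidHom :=
      (MulAut.conj g).toMonoidHom.subgroupMap s.1.T
    have hf : Function.Surjective f := MonoidHom.subgroupMap_surjective _ _
    exact frattini_le_comap_frattini_of_surjective hf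
      (s.2 (Subgroup.mem_subgroupOf.2 hz : (⟨z, hx⟩ : s.1.T) ∈ _))⟩

instance : MulAction G (MinSec G) where
  smul := MinSec.smul
  one_smul s := Subtype.ext (Sec.ext (by
      change s.1.T.map (MulAut.conj 1).toMonoidHom = _
      rw [map_one]; exact Subgroup.map_id _) (by
      change s.1.S.map (MulAut.conj 1).toMonoidHom = _
      rw [map_one]; exact Subgroup.map_id _))
  mul_smul a b s := Subtype.ext (Sec.ext (by
      change s.1.T.map (MulAut.conj (a * b)).toMonoidHom =
        (s.1.T.map (MulAut.conj b).toMonoidHom).map (MulAut.conj a).toMonoidHom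
      rw [map_mul, Subgroup.map_map]; rfl) (by
      change s.1.S.map (MulAut.conj (a * b)).toMonoidHom =
        (s.1.S.map (MulAut.conj b).toMonoidHom).map (MulAut.conj a).toMonoidHom
      rw [map_mul, Subgroup.map_map]; rfl))

theorem MinSec.conj_iff_mem_orbit (s t : MinSec G) :
    (MinSec.conj G).r s t ↔ t ∈ MulAction.orbit G s := by
  refine exists_congr fun g => ⟨fun h => ?_, ?_⟩
  · refine Subtype.ext (Sec.ext (Subgroup.ext fun x => ?_) (Subgroup.ext fun x => ?_))
    · exact (mem_map_conj g x _).trans (h.1 x).symm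
    · exact (mem_map_conj g x _).trans (h.2 x).symm
  · rintro rfl
    exact ⟨fun x => mem_map_conj g x _, fun x => mem_map_conj g x _⟩

theorem MinSec.stabilizer_eq (s : MinSec G) : MulAction.stabilizer G s =
    Subgroup.normalizer (s.1.T : Set G) ⊓ Subgroup.normalizer (s.1.S : Set G) := by
  have key : ∀ (X : Subgroup G) (g : G), X.map (MulAut.conj g).toMonoidHom = X ↔
      g ∈ Subgroup.normalizer (X : Set G) := by
    intro X g
    rw [Subgroup.mem_normalizer_iff]
    refine ⟨fun h x => ?_, fun h => Subgroup.ext fun x => ?_⟩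
    · have h1 := mem_map_conj g (g * x * g⁻¹) X
      rw [h] at h1
      rw [h1]
      simp [mul_assoc]
    · rw [mem_map_conj, h]
      simp [mul_assoc]
  ext g
  rw [MulAction.mem_stabilizer_iff, Subgroup.mem_inf, ← key, ← key]
  refine ⟨fun h => ⟨congrArg (fun s => s.1.T) h, congrArg (fun s => s.1.S) h⟩, fun h => ?_⟩
  exact Subtype.ext (Sec.ext h.1 h.2)

variable [Finite G]

theorem Sec.cls_indinf (s : Sec G) : cls R s.indinf =
    cls R (indB s.T.subtype) ⊙ cls R (resB (QuotientGroup.mk' (s.S.subgroupOf s.T))) := by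
  rw [rbMul_cls]
  refine (cls_eq R (tensor_iso (U := indB s.T.subtype)
    (V := resB (QuotientGroup.mk' (s.S.subgroupOf s.T))) (W := s.indinf)
    (fun (x : G) (y : s.Quot) => op y • (show s.indinf.carrier from (x : G ⧸ s.S)))
    ?_ ?_ ?_ ?_ ?_)).symm
  · intro (x : G) h (y : s.Quot)
    exact (mul_smul (op y) (op (h : s.Quot)) (show s.indinf.carrier from (x : G ⧸ s.S))).symm
  · exact fun g (x : G) (y : s.Quot) => (smul_comm (α := s.indinf.carrier) g (op y)
      (Quotient.mk (QuotientGroup.leftRel s.S) x)).symm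
  · intro g (x : G) (y : s.Quot)
    exact mul_smul (op g) (op y) (show s.indinf.carrier from (x : G ⧸ s.S))
  · intro (x : G) (y : s.Quot) (x' : G) (y' : s.Quot) h
    obtain ⟨a, rfl⟩ := QuotientGroup.mk_surjective y
    obtain ⟨b, rfl⟩ := QuotientGroup.mk_surjective y'
    have h1 : ((x * a : G) : G ⧸ s.S) = ((x' * b : G) : G ⧸ s.S) := h
    have h2 := QuotientGroup.eq.1 h1
    have h3 : x⁻¹ * x' = a * ((x * a)⁻¹ * (x' * b)) * (b : G)⁻¹ := by group
    have h4 : x⁻¹ * x' ∈ s.T := by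
      rw [h3]
      exact s.T.mul_mem (s.T.mul_mem a.2 (s.le h2)) (s.T.inv_mem b.2)
    refine ⟨⟨x⁻¹ * x', h4⟩, ?_, ?_⟩
    · change x' = x * (x⁻¹ * x'); group
    · change (b : s.Quot) = (((⟨x⁻¹ * x', h4⟩ : s.T)⁻¹ * a : s.T) : s.Quot)
      rw [eq_comm, QuotientGroup.eq, Subgroup.mem_subgroupOf]
      convert h2 using 1
      change ((x⁻¹ * x')⁻¹ * (a : G))⁻¹ * b = _
      group
  · rintro ⟨x⟩
    exact ⟨x, (1 : s.Quot), one_smul s.Quotᵐᵒᵖ (show s.indinf.carrier from (x : G ⧸ s.S))⟩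

theorem Sec.defres_iso (s : Sec G) : Iso s.indinf.opp s.defres := by
  refine Iso.of_bijective (Quotient.map' (fun g : G => g⁻¹) ?_) ⟨?_, ?_⟩ ?_ ?_
  · intro a b h
    rw [QuotientGroup.leftRel_apply] at h
    rw [QuotientGroup.rightRel_apply]
    simpa using s.S.inv_mem h
  · rintro ⟨a⟩ ⟨b⟩ h
    have h1 := QuotientGroup.rightRel_apply.1 (Quotient.exact h)
    refine QuotientGroup.eq.2 ?_
    simpa using s.S.inv_mem h1
  · rintro ⟨a⟩
    exact ⟨Quotient.mk _ a⁻¹, congrArg (Quotient.mk _) (inv_inv a)⟩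
  · rintro ⟨h⟩ ⟨a⟩
    refine congrArg (Quotient.mk _) ?_
    change (a * (h⁻¹ : s.T))⁻¹ = h * a⁻¹
    simp
  · rintro g ⟨a⟩
    refine congrArg (Quotient.mk _) ?_
    change (g⁻¹ * a)⁻¹ = a⁻¹ * g
    simp

theorem Sec.cls_defres (s : Sec G) : cls R s.defres =
    cls R (indB (QuotientGroup.mk' (s.S.subgroupOf s.T))) ⊙ cls R (resB s.T.subtype) := by
  rw [← cls_eq R s.defres_iso, ← rbOpp_cls R, Sec.cls_indinf, rbOpp_rbMul, rbOpp_bi, rbOpp_bi]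

/-- The element `Indinf_{T/S}^G φ_1^{T/S} Defres_{T/S}^G` of `RB(G, G)`. -/
def secElem (s : Sec G) : RBurnside R G G :=
  cls R s.indinf ⊙ phiOne R s.Quot ⊙ cls R s.defres

variable {R}

/-- The inflation and deflation between `T` and `T/S` are absorbed into `φ_1^{T/S}`, leaving an
element of `RB(T, T)`. This form can be summed over `S` for fixed `T`. -/
theorem secElem_eq (h : IsUnit (Nat.card G : R)) (s : MinSec G) :
    secElem R s.1 = cls R (indB s.1.T.subtype) ⊙ phiAt R ⟨s.1.S.subgroupOf s.1.T, s.1.normal⟩ ⊙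
      cls R (resB s.1.T.subtype) := by
  have hk := QuotientGroup.ker_mk' (s.1.S.subgroupOf s.1.T)
  have h1 := resB_mul_phiOne_mul_indB (isUnit_card_subgroup h s.1.T)
    (QuotientGroup.mk' (s.1.S.subgroupOf s.1.T)) (QuotientGroup.mk'_surjective _)
    (by rw [hk]; exact s.2)
  simp only [hk] at h1
  rw [secElem, Sec.cls_indinf, Sec.cls_defres, ← h1]
  simp only [rbMul_assoc]

/-- Conjugation gives `c : T ≃* T'`, and `T → T' → T'/S'` has kernel `S`, so `φ_S^T` can be computed
from `φ_1^{T'/S'}`. The composites of `c` with its reverse then cancel, because conjugate embeddings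
in `G` induce isomorphic bisets. -/
theorem secElem_conj (h : IsUnit (Nat.card G : R)) {s t : MinSec G} (hst : (MinSec.conj G).r s t) :
    secElem R t.1 = secElem R s.1 := by
  obtain ⟨g, hT, hS⟩ := hst
  let c : s.1.T ≃* t.1.T :=
    { toFun := fun x => ⟨g * x * g⁻¹, (hT _).2 (by simp [mul_assoc])⟩
      invFun := fun x => ⟨g⁻¹ * x * g, (hT _).1 x.2⟩
      left_inv := fun x => Subtype.ext (by simp [mul_assoc])
      right_inv := fun x => Subtype.ext (by simp [mul_assoc])
      map_mul' := fun x y => Subtype.ext (by simp [mul_assoc]) }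
  let q := QuotientGroup.mk' (t.1.S.subgroupOf t.1.T)
  have hk : (q.comp c.toMonoidHom).ker = s.1.S.subgroupOf s.1.T := by
    ext x
    rw [← MonoidHom.comap_ker, QuotientGroup.ker_mk', Subgroup.mem_comap, Subgroup.mem_subgroupOf,
      Subgroup.mem_subgroupOf, hS]
    change g⁻¹ * (g * x * g⁻¹) * g ∈ s.1.S ↔ _
    simp [mul_assoc]
  have h1 := resB_mul_phiOne_mul_indB (isUnit_card_subgroup h s.1.T) (q.comp c.toMonoidHom)
    ((QuotientGroup.mk'_surjective _).comp c.surjective) (by rw [hk]; exact s.2)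
  simp only [hk] at h1
  have h2 : cls R (indB s.1.T.subtype) =
      cls R (indB t.1.T.subtype) ⊙ cls R (indB c.toMonoidHom) := by
    rw [cls_indB_mul]
    exact (cls_eq R (indB_conj g fun k => rfl)).symm
  have h3 : cls R (resB s.1.T.subtype) =
      cls R (resB c.toMonoidHom) ⊙ cls R (resB t.1.T.subtype) := by
    rw [← rbOpp_bi, h2, rbOpp_rbMul, rbOpp_bi, rbOpp_bi]
  rw [secElem_eq h s, ← h1, h2, h3, ← cls_resB_mul, ← cls_indB_mul, secElem, Sec.cls_indinf,
    Sec.cls_defres]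
  have h4 : ∀ {K : Type w} [Group K] (x : RBurnside R t.1.T K),
      cls R (indB c.toMonoidHom) ⊙ (cls R (resB c.toMonoidHom) ⊙ x) = x := fun x => by
    rw [← rbMul_assoc, cls_indB_mul_resB_equiv, one_rbMul]
  simp only [rbMul_assoc, h4]
  rfl

/-- Orbit-stabilizer for conjugation, the stabilizer `N_G(T) ∩ N_G(S)` containing `T`. It explains
the denominator in `eps`. -/
theorem card_conj_mul (s : MinSec G) : Nat.card {t // (MinSec.conj G).r s t} * Nat.card s.1.T *
    s.1.T.relIndex (Subgroup.normalizer (s.1.T : Set G) ⊓ Subgroup.normalizer (s.1.S : Set G)) =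
      Nat.card G := by
  classical
  let := Fintype.ofFinite G
  have hle : s.1.T ≤ Subgroup.normalizer (s.1.T : Set G) ⊓ Subgroup.normalizer (s.1.S : Set G) := by
    refine le_inf Subgroup.le_normalizer fun t ht => ?_
    rw [Subgroup.mem_normalizer_iff]
    intro x
    refine ⟨fun h => s.1.conj_mem ht h, fun h => ?_⟩
    have := s.1.conj_mem' ht h
    simpa [mul_assoc] using this
  rw [← MinSec.stabilizer_eq] at hle ⊢
  rw [mul_assoc, Subgroup.relIndex, ← Nat.card_congr (Subgroup.subgroupOfEquivOfLe hle).toEquiv,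
    Subgroup.card_mul_index]
  have h1 : Nat.card {t // (MinSec.conj G).r s t} = Nat.card (MulAction.orbit G s) :=
    Nat.card_congr (Equiv.subtypeEquivRight fun t => MinSec.conj_iff_mem_orbit s t)
  have := Fintype.ofFinite (MulAction.orbit G s)
  rw [h1, Nat.card_eq_fintype_card, Nat.card_eq_fintype_card, Nat.card_eq_fintype_card,
    MulAction.card_orbit_mul_card_stabilizer_eq_card_group]

instance : Fintype (MinSec G) := Fintype.ofFinite _

/-- The minimal sections with first member `T` correspond to the normal subgroups of `T` inside
`Φ(T)`, which are the indices in the expansion of `ẽ_T` by `sum_phiAt`. -/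
theorem sum_card_smul_secElem (h : IsUnit (Nat.card G : R)) :
    ∑ s : MinSec G, (Nat.card s.1.T : R) • secElem R s.1 =
      (Nat.card G : R) • cls R (regular G) := by
  classical
  rw [card_smul_regular h]
  have h1 : ∀ T : Subgroup G, (Nat.card T : R) •
      (cls R (indB T.subtype) ⊙ eTilde R T ⊙ cls R (resB T.subtype)) =
      ∑ s : MinSec G with s.1.T = T, (Nat.card s.1.T : R) • secElem R s.1 := by
    intro T
    rw [← sum_phiAt (isUnit_card_subgroup h T), map_sum, map_sum, LinearMap.sum_apply,
      Finset.smul_sum]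
    have hS : ∀ N : Subgroup T, (N.map T.subtype).subgroupOf T = N := fun N => by
      rw [Subgroup.subgroupOf, Subgroup.comap_map_eq_self_of_injective T.subtype_injective]
    let F : ∀ N : {N : Subgroup T // N.Normal}, N.1 ≤ frattini T → MinSec G := fun N hN =>
      ⟨⟨T, N.1.map T.subtype, Subgroup.map_subtype_le _, (hS N.1).symm ▸ N.2⟩,
        (hS N.1).le.trans hN⟩
    refine Finset.sum_bij (fun N hN => F N (Finset.mem_filter.1 hN).2) ?_ ?_ ?_ ?_
    · exact fun N hN => Finset.mem_filter.2 ⟨Finset.mem_univ _, rfl⟩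
    · intro N hN M hM e
      have h2 : N.1.map T.subtype = M.1.map T.subtype := congrArg (fun s => s.1.S) e
      exact Subtype.ext (Subgroup.map_injective T.subtype_injective h2)
    · rintro ⟨⟨T', S, hle, hn⟩, hs⟩ hT
      obtain rfl : T' = T := (Finset.mem_filter.1 hT).2
      refine ⟨⟨S.subgroupOf T', hn⟩, Finset.mem_filter.2 ⟨Finset.mem_univ _, hs⟩, ?_⟩
      refine Subtype.ext (Sec.ext rfl ?_)
      exact Subgroup.map_subgroupOf_eq_of_le hle
    · intro N hN
      rw [secElem_eq h]
      simp only [F, hS]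
  rw [Finset.sum_congr rfl fun T _ => h1 T]
  exact (Finset.sum_fiberwise _ (fun s : MinSec G => s.1.T) _).symm

/-- The elements `ε_{T,S}^G`, for representatives of the conjugacy classes of minimal sections,
have sum `1`. -/
theorem sum_eps (h : IsUnit (Nat.card G : R)) :
    ∑ c : Quotient (MinSec.conj G), eps R c.out.1 = cls R (regular G) := by
  classical
  rw [← h.smul_left_cancel, ← sum_card_smul_secElem h,
    ← Finset.sum_fiberwise _ (Quotient.mk (MinSec.conj G)), Finset.smul_sum]
  refine Finset.sum_congr rfl fun c _ => ?_
  obtain ⟨s, hs⟩ : ∃ s, s = c.out := ⟨_, rfl⟩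
  have hc : Quotient.mk (MinSec.conj G) s = c := by rw [hs, Quotient.out_eq]
  rw [← hs]
  -- On a conjugacy class both `|T|` and the section element are constant, so the class contributes
  -- its cardinality times a single term.
  have h1 : ∀ t ∈ ({t | Quotient.mk (MinSec.conj G) t = c} : Finset (MinSec G)),
      (Nat.card t.1.T : R) • secElem R t.1 = (Nat.card s.1.T : R) • secElem R s.1 := by
    intro t ht
    have hst : (MinSec.conj G).r s t := Quotient.exact (hc.trans (Finset.mem_filter.1 ht).2.symm)
    rw [secElem_conj h hst]
    obtain ⟨g, rfl⟩ := (MinSec.conj_iff_mem_orbit s t).1 hst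
    congr 2
    exact Nat.card_congr (s.1.T.equivMapOfInjective _ (MulAut.conj g).injective).toEquiv.symm
  have h2 : ({t | Quotient.mk (MinSec.conj G) t = c} : Finset (MinSec G)).card =
      Nat.card {t // (MinSec.conj G).r s t} := by
    rw [← Fintype.card_subtype, ← Nat.card_eq_fintype_card]
    refine Nat.card_congr (Equiv.subtypeEquivRight fun t => ?_)
    rw [← hc]
    exact ⟨fun h => Quotient.exact h.symm, fun h => (Quotient.sound h).symm⟩
  have h3 := card_conj_mul s
  rw [Finset.sum_congr rfl h1, Finset.sum_const, h2, eps, smul_smul, ← h3, ← Nat.cast_smul_eq_nsmul R,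
    smul_smul, secElem]
  congr 1
  push_cast
  rw [mul_assoc, Ring.mul_inverse_cancel, mul_one]
  refine isUnit_card_of_dvd h ?_
  rw [← h3]
  exact Dvd.intro_left _ rfl

end

end BisetFun

/-! ### The Frattini subgroup of a `p`-group -/

namespace BisetFun

section ElementaryAbelianQuotients

/-- The subgroup `A` contains all `p`-th powers and all commutators, that is, `A` is normal and the
quotient by `A` is an elementary abelian `p`-group. -/
def HasElemAbQuotient (p : ℕ) {G : Type*} [Group G] (A : Subgroup G) : Prop :=
  (∀ x, x ^ p ∈ A) ∧ ∀ x y, x * y * x⁻¹ * y⁻¹ ∈ A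

variable {p : ℕ} {G H : Type*} [Group G] [Group H]

theorem HasElemAbQuotient.mono {A B : Subgroup G} (h : HasElemAbQuotient p A) (hAB : A ≤ B) :
    HasElemAbQuotient p B :=
  ⟨fun x => hAB (h.1 x), fun x y => hAB (h.2 x y)⟩

theorem HasElemAbQuotient.normal {A : Subgroup G} (h : HasElemAbQuotient p A) : A.Normal :=
  ⟨fun n hn g => by simpa using A.mul_mem (h.2 g n) hn⟩

theorem HasElemAbQuotient.map {A : Subgroup G} (h : HasElemAbQuotient p A) (f : G →* H)
    (hf : Function.Surjective f) : HasElemAbQuotient p (A.map f) := by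
  refine ⟨fun x => ?_, fun x y => ?_⟩
  · obtain ⟨a, rfl⟩ := hf x
    exact ⟨a ^ p, h.1 a, map_pow f a p⟩
  · obtain ⟨a, rfl⟩ := hf x
    obtain ⟨b, rfl⟩ := hf y
    exact ⟨_, h.2 a b, by simp⟩

theorem mem_of_zpow_mem [Fact p.Prime] {K : Subgroup G} {g : G} {i : ℤ} (h1 : g ^ i ∈ K)
    (h2 : g ^ p ∈ K) (hi : ¬ (p : ℤ) ∣ i) : g ∈ K := by
  have h3 : IsCoprime (p : ℤ) i :=
    (Nat.prime_iff_prime_int.1 Fact.out : Prime (p : ℤ)).irreducible.coprime_iff_not_dvd.2 hi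
  obtain ⟨a, b, hab⟩ := h3
  have h4 : (g ^ p) ^ a * (g ^ i) ^ b = g := by
    rw [← zpow_natCast, ← zpow_mul, ← zpow_mul, ← zpow_add, mul_comm _ a, mul_comm i, hab, zpow_one]
  rw [← h4]
  exact K.mul_mem (K.zpow_mem h2 a) (K.zpow_mem h1 b)

variable [Finite G]

/-- Complements exist in the vector space `G/F`. A maximal `Q` over `F` with `Q ∩ A ≤ F` works: if
`Q A` missed some `g`, then `Q⟨g⟩` would still qualify, since `q g^i ∈ A` with `p ∤ i` forces `g ∈ Q
A`. -/
theorem HasElemAbQuotient.exists_complement [Fact p.Prime] {F : Subgroup G}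
    (hF : HasElemAbQuotient p F) (A : Subgroup G) :
    ∃ Q : Subgroup G, F ≤ Q ∧ Q ⊓ A ≤ F ∧ Q ⊔ A = ⊤ := by
  obtain ⟨Q, hQ⟩ := (Set.toFinite {Q : Subgroup G | F ≤ Q ∧ Q ⊓ A ≤ F}).exists_maximal
    ⟨F, le_rfl, inf_le_left⟩
  obtain ⟨hFQ, hQA⟩ := hQ.prop
  refine ⟨Q, hFQ, hQA, ?_⟩
  by_contra hne
  obtain ⟨g, -, hg⟩ := SetLike.exists_of_lt (lt_top_iff_ne_top.2 hne)
  have hQn := (hF.mono hFQ).normal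
  have h1 : Q ⊔ Subgroup.zpowers g ≤ Q := by
    refine hQ.le_of_ge ⟨hFQ.trans le_sup_left, ?_⟩ le_sup_left
    rintro x ⟨hx, hxA⟩
    obtain ⟨q, hq, y, ⟨i, rfl⟩, rfl⟩ := Subgroup.mem_sup_of_normal_left.1 hx
    by_cases hi : (p : ℤ) ∣ i
    · refine hQA ⟨Q.mul_mem hq ?_, hxA⟩
      obtain ⟨k, rfl⟩ := hi
      change g ^ ((p : ℤ) * k) ∈ Q
      rw [zpow_mul, zpow_natCast]
      exact Q.zpow_mem (hFQ (hF.1 g)) k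
    · refine (hg (mem_of_zpow_mem ?_ (Subgroup.mem_sup_left (hFQ (hF.1 g))) hi)).elim
      have h2 : g ^ i = q⁻¹ * (q * g ^ i) := by group
      rw [h2]
      exact Subgroup.mul_mem _ (Subgroup.mem_sup_left (Q.inv_mem hq)) (Subgroup.mem_sup_right hxA)
  exact hg (Subgroup.mem_sup_left (h1 (Subgroup.mem_sup_right (Subgroup.mem_zpowers g))))

/-- An element `x ∉ A` is avoided by a maximal subgroup: take `M ≥ A` maximal among subgroups
without `x`. A complement of `M⟨x⟩` over `M` cannot contain `x`, so it equals `M`; thus `M⟨x⟩ = G`,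
and every subgroup strictly above `M` contains `x`, hence is `G`. -/
theorem HasElemAbQuotient.frattini_le [Fact p.Prime] {A : Subgroup G}
    (hA : HasElemAbQuotient p A) : frattini G ≤ A := by
  intro x hx
  by_contra hxA
  obtain ⟨M, hM⟩ := (Set.toFinite {M : Subgroup G | A ≤ M ∧ x ∉ M}).exists_maximal ⟨A, le_rfl, hxA⟩
  obtain ⟨hAM, hxM⟩ := hM.prop
  have hMn := (hA.mono hAM).normal
  obtain ⟨Q, hMQ, hQ, hQ'⟩ := (hA.mono hAM).exists_complement (M ⊔ Subgroup.zpowers x)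
  have h1 : Q ≤ M := by
    refine hM.le_of_ge ⟨hAM.trans hMQ, fun h => ?_⟩ hMQ
    exact hxM (hQ ⟨h, Subgroup.mem_sup_right (Subgroup.mem_zpowers x)⟩)
  refine hxM (frattini_le_coatom (K := M) ⟨fun h => hxM (h ▸ trivial), fun L hL => ?_⟩ hx)
  have h2 : x ∈ L := by
    by_contra hxL
    exact hL.not_ge (hM.le_of_ge ⟨hAM.trans hL.le, hxL⟩ hL.le)
  rw [eq_top_iff, ← hQ']
  exact sup_le (h1.trans hL.le) (sup_le hL.le (by simpa using h2))

theorem IsPGroup.hasElemAbQuotient_frattini [Fact p.Prime] (hG : IsPGroup p G) :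
    HasElemAbQuotient p (frattini G) := by
  have key : ∀ M : Subgroup G, IsCoatom M → HasElemAbQuotient p M := by
    intro M hM
    have hnil := (Group.isNilpotent_of_finite_tfae (G := G)).out 0 2
    have hMn : M.Normal := hnil.1 hG.isNilpotent M hM
    have hnt : Nontrivial (G ⧸ M) := by
      rw [← not_subsingleton_iff_nontrivial, QuotientGroup.subsingleton_iff]
      exact hM.1
    have hdvd : p ∣ Nat.card (G ⧸ M) :=
      ((hG.to_quotient M).card_eq_or_dvd).resolve_left (Finite.one_lt_card.ne')
    obtain ⟨z, hz⟩ := exists_prime_orderOf_dvd_card' p hdvd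
    -- The preimage of a subgroup of order `p` strictly contains the maximal subgroup `M`, so it is
    -- all of `G`; hence `G/M` is cyclic of order `p`.
    have h1 : (Subgroup.zpowers z).comap (QuotientGroup.mk' M) = ⊤ := by
      refine hM.2 _ (lt_of_le_of_ne ?_ fun h => ?_)
      · exact (QuotientGroup.ker_mk' M).ge.trans (Subgroup.ker_le_comap _ _)
      · obtain ⟨a, rfl⟩ := QuotientGroup.mk_surjective z
        have h2 : a ∈ M := by
          rw [h]
          exact Subgroup.mem_zpowers (a : G ⧸ M)
        rw [(QuotientGroup.eq_one_iff a).2 h2, orderOf_one] at hz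
        exact (Fact.out : p.Prime).one_lt.ne hz
    have h2 : ∀ x : G, ∃ i : ℤ, z ^ i = (x : G ⧸ M) := fun x => by
      have : x ∈ (Subgroup.zpowers z).comap (QuotientGroup.mk' M) := h1 ▸ trivial
      exact this
    refine ⟨fun x => ?_, fun x y => ?_⟩
    · obtain ⟨i, hi⟩ := h2 x
      rw [← QuotientGroup.eq_one_iff, QuotientGroup.mk_pow, ← hi, ← zpow_natCast, ← zpow_mul,
        mul_comm, zpow_mul, zpow_natCast, ← hz, pow_orderOf_eq_one, one_zpow]
    · obtain ⟨i, hi⟩ := h2 x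
      obtain ⟨j, hj⟩ := h2 y
      rw [← QuotientGroup.eq_one_iff, QuotientGroup.mk_mul, QuotientGroup.mk_mul,
        QuotientGroup.mk_mul, QuotientGroup.mk_inv, QuotientGroup.mk_inv, ← hi, ← hj]
      group
  refine ⟨fun x => ?_, fun x y => ?_⟩
  · simp_rw [frattini, Order.radical, Subgroup.mem_iInf]
    exact fun M hM => (key M hM).1 x
  · simp_rw [frattini, Order.radical, Subgroup.mem_iInf]
    exact fun M hM => (key M hM).2 x y

end ElementaryAbelianQuotients

/-! ### The group `P^@` -/

section Atoric

variable {p : ℕ} {G H : Type w} [Group G] [Group H]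

/-- Otherwise `N⟨z⟩` would be a normal subgroup still meeting `Φ(G)` trivially, against maximality:
`n z^i ∈ Φ(G)` with `p ∤ i` would put `z` in `N Φ(G)`. -/
theorem mem_sup_frattini_of_maximal [Fact p.Prime] {N : Subgroup G}
    (hN : Maximal (fun N : Subgroup G => N.Normal ∧ N ⊓ frattini G = ⊥) N) {z : G}
    (hz : ∀ g, g * z = z * g) (hp : z ^ p = 1) : z ∈ N ⊔ frattini G := by
  by_contra hzN
  have hNn := hN.prop.1
  have hzn : (Subgroup.zpowers z).Normal := by
    refine ⟨?_⟩
    rintro _ ⟨i, rfl⟩ g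
    have h1 : Commute g (z ^ i) := Commute.zpow_right (hz g) i
    refine ⟨i, ?_⟩
    change z ^ i = g * z ^ i * g⁻¹
    rw [h1.eq, mul_inv_cancel_right]
  refine hzN (Subgroup.mem_sup_left (hN.le_of_ge (y := N ⊔ Subgroup.zpowers z)
    ⟨inferInstance, ?_⟩ le_sup_left (Subgroup.mem_sup_right (Subgroup.mem_zpowers z))))
  rw [eq_bot_iff]
  rintro x ⟨hx, hxF⟩
  obtain ⟨n, hn, y, ⟨i, rfl⟩, rfl⟩ := Subgroup.mem_sup_of_normal_left.1 hx
  by_cases hi : (p : ℤ) ∣ i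
  · obtain ⟨k, rfl⟩ := hi
    have h1 : z ^ ((p : ℤ) * k) = 1 := by rw [zpow_mul, zpow_natCast, hp, one_zpow]
    rw [← hN.prop.2]
    have h2 : n * z ^ ((p : ℤ) * k) = n := by rw [h1, mul_one]
    exact ⟨h2.symm ▸ hn, hxF⟩
  · refine (hzN (mem_of_zpow_mem ?_ (hp ▸ Subgroup.one_mem _) hi)).elim
    have h2 : z ^ i = n⁻¹ * (n * z ^ i) := by group
    rw [h2]
    exact Subgroup.mul_mem _ (Subgroup.mem_sup_left (N.inv_mem hn)) (Subgroup.mem_sup_right hxF)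

variable [Finite G]

theorem pow_eq_one_of_inf_frattini [Fact p.Prime] (hG : IsPGroup p G) {N : Subgroup G}
    (h : N ⊓ frattini G = ⊥) {x : G} (hx : x ∈ N) : x ^ p = 1 :=
  (Subgroup.mem_bot).1 (h ▸ ⟨N.pow_mem hx p, hG.hasElemAbQuotient_frattini.1 x⟩)

theorem mul_comm_of_inf_frattini [Fact p.Prime] (hG : IsPGroup p G) {N : Subgroup G} (hN : N.Normal)
    (h : N ⊓ frattini G = ⊥) {x : G} (hx : x ∈ N) (g : G) : g * x = x * g := by
  have h1 : g * x * g⁻¹ * x⁻¹ ∈ N ⊓ frattini G :=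
    ⟨N.mul_mem (hN.conj_mem x hx g) (N.inv_mem hx), hG.hasElemAbQuotient_frattini.2 g x⟩
  rw [h, Subgroup.mem_bot, mul_inv_eq_one, mul_inv_eq_iff_eq_mul] at h1
  exact h1

/-- The isomorphism type of `G^@` does not depend on the choice of the maximal normal subgroup. -/
theorem quotient_equiv_of_maximal [Fact p.Prime] (hG : IsPGroup p G) {N M : Subgroup G} [N.Normal]
    [M.Normal] (hN : Maximal (fun N : Subgroup G => N.Normal ∧ N ⊓ frattini G = ⊥) N)
    (hM : Maximal (fun N : Subgroup G => N.Normal ∧ N ⊓ frattini G = ⊥) M) :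
    Nonempty (G ⧸ N ≃* G ⧸ M) := by
  have hle : ∀ {N M : Subgroup G},
      Maximal (fun N : Subgroup G => N.Normal ∧ N ⊓ frattini G = ⊥) N →
      Maximal (fun N : Subgroup G => N.Normal ∧ N ⊓ frattini G = ⊥) M →
      M ⊔ frattini G ≤ N ⊔ frattini G := fun hN hM =>
    sup_le (fun z hz => mem_sup_frattini_of_maximal hN
      (mul_comm_of_inf_frattini hG hM.prop.1 hM.prop.2 hz)
      (pow_eq_one_of_inf_frattini hG hM.prop.2 hz)) le_sup_right
  -- Elements of `N` and `M` are central of exponent `p`, so `N Φ(G) = M Φ(G)`. A complement `Q` of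
  -- this subgroup over `Φ(G)` is then an honest complement of both `N` and `M`, and `G/N ≅ Q ≅
  -- G/M`.
  obtain ⟨Q, hFQ, hQ, hQ'⟩ := hG.hasElemAbQuotient_frattini.exists_complement (N ⊔ frattini G)
  have key : ∀ (K : Subgroup G) [K.Normal], K ⊔ frattini G = N ⊔ frattini G →
      K ⊓ frattini G = ⊥ → Q.IsComplement' K := by
    intro K _ h1 h2
    refine Subgroup.isComplement'_of_disjoint_and_mul_eq_univ ?_ ?_
    · rw [disjoint_iff, eq_bot_iff, ← h2]
      exact le_inf inf_le_right ((inf_le_inf_left Q (h1 ▸ le_sup_left)).trans hQ)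
    · rw [← Subgroup.mul_normal, ← Subgroup.coe_top, SetLike.coe_set_eq, ← hQ', ← h1, sup_comm K,
        ← sup_assoc, sup_eq_left.2 hFQ]
  exact ⟨(key N rfl hN.prop.2).QuotientMulEquiv.trans
    (key M (le_antisymm (hle hN hM) (hle hM hN)) hM.prop.2).QuotientMulEquiv.symm⟩

/-- The preimage of `atKernel H` is again maximal among normal subgroups avoiding `Φ(G)`, so it
computes `G^@`, and the quotient by it is `H^@`. Maximality uses `Φ(H) ≤ f(Φ(G))`, valid since `G`
is a `p`-group. -/
theorem At_equiv_of_surjective [Finite H] [Fact p.Prime] (hG : IsPGroup p G) (f : G →* H)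
    (hf : Function.Surjective f) (hk : f.ker ⊓ frattini G = ⊥) : Nonempty (At G ≃* At H) := by
  have hK : Maximal (fun N : Subgroup H => N.Normal ∧ N ⊓ frattini H = ⊥) (atKernel H) :=
    (exists_atKernel H).choose_spec
  have hKn := hK.prop.1
  have h1 : frattini H ≤ (frattini G).map f :=
    (hG.hasElemAbQuotient_frattini.map f hf).frattini_le
  have hmax : Maximal (fun N : Subgroup G => N.Normal ∧ N ⊓ frattini G = ⊥)
      ((atKernel H).comap f) := by
    refine ⟨⟨inferInstance, ?_⟩, ?_⟩
    · rw [eq_bot_iff, ← hk]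
      rintro x ⟨hx, hxF⟩
      refine ⟨?_, hxF⟩
      have h2 : f x ∈ atKernel H ⊓ frattini H :=
        ⟨hx, frattini_le_comap_frattini_of_surjective hf hxF⟩
      rw [hK.prop.2] at h2
      exact h2
    · rintro M ⟨hMn, hM⟩ hle x hx
      have hkM : f.ker ≤ M := (Subgroup.ker_le_comap f _).trans hle
      refine hK.le_of_ge (y := M.map f) ⟨hMn.map f hf, ?_⟩ ?_ (Subgroup.mem_map_of_mem f hx)
      · rw [eq_bot_iff]
        rintro y ⟨⟨m, hm, rfl⟩, hy⟩
        obtain ⟨a, ha, ham⟩ := h1 hy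
        have h2 : a ∈ M := by
          have h3 : a * m⁻¹ ∈ f.ker := by rw [MonoidHom.mem_ker, map_mul, ham, map_inv, mul_inv_cancel]
          simpa using M.mul_mem (hkM h3) hm
        have h4 : a ∈ M ⊓ frattini G := ⟨h2, ha⟩
        rw [hM, Subgroup.mem_bot] at h4
        rw [← ham, h4, map_one]
        exact Subgroup.one_mem _
      · rw [← Subgroup.map_comap_eq_self_of_surjective hf (atKernel H)]
        exact Subgroup.map_mono hle
  obtain ⟨e⟩ := quotient_equiv_of_maximal (N := atKernel G) hG
    (exists_atKernel G).choose_spec hmax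
  have h2 : ((QuotientGroup.mk' (atKernel H)).comp f).ker = (atKernel H).comap f := by
    rw [← MonoidHom.comap_ker, QuotientGroup.ker_mk']
  have h3 : Function.Surjective ((QuotientGroup.mk' (atKernel H)).comp f) :=
    (QuotientGroup.mk'_surjective _).comp hf
  exact ⟨e.trans ((QuotientGroup.quotientMulEquivOfEq h2.symm).trans
    (QuotientGroup.quotientKerEquivOfSurjective _ h3))⟩

theorem At_congr [Finite H] [Fact p.Prime] (hG : IsPGroup p G) (e : G ≃* H) :
    Nonempty (At G ≃* At H) :=
  At_equiv_of_surjective hG e.toMonoidHom e.surjective (by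
    rw [show e.toMonoidHom.ker = ⊥ from (MonoidHom.ker_eq_bot_iff _).2 e.injective, bot_inf_eq])

theorem IsInternalProd.hasElemAbQuotient {G : Type w} [Group G] {E Q : Subgroup G}
    (hE : IsElemAb p E) (h : IsInternalProd E Q) : HasElemAbQuotient p Q := by
  have hQn : Q.Normal := by
    rw [← Subgroup.normalizer_eq_top_iff, eq_top_iff, ← h.2.2]
    refine sup_le (fun x hx => ?_) Subgroup.le_normalizer
    rw [Subgroup.mem_normalizer_iff]
    intro y
    refine ⟨fun hy => ?_, fun hy => ?_⟩
    · rw [h.1 x hx y hy, mul_inv_cancel_right]; exact hy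
    · have h1 := h.1 x hx _ hy
      have h2 : y = x * y * x⁻¹ := by
        have h3 : x * (x * y * x⁻¹) = x * y := by rw [h1]; group
        exact (mul_left_cancel h3).symm
      rw [h2]; exact hy
  have h1 : ∀ x : G, ∃ e ∈ E, (x : G ⧸ Q) = e := by
    intro x
    have hx : x ∈ E ⊔ Q := h.2.2 ▸ trivial
    obtain ⟨e, he, q, hq, rfl⟩ := Subgroup.mem_sup_of_normal_right.1 hx
    exact ⟨e, he, (QuotientGroup.mk_mul_of_mem e hq)⟩
  refine ⟨fun x => ?_, fun x y => ?_⟩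
  · obtain ⟨e, he, hx⟩ := h1 x
    rw [← QuotientGroup.eq_one_iff, QuotientGroup.mk_pow, hx, ← QuotientGroup.mk_pow, hE.2 e he]
    rfl
  · obtain ⟨e, he, hx⟩ := h1 x
    obtain ⟨e', he', hy⟩ := h1 y
    rw [← QuotientGroup.eq_one_iff, QuotientGroup.mk_mul, QuotientGroup.mk_mul,
      QuotientGroup.mk_mul, QuotientGroup.mk_inv, QuotientGroup.mk_inv, hx, hy,
      ← QuotientGroup.mk_inv, ← QuotientGroup.mk_inv, ← QuotientGroup.mk_mul,
      ← QuotientGroup.mk_mul, ← QuotientGroup.mk_mul, hE.1 e he e' he']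
    simp

variable (G) in
-- If `At G = E × Q`, the quotient by `Q` is elementary abelian, so the Frattini subgroup lies in
-- `Q` and misses `E`. The preimage of `E` in `G` then avoids `Φ(G)`, and maximality of `atKernel G`
-- forces `E = 1`.
theorem At_atoric [Fact p.Prime] :
    ¬ ∃ E Q : Subgroup (At G), E ≠ ⊥ ∧ IsElemAb p E ∧ IsInternalProd E Q := by
  rintro ⟨E, Q, hE, hEp, hEQ⟩
  apply hE
  have hN := (exists_atKernel G).choose_spec
  have hEn : E.Normal := by
    rw [← Subgroup.normalizer_eq_top_iff, eq_top_iff, ← hEQ.2.2]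
    refine sup_le Subgroup.le_normalizer (fun x hx => ?_)
    rw [Subgroup.mem_normalizer_iff]
    intro y
    refine ⟨fun hy => ?_, fun hy => ?_⟩
    · rw [← hEQ.1 y hy x hx, mul_inv_cancel_right]; exact hy
    · have h1 := hEQ.1 _ hy x hx
      have h2 : y = x * y * x⁻¹ := by
        have h3 : x * (x * y * x⁻¹) = x * y := by rw [← h1]; group
        exact (mul_left_cancel h3).symm
      rw [h2]; exact hy
  have h1 : E ⊓ frattini (At G) = ⊥ := by
    rw [eq_bot_iff, ← hEQ.2.1]
    exact inf_le_inf_left E (hEQ.hasElemAbQuotient hEp).frattini_le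
  have h2 : E.comap (QuotientGroup.mk' (atKernel G)) ≤ atKernel G := by
    refine hN.le_of_ge ⟨inferInstance, ?_⟩ ?_
    · rw [eq_bot_iff]
      rintro x ⟨hx, hxF⟩
      have h3 : (x : At G) ∈ E ⊓ frattini (At G) :=
        ⟨hx, frattini_le_comap_frattini_of_surjective (QuotientGroup.mk'_surjective _) hxF⟩
      rw [h1, Subgroup.mem_bot, QuotientGroup.eq_one_iff] at h3
      rw [← hN.prop.2]
      exact ⟨h3, hxF⟩
    · exact (QuotientGroup.ker_mk' (atKernel G)).ge.trans (Subgroup.ker_le_comap _ _)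
  rw [eq_bot_iff]
  intro x hx
  obtain ⟨a, rfl⟩ := QuotientGroup.mk_surjective x
  exact (QuotientGroup.eq_one_iff a).2 (h2 hx)

/-- The atoric `p`-group `G^@`. -/
noncomputable def atAtoric [Fact p.Prime] (hG : IsPGroup p G) : AtoricGroup.{w} p where
  carrier := At G
  isPGroup := hG.to_quotient _
  atoric := At_atoric G

end Atoric

/-! ### Vanishing of `φ_1^H V φ_1^G` -/

noncomputable section

/-- The product `×_H`. -/
local infixl:70 " ⊙ " => rbMul _

variable {R : Type u} [CommRing R] {p : ℕ} {G H : Type w} [Group G] [Group H] [Finite G] [Finite H]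

open FinBiset MulOpposite

theorem isUnit_card_of_isPGroup [Fact p.Prime] (hp : IsUnit (p : R)) (hG : IsPGroup p G) :
    IsUnit (Nat.card G : R) := by
  obtain ⟨n, hn⟩ := IsPGroup.iff_card.1 hG
  rw [hn, Nat.cast_pow]
  exact hp.pow n

/-- For `p`-groups `G` and `H`, the product `φ_1^H V φ_1^G` vanishes unless `H^@ ≅ G^@`. -/
theorem phiOne_mul_mul_phiOne [Fact p.Prime] (hp : IsUnit (p : R)) (hH : IsPGroup p H)
    (hG : IsPGroup p G) (hne : ¬ Nonempty (At H ≃* At G)) (V : RBurnside R H G) :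
    phiOne R H ⊙ V ⊙ phiOne R G = 0 := by
  have uH := isUnit_card_of_isPGroup hp hH
  have uG := isUnit_card_of_isPGroup hp hG
  suffices h : ∀ X : Subgroup (H × G), phiOne R H ⊙ cls R (transitive X) ⊙ phiOne R G = 0 from
    DFunLike.congr_fun (f := (rbMul R).flip (phiOne R G) ∘ₗ rbMul R (phiOne R H)) (g := 0)
      (RBurnside.hom_ext_transitive R h) V
  intro X
  -- `V` factors through `X` along its projections, so the factors `ẽ` contained in `φ_1` kill it
  -- unless `X` surjects onto both `H` and `G`.
  by_cases h1 : Function.Surjective ((MonoidHom.fst H G).comp X.subtype)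
  swap
  · rw [← cls_eq R (transitive_iso X), ← rbMul_cls, ← phiOne_mul_eTilde uH, ← rbMul_assoc,
      rbMul_assoc R _ (eTilde R H), eTilde_mul_indB uH _ h1]
    simp
  by_cases h2 : Function.Surjective ((MonoidHom.snd H G).comp X.subtype)
  swap
  · rw [← cls_eq R (transitive_iso X), ← rbMul_cls, ← eTilde_mul_phiOne uG, rbMul_assoc,
      rbMul_assoc, ← rbMul_assoc R _ (eTilde R G), resB_mul_eTilde uG _ h2]
    simp
  have n1 := Subgroup.normal_goursatFst h1
  have n2 := Subgroup.normal_goursatSnd h2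
  -- The Goursat kernels are normal and act trivially on the biset. If one of them meets the
  -- Frattini subgroup non-trivially, the corresponding `φ_1` annihilates it.
  by_cases k1 : X.goursatFst ⊓ frattini H = ⊥
  swap
  · rw [phiOne_mul_cls uH _ inferInstance inf_le_right k1, LinearMap.map_zero₂]
    rintro x ⟨hx, -⟩ ⟨⟨a, b⟩⟩
    refine QuotientGroup.eq.2 ?_
    have h3 := Subgroup.mem_goursatFst.1 (n1.conj_mem _ (X.goursatFst.inv_mem hx) a⁻¹)
    convert h3 using 1
    ext
    · change (x * a)⁻¹ * a = a⁻¹ * x⁻¹ * (a⁻¹)⁻¹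
      group
    · change (1 * b)⁻¹ * b = 1
      group
  by_cases k2 : X.goursatSnd ⊓ frattini G = ⊥
  swap
  · rw [rbMul_assoc, cls_mul_phiOne uG _ inferInstance inf_le_right k2, map_zero]
    rintro x ⟨hx, -⟩ ⟨⟨a, b⟩⟩
    refine QuotientGroup.eq.2 ?_
    have h3 := Subgroup.mem_goursatSnd.1 (n2.conj_mem _ hx b⁻¹)
    convert h3 using 1
    ext
    · change (1 * a)⁻¹ * a = 1
      group
    · change (x⁻¹ * b)⁻¹ * b = b⁻¹ * x * (b⁻¹)⁻¹
      group
  exfalso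
  apply hne
  -- Goursat's lemma gives an isomorphism between the quotients by the two kernels, and these
  -- kernels do not affect `H^@` and `G^@`.
  obtain ⟨e, -⟩ := Subgroup.goursat_surjective h1 h2
  obtain ⟨e1⟩ := At_equiv_of_surjective hH (QuotientGroup.mk' X.goursatFst)
    (QuotientGroup.mk'_surjective _) (by rwa [QuotientGroup.ker_mk'])
  obtain ⟨e2⟩ := At_equiv_of_surjective hG (QuotientGroup.mk' X.goursatSnd)
    (QuotientGroup.mk'_surjective _) (by rwa [QuotientGroup.ker_mk'])
  obtain ⟨e3⟩ := At_congr (hH.to_quotient _) e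
  exact ⟨e1.trans (e3.trans e2.symm)⟩

end

end BisetFun

/-! ### The elements `b_L`: centrality, idempotence, orthogonality -/

namespace BisetFun

noncomputable section

/-- The product `×_H`. -/
local infixl:70 " ⊙ " => rbMul _

theorem Sec.isPGroup_quot {p : ℕ} {G : Type w} [Group G] (hG : IsPGroup p G) (s : Sec G) :
    IsPGroup p s.Quot :=
  (hG.to_subgroup s.T).to_quotient _

variable {R : Type u} [CommRing R] {p : ℕ} {G H : Type w} [Group G] [Group H] [Finite G] [Finite H]

open FinBiset

/-- For `p`-groups, the product `ε_{T,S}^H V ε_{T',S'}^G` vanishes unless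
`(T/S)^@ ≅ (T'/S')^@`. -/
theorem eps_mul_mul_eps [Fact p.Prime] (hp : IsUnit (p : R)) (hH : IsPGroup p H)
    (hG : IsPGroup p G) {s : Sec H} {t : Sec G} (hne : ¬ Nonempty (At s.Quot ≃* At t.Quot))
    (V : RBurnside R H G) : eps R s ⊙ V ⊙ eps R t = 0 := by
  have h := phiOne_mul_mul_phiOne hp (s.isPGroup_quot hH) (t.isPGroup_quot hG) hne
    (cls R s.defres ⊙ V ⊙ cls R t.indinf)
  have key : cls R s.indinf ⊙ phiOne R s.Quot ⊙ cls R s.defres ⊙ V ⊙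
      (cls R t.indinf ⊙ phiOne R t.Quot ⊙ cls R t.defres) = cls R s.indinf ⊙
        (phiOne R s.Quot ⊙ (cls R s.defres ⊙ V ⊙ cls R t.indinf) ⊙ phiOne R t.Quot) ⊙
          cls R t.defres := by
    simp only [rbMul_assoc]
  rw [eps, eps, LinearMap.map_smul₂, LinearMap.map_smul₂, map_smul, key, h]
  simp

theorem sum_eps_mul_mul_sum_eps [Fact p.Prime] (hp : IsUnit (p : R)) (hH : IsPGroup p H)
    (hG : IsPGroup p G) {A : Finset (Quotient (MinSec.conj H))}
    {B : Finset (Quotient (MinSec.conj G))}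
    (hne : ∀ c ∈ A, ∀ d ∈ B, ¬ Nonempty (At c.out.1.Quot ≃* At d.out.1.Quot))
    (V : RBurnside R H G) : (∑ c ∈ A, eps R c.out.1) ⊙ V ⊙ ∑ d ∈ B, eps R d.out.1 = 0 := by
  rw [map_sum]
  refine Finset.sum_eq_zero fun d hd => ?_
  rw [LinearMap.map_sum₂, LinearMap.map_sum₂]
  exact Finset.sum_eq_zero fun c hc => eps_mul_mul_eps hp hH hG (hne c hc d hd) V

open Classical in
variable (R G) in
/-- The sum of the elements `ε_{T,S}^G` over the conjugacy classes of minimal sections which do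
not contribute to `b_L^G`. -/
def bCompl (L : Type w) [Group L] : RBurnside R G G :=
  ∑ c : Quotient (MinSec.conj G) with ¬ Nonempty (At c.out.1.Quot ≃* L), eps R c.out.1

theorem bElem_add_bCompl (h : IsUnit (Nat.card G : R)) (L : Type w) [Group L] :
    bElem R G L + bCompl R G L = cls R (regular G) := by
  classical
  rw [bElem, bCompl, ← sum_eps h, Finset.sum_filter_add_sum_filter_not]

theorem bElem_mul_mul_bCompl [Fact p.Prime] (hp : IsUnit (p : R)) (hH : IsPGroup p H)
    (hG : IsPGroup p G) (L : Type w) [Group L] (V : RBurnside R H G) :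
    bElem R H L ⊙ V ⊙ bCompl R G L = 0 := by
  refine sum_eps_mul_mul_sum_eps hp hH hG (fun c hc d hd => ?_) V
  classical
  rw [Finset.mem_filter_univ] at hc hd
  rintro ⟨e⟩
  exact hd (hc.map e.symm.trans)

theorem bCompl_mul_mul_bElem [Fact p.Prime] (hp : IsUnit (p : R)) (hH : IsPGroup p H)
    (hG : IsPGroup p G) (L : Type w) [Group L] (V : RBurnside R H G) :
    bCompl R H L ⊙ V ⊙ bElem R G L = 0 := by
  refine sum_eps_mul_mul_sum_eps hp hH hG (fun c hc d hd => ?_) V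
  classical
  rw [Finset.mem_filter_univ] at hc hd
  rintro ⟨e⟩
  exact hc (hd.map e.trans)

/-- The elements `b_L` commute with all bisets between `p`-groups. -/
theorem mul_bElem [Fact p.Prime] (hp : IsUnit (p : R)) (hH : IsPGroup p H)
    (hG : IsPGroup p G) (L : Type w) [Group L] (V : RBurnside R H G) :
    V ⊙ bElem R G L = bElem R H L ⊙ V := by
  -- The identity `b_L + bCompl` is inserted on the left of `V` here and on its right in `h2`; the
  -- cross terms vanish.
  have h1 : V ⊙ bElem R G L = bElem R H L ⊙ V ⊙ bElem R G L := by
    conv_lhs => rw [← one_rbMul R V, ← bElem_add_bCompl (isUnit_card_of_isPGroup hp hH) L]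
    rw [LinearMap.map_add₂, LinearMap.map_add₂, bCompl_mul_mul_bElem hp hH hG, add_zero]
  have h2 : bElem R H L ⊙ V = bElem R H L ⊙ V ⊙ bElem R G L := by
    conv_lhs => rw [← rbMul_one R (bElem R H L ⊙ V),
      ← bElem_add_bCompl (isUnit_card_of_isPGroup hp hG) L]
    rw [map_add, bElem_mul_mul_bCompl hp hH hG, add_zero]
  exact h1.trans h2.symm

theorem bElem_mul_self [Fact p.Prime] (hp : IsUnit (p : R)) (hG : IsPGroup p G) (L : Type w)
    [Group L] : bElem R G L ⊙ bElem R G L = bElem R G L := by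
  have h := bElem_mul_mul_bCompl hp hG hG L (cls R (regular G))
  rw [rbMul_one] at h
  conv_rhs => rw [← rbMul_one R (bElem R G L),
    ← bElem_add_bCompl (isUnit_card_of_isPGroup hp hG) L]
  rw [map_add, h, add_zero]

theorem bElem_mul_bElem_of_not_equiv [Fact p.Prime] (hp : IsUnit (p : R)) (hG : IsPGroup p G)
    {L M : Type w} [Group L] [Group M] (hne : ¬ Nonempty (L ≃* M)) :
    bElem R G L ⊙ bElem R G M = 0 := by
  rw [← rbMul_one R (bElem R G L)]
  refine sum_eps_mul_mul_sum_eps hp hG hG (fun c hc d hd => ?_) _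
  classical
  rw [Finset.mem_filter_univ] at hc hd
  rintro ⟨e⟩
  exact hne (hc.elim fun f => hd.map fun g => f.symm.trans (e.trans g))

/-- The elements `b_L^G`, for `L` in a system of representatives of atoric `p`-groups, are almost
all zero, and their sum is the identity. -/
theorem exists_finset_sum_bElem [Fact p.Prime] (hp : IsUnit (p : R)) (hG : IsPGroup p G)
    {I : Type t} (L : I → AtoricGroup.{w} p)
    (hL : ∀ M : AtoricGroup.{w} p, ∃! i, Nonempty (M.carrier ≃* (L i).carrier)) :
    ∃ s : Finset I, (∀ i ∉ s, bElem R G (L i).carrier = 0) ∧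
      ∑ i ∈ s, bElem R G (L i).carrier = cls R (regular G) := by
  classical
  -- `(T/S)^@` is atoric, so each conjugacy class of minimal sections belongs to exactly one index,
  -- and the `b_{L i}` partition the sum of all `ε_{T,S}`.
  have key : ∀ c : Quotient (MinSec.conj G), ∃ i, Nonempty (At c.out.1.Quot ≃* (L i).carrier) ∧
      ∀ j, Nonempty (At c.out.1.Quot ≃* (L j).carrier) → j = i := fun c =>
    hL (atAtoric (c.out.1.isPGroup_quot hG))
  choose f hf hf' using key
  have hb : ∀ i, bElem R G (L i).carrier =
      ∑ c : Quotient (MinSec.conj G) with f c = i, eps R c.out.1 := by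
    intro i
    refine Finset.sum_congr (Finset.filter_congr fun c _ => ⟨fun h => (hf' c i h).symm, ?_⟩)
      fun _ _ => rfl
    rintro rfl
    exact hf c
  refine ⟨Finset.univ.image f, fun i hi => ?_, ?_⟩
  · rw [hb, Finset.sum_filter]
    refine Finset.sum_eq_zero fun c _ => if_neg ?_
    rintro rfl
    exact hi (Finset.mem_image_of_mem f (Finset.mem_univ c))
  · rw [← sum_eps (isUnit_card_of_isPGroup hp hG), Finset.sum_congr rfl fun i _ => hb i]
    exact Finset.sum_fiberwise_of_maps_to (fun c hc => Finset.mem_image_of_mem f hc) _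

end

end BisetFun

namespace BisetFun

/-! ### Linear functors -/

section LinearFunctors

variable {R : Type*} [CommRing R] {C D : Type*} [Category* C] [Category* D] [Preadditive C]
  [Linear R C] [Preadditive D] [Linear R D]

/-- A functor which embeds pointwise in a family of linear functors is linear. -/
theorem linear_of_jointly_mono {J : Type*} {X : C ⥤ D} {Y : J → C ⥤ D} (f : ∀ j, X ⟶ Y j)
    (hY : ∀ j, (Y j).Additive ∧ (Y j).Linear R)
    (hf : ∀ c {T : D} (g h : T ⟶ X.obj c), (∀ j, g ≫ (f j).app c = h ≫ (f j).app c) → g = h) :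
    X.Additive ∧ X.Linear R := by
  refine ⟨⟨fun {c d g h} => hf _ _ _ fun j => ?_⟩, ⟨fun {c d} g r => hf _ _ _ fun j => ?_⟩⟩
  · have := (hY j).1
    simp only [(f j).naturality, Preadditive.add_comp, (Y j).map_add, Preadditive.comp_add]
  · have := (hY j).1
    have := (hY j).2
    simp only [(f j).naturality, Linear.smul_comp, (Y j).map_smul, Linear.comp_smul]

theorem linear_of_epi {X Y : C ⥤ D} (f : X ⟶ Y) (hX : X.Additive ∧ X.Linear R)
    [∀ c, Epi (f.app c)] : Y.Additive ∧ Y.Linear R := by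
  obtain ⟨h1, h2⟩ := hX
  refine ⟨⟨fun {c d g h} => ?_⟩, ⟨fun {c d} g r => ?_⟩⟩
  · simp only [← cancel_epi (f.app c), ← f.naturality, Preadditive.add_comp, X.map_add,
      Preadditive.comp_add]
  · simp only [← cancel_epi (f.app c), ← f.naturality, Linear.smul_comp, X.map_smul,
      Linear.comp_smul]

/-- Limits of functors are computed pointwise, so the legs of the limit cone are jointly monic at
each object and linearity can be tested after projecting. -/
theorem linear_of_isLimit {J : Type*} [Category* J] {K : J ⥤ C ⥤ D} {c : Cone K} (hc : IsLimit c)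
    [∀ X, PreservesLimit K ((evaluation C D).obj X)]
    (hK : ∀ j, (K.obj j).Additive ∧ (K.obj j).Linear R) : c.pt.Additive ∧ c.pt.Linear R :=
  linear_of_jointly_mono c.π.app hK fun X _ _ _ h =>
    (isLimitOfPreserves ((evaluation C D).obj X) hc).hom_ext h

end LinearFunctors

section LinearFunctorsAbelian

variable {R : Type*} [CommRing R] {C D : Type*} [Category* C] [Category* D] [Preadditive C]
  [Linear R C] [Abelian D] [Linear R D]

instance : ObjectProperty.IsClosedUnderSubobjects
    (fun F : C ⥤ D => F.Additive ∧ F.Linear R) where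
  prop_of_mono f _ hY :=
    linear_of_jointly_mono (fun _ : Unit => f) (fun _ => hY) fun c _ _ _ H =>
      (cancel_mono (f.app c)).1 (H ())

instance : ObjectProperty.IsClosedUnderQuotients
    (fun F : C ⥤ D => F.Additive ∧ F.Linear R) where
  prop_of_epi f _ hX := linear_of_epi f hX

instance (J : Type*) [Category* J] [HasLimitsOfShape J D] :
    ObjectProperty.IsClosedUnderLimitsOfShape (fun F : C ⥤ D => F.Additive ∧ F.Linear R) J where
  limitsOfShape_le := by
    rintro X ⟨q⟩
    exact linear_of_isLimit q.isLimit q.prop_diag_obj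

instance : ObjectProperty.IsClosedUnderFiniteProducts
    (fun F : C ⥤ D => F.Additive ∧ F.Linear R) where
  isClosedUnderLimitsOfShape _ _ := inferInstance

open ZeroObject in
instance : ObjectProperty.ContainsZero (fun F : C ⥤ D => F.Additive ∧ F.Linear R) where
  exists_zero := ⟨0, isZero_zero _,
    ⟨⟨fun {c _ _ _} => ((isZero_zero (C ⥤ D)).obj c).eq_of_src _ _⟩,
      ⟨fun {c _} _ _ => ((isZero_zero (C ⥤ D)).obj c).eq_of_src _ _⟩⟩⟩

end LinearFunctorsAbelian

/-! ### The objects on which an element of the center is the identity -/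

section Center

variable {C : Type*} [Category* C] (e : CatCenter C)

/-- The components of a central element are natural, so the equation `e.app X = 𝟙 X` can be checked
after composing with a mono. The closure properties below follow from the same principle with epis
and with limit or colimit legs. -/
instance : ObjectProperty.IsClosedUnderSubobjects (fun X : C => e.app X = 𝟙 X) where
  prop_of_mono {X Y} f _ hY := by
    rw [← cancel_mono f, ← e.naturality, hY, Category.comp_id, Category.id_comp]

instance : ObjectProperty.IsClosedUnderQuotients (fun X : C => e.app X = 𝟙 X) where
  prop_of_epi {X Y} f _ hX := by
    rw [← cancel_epi f, e.naturality, hX, Category.comp_id, Category.id_comp]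

instance (J : Type*) [Category* J] :
    ObjectProperty.IsClosedUnderLimitsOfShape (fun X : C => e.app X = 𝟙 X) J where
  limitsOfShape_le := by
    rintro X ⟨q⟩
    refine q.isLimit.hom_ext fun j => ?_
    rw [← e.naturality, q.prop_diag_obj, Category.comp_id, Category.id_comp]

instance (J : Type*) [Category* J] :
    ObjectProperty.IsClosedUnderColimitsOfShape (fun X : C => e.app X = 𝟙 X) J where
  colimitsOfShape_le := by
    rintro X ⟨q⟩
    refine q.isColimit.hom_ext fun j => ?_
    rw [e.naturality, q.prop_diag_obj, Category.comp_id, Category.id_comp]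

instance : ObjectProperty.IsClosedUnderFiniteProducts (fun X : C => e.app X = 𝟙 X) where

open ZeroObject in
instance [HasZeroMorphisms C] [HasZeroObject C] :
    ObjectProperty.ContainsZero (fun X : C => e.app X = 𝟙 X) where
  exists_zero := ⟨0, isZero_zero C, (isZero_zero C).eq_of_src _ _⟩

end Center

/-! ### The summands are abelian subcategories -/

section Summand

variable {R : Type u} [CommRing R] {p : ℕ}

/-- An idempotent with full image is the identity. This replaces the condition on images, which
defines `Summand`, by an equation stable under limits and colimits. -/
theorem forall_imageSub_eq_top_iff {F : PBisetFunctor.{w, u, v} R p} {η : F ⟶ F} (hη : η ≫ η = η) :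
    (∀ P, imageSub η P = ⊤) ↔ η = 𝟙 F := by
  refine ⟨fun h => ?_, ?_⟩
  · ext P x
    obtain ⟨y, rfl⟩ := LinearMap.range_eq_top.1 (h P) x
    exact congrArg (fun k => (k.hom.app P).hom y) hη
  · rintro rfl P
    exact LinearMap.range_eq_top.2 fun x => ⟨x, rfl⟩

theorem CatCenter.app_comp_app {C : Type*} [Category* C] {e : CatCenter C}
    (he : IsIdempotentElem e) (X : C) : e.app X ≫ e.app X = e.app X :=
  congrArg (fun z : CatCenter C => z.app X) he.eq

theorem summand_property_eq {e : CatCenter (PBisetFunctor.{w, u, v} R p)}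
    (he : IsIdempotentElem e) :
    (fun F : PBisetFunctor.{w, u, v} R p => ∀ P : PBisetCat.{w} R p, imageSub (e.app F) P = ⊤) =
      fun F => e.app F = 𝟙 F :=
  funext fun F => propext (forall_imageSub_eq_top_iff (CatCenter.app_comp_app he F))

theorem exists_abelian_summand {e : CatCenter (PBisetFunctor.{w, u, v} R p)}
    (he : IsIdempotentElem e) :
    ∃ A : Abelian (Summand e), A.toPreadditive = summandPreadditive e := by
  have h := summand_property_eq he
  have h1 : ObjectProperty.IsClosedUnderSubobjects (fun F : PBisetFunctor.{w, u, v} R p =>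
      ∀ P : PBisetCat.{w} R p, imageSub (e.app F) P = ⊤) := h ▸ inferInstance
  have h2 : ObjectProperty.IsClosedUnderQuotients (fun F : PBisetFunctor.{w, u, v} R p =>
      ∀ P : PBisetCat.{w} R p, imageSub (e.app F) P = ⊤) := h ▸ inferInstance
  have h3 : ObjectProperty.IsClosedUnderFiniteProducts (fun F : PBisetFunctor.{w, u, v} R p =>
      ∀ P : PBisetCat.{w} R p, imageSub (e.app F) P = ⊤) := h ▸ inferInstance
  have h4 : ObjectProperty.ContainsZero (fun F : PBisetFunctor.{w, u, v} R p =>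
      ∀ P : PBisetCat.{w} R p, imageSub (e.app F) P = ⊤) := h ▸ inferInstance
  exact ⟨inferInstance, rfl⟩

theorem preservesFiniteLimits_summand {e : CatCenter (PBisetFunctor.{w, u, v} R p)}
    (he : IsIdempotentElem e) : PreservesFiniteLimits (Summand.ι e) where
  preservesFiniteLimits J _ _ := by
    have h : ObjectProperty.IsClosedUnderLimitsOfShape (fun F : PBisetFunctor.{w, u, v} R p =>
      ∀ P : PBisetCat.{w} R p, imageSub (e.app F) P = ⊤) J :=
      summand_property_eq he ▸ inferInstance
    infer_instance

theorem preservesFiniteColimits_summand {e : CatCenter (PBisetFunctor.{w, u, v} R p)}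
    (he : IsIdempotentElem e) : PreservesFiniteColimits (Summand.ι e) where
  preservesFiniteColimits J _ _ := by
    have h : ObjectProperty.IsClosedUnderColimitsOfShape (fun F : PBisetFunctor.{w, u, v} R p =>
      ∀ P : PBisetCat.{w} R p, imageSub (e.app F) P = ⊤) J :=
      summand_property_eq he ▸ inferInstance
    infer_instance

end Summand

end BisetFun

namespace BisetFun

noncomputable section

/-! ### The idempotents `b̂_L` -/

section Bhat

variable {R : Type u} [CommRing R] {p : ℕ} [Fact p.Prime]

theorem comp_bEnd (hp : IsUnit (p : R)) (L : AtoricGroup.{w} p) {P Q : PBisetCat.{w} R p}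
    (f : P ⟶ Q) : f ≫ bEnd R L Q = bEnd R L P ≫ f :=
  ObjectProperty.hom_ext _ (mul_bElem hp Q.property P.property L.carrier f.hom).symm

theorem bEnd_comp_self (hp : IsUnit (p : R)) (L : AtoricGroup.{w} p) (P : PBisetCat.{w} R p) :
    bEnd R L P ≫ bEnd R L P = bEnd R L P :=
  ObjectProperty.hom_ext _ (bElem_mul_self hp P.property L.carrier)

theorem bEnd_comp_bEnd (hp : IsUnit (p : R)) {L M : AtoricGroup.{w} p}
    (h : ¬ Nonempty (M.carrier ≃* L.carrier)) (P : PBisetCat.{w} R p) :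
    bEnd R L P ≫ bEnd R M P = 0 :=
  ObjectProperty.hom_ext _ (bElem_mul_bElem_of_not_equiv hp P.property h)

theorem exists_finset_sum_bEnd (hp : IsUnit (p : R)) {I : Type t} (L : I → AtoricGroup.{w} p)
    (hL : ∀ M : AtoricGroup.{w} p, ∃! i, Nonempty (M.carrier ≃* (L i).carrier))
    (P : PBisetCat.{w} R p) :
    ∃ s : Finset I, (∀ i ∉ s, bEnd R (L i) P = 0) ∧ ∑ i ∈ s, bEnd R (L i) P = 𝟙 P := by
  obtain ⟨s, h1, h2⟩ := exists_finset_sum_bElem (R := R) hp P.property L hL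
  refine ⟨s, fun i hi => ObjectProperty.hom_ext _ (h1 i hi), ObjectProperty.hom_ext _ ?_⟩
  exact (map_sum ((ObjectProperty.ι fun G : BisetCat.{w} R => IsPGroup p G.carrier).mapAddHom
    (X := P) (Y := P)) _ s).trans h2

/-- The idempotent `b̂_L` of the center of the category of `p`-biset functors, whose component at
`F` consists of the maps `F(b_L^P)`. -/
def bhat (hp : IsUnit (p : R)) (L : AtoricGroup.{w} p) :
    CatCenter (PBisetFunctor.{w, u, v} R p) where
  app F := ObjectProperty.homMk
    { app := fun P => F.obj.map (bEnd R L P)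
      naturality := fun _ _ f => (F.obj.map_comp _ _).symm.trans
        ((congrArg F.obj.map (comp_bEnd hp L f)).trans (F.obj.map_comp _ _)) }
  naturality _ _ θ := ObjectProperty.hom_ext _ (NatTrans.ext (funext fun P =>
    (θ.hom.naturality (bEnd R L P)).symm))

theorem bhat_app_app (hp : IsUnit (p : R)) (L : AtoricGroup.{w} p) (F : PBisetFunctor.{w, u, v} R p)
    (P : PBisetCat.{w} R p) : ((bhat hp L).app F).hom.app P = F.obj.map (bEnd R L P) := rfl

theorem isIdempotentElem_bhat (hp : IsUnit (p : R)) (L : AtoricGroup.{w} p) :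
    IsIdempotentElem (bhat.{u, v, w} hp L) := by
  refine CatCenter.ext _ _ fun F => ObjectProperty.hom_ext _ (NatTrans.ext (funext fun P => ?_))
  exact (F.obj.map_comp _ _).symm.trans (congrArg F.obj.map (bEnd_comp_self hp L P))

theorem bhat_mul_bhat (hp : IsUnit (p : R)) {L M : AtoricGroup.{w} p} (h : ¬ Nonempty (L.carrier ≃* M.carrier)) :
    bhat.{u, v, w} hp L * bhat hp M = 0 := by
  refine CatCenter.ext _ _ fun F => ObjectProperty.hom_ext _ (NatTrans.ext (funext fun P => ?_))
  have := F.property.1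
  exact (F.obj.map_comp _ _).symm.trans
    ((congrArg F.obj.map (bEnd_comp_bEnd hp h P)).trans (F.obj.map_zero P P))

theorem exists_finset_sum_bhat (hp : IsUnit (p : R)) {I : Type t} (L : I → AtoricGroup.{w} p)
    (hL : ∀ M : AtoricGroup.{w} p, ∃! i, Nonempty (M.carrier ≃* (L i).carrier))
    (P : PBisetCat.{w} R p) :
    ∃ s : Finset I, ∀ F : PBisetFunctor.{w, u, v} R p,
      (∀ i ∉ s, ((bhat hp (L i)).app F).hom.app P = 0) ∧
      ∑ i ∈ s, ((bhat hp (L i)).app F).hom.app P = 𝟙 (F.obj.obj P) := by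
  obtain ⟨s, h1, h2⟩ := exists_finset_sum_bEnd hp L hL P
  refine ⟨s, fun F => ?_⟩
  have := F.property.1
  simp only [bhat_app_app]
  refine ⟨fun i hi => by rw [h1 i hi, F.obj.map_zero], ?_⟩
  rw [← F.obj.map_sum, h2, F.obj.map_id]

end Bhat

/-! ### Locally finite families of orthogonal central idempotents -/

section LocallyFinite

variable {R : Type u} [CommRing R] {p : ℕ} {I : Type t}

/-- The family `(e i)` of elements of the center is locally finite with sum `1`. -/
def IsLocallyFinitePartition (e : I → CatCenter (PBisetFunctor.{w, u, v} R p)) : Prop :=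
  ∀ P : PBisetCat.{w} R p, ∃ s : Finset I, ∀ F : PBisetFunctor.{w, u, v} R p,
    (∀ i ∉ s, ((e i).app F).hom.app P = 0) ∧
      ∑ i ∈ s, ((e i).app F).hom.app P = 𝟙 (F.obj.obj P)

/-- The projection of `F` onto the image of `η`. -/
def imageπ {F : PBisetFunctor.{w, u, v} R p} (η : F ⟶ F) : F ⟶ image η :=
  ObjectProperty.homMk
    { app := fun P => ModuleCat.ofHom (η.hom.app P).hom.rangeRestrict
      naturality := fun P Q f => by
        ext x
        exact Subtype.ext (congrArg (fun k => k.hom x) (η.hom.naturality f)) }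

variable {F G H : PBisetFunctor.{w, u, v} R p}

theorem imageπ_comp_imageι (η : F ⟶ F) : imageπ η ≫ imageι η = η := rfl

instance (η : F ⟶ F) : Mono (imageι η) where
  right_cancellation f g h := by
    ext P x
    exact Subtype.ext (congrArg (fun k => (k.hom.app P).hom x) h)

theorem imageι_comp {η : F ⟶ F} (hη : η ≫ η = η) : imageι η ≫ η = imageι η := by
  ext P x
  obtain ⟨y, hy⟩ := x.2
  change (η.hom.app P).hom x.1 = x.1
  rw [← hy]
  exact congrArg (fun k => (k.hom.app P).hom y) hη

theorem imageι_comp_comp {η : F ⟶ F} (hη : η ≫ η = η) (f : F ⟶ G) :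
    imageι η ≫ η ≫ f = imageι η ≫ f := by
  rw [← Category.assoc, imageι_comp hη]

theorem imageι_comp_imageπ {η : F ⟶ F} (hη : η ≫ η = η) : imageι η ≫ imageπ η = 𝟙 _ := by
  rw [← cancel_mono (imageι η), Category.assoc, imageπ_comp_imageι, Category.id_comp,
    imageι_comp hη]

theorem imageι_comp_imageπ_comp {η : F ⟶ F} (hη : η ≫ η = η) (f : image η ⟶ G) :
    imageι η ≫ imageπ η ≫ f = f := by
  rw [← Category.assoc, imageι_comp_imageπ hη, Category.id_comp]

theorem comp_imageπ {η : F ⟶ F} (hη : η ≫ η = η) : η ≫ imageπ η = imageπ η := by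
  rw [← cancel_mono (imageι η), Category.assoc, imageπ_comp_imageι, hη]

variable {e : I → CatCenter (PBisetFunctor.{w, u, v} R p)}

theorem IsLocallyFinitePartition.hom_ext (he : IsLocallyFinitePartition e) {f g : F ⟶ G}
    (h : ∀ i, (e i).app F ≫ f = (e i).app F ≫ g) : f = g := by
  refine ObjectProperty.hom_ext _ (NatTrans.ext (funext fun P => ?_))
  obtain ⟨s, hs⟩ := he P
  rw [← Category.id_comp (f.hom.app P), ← Category.id_comp (g.hom.app P), ← (hs F).2,
    Preadditive.sum_comp, Preadditive.sum_comp]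
  exact Finset.sum_congr rfl fun i _ => congrArg (fun k => k.hom.app P) (h i)

/-- Natural transformations can be glued along a locally finite family of orthogonal central
idempotents. -/
theorem IsLocallyFinitePartition.exists_glue (he : IsLocallyFinitePartition e)
    (hidem : ∀ i, IsIdempotentElem (e i)) (horth : ∀ i j, i ≠ j → e i * e j = 0)
    (θ : I → (F ⟶ G)) : ∃ φ : F ⟶ G, ∀ i, (e i).app F ≫ φ = (e i).app F ≫ θ i := by
  -- The glued map is the sum of the `e i ≫ θ i`; at each `P` only finitely many terms are nonzero,
  -- so the `finsum` below takes no default value.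
  have hfin : ∀ P, (Function.support fun i => ((e i).app F ≫ θ i).hom.app P).Finite := by
    intro P
    obtain ⟨s, hs⟩ := he P
    refine s.finite_toSet.subset fun i hi => ?_
    by_contra his
    apply hi
    change ((e i).app F).hom.app P ≫ (θ i).hom.app P = 0
    rw [(hs F).1 i his, zero_comp]
  refine ⟨ObjectProperty.homMk
    { app := fun P => ∑ᶠ i, ((e i).app F ≫ θ i).hom.app P
      naturality := fun P Q f => ?_ }, fun i => ?_⟩
  · have h1 := (Preadditive.leftComp (G.obj.obj Q) (F.obj.map f)).map_finsum (hfin Q)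
    have h2 := (Preadditive.rightComp (F.obj.obj P) (G.obj.map f)).map_finsum (hfin P)
    refine h1.trans (Eq.trans (finsum_congr fun i => ?_) h2.symm)
    exact ((e i).app F ≫ θ i).hom.naturality f
  · refine ObjectProperty.hom_ext _ (NatTrans.ext (funext fun P => ?_))
    refine ((Preadditive.leftComp (G.obj.obj P) (((e i).app F).hom.app P)).map_finsum
      (hfin P)).trans ((finsum_eq_single _ i fun j hj => ?_).trans ?_)
    · have h := congrArg (fun z : CatCenter _ => (z.app F ≫ θ j).hom.app P) (horth j i hj)
      exact h.trans zero_comp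
    · exact congrArg (fun k => (k ≫ θ i).hom.app P) (CatCenter.app_comp_app (hidem i) F)

/-- Independence: `e i` fixes its own image and kills the images of all other `e j`. Spanning: every
`x` is the finite sum of its components `e i x`. -/
theorem IsLocallyFinitePartition.isInternal [DecidableEq I] (he : IsLocallyFinitePartition e)
    (hidem : ∀ i, IsIdempotentElem (e i)) (horth : ∀ i j, i ≠ j → e i * e j = 0)
    (F : PBisetFunctor.{w, u, v} R p) (P : PBisetCat.{w} R p) :
    DirectSum.IsInternal fun i => imageSub ((e i).app F) P := by
  rw [DirectSum.isInternal_submodule_iff_iSupIndep_and_iSup_eq_top]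
  constructor
  · refine fun i => Submodule.disjoint_def.2 ?_
    rintro _ ⟨x, rfl⟩ hx
    have h1 : (⨆ j, ⨆ _ : j ≠ i, imageSub ((e j).app F) P) ≤
        LinearMap.ker (((e i).app F).hom.app P).hom := by
      refine iSup₂_le fun j hj => ?_
      rintro _ ⟨y, rfl⟩
      exact congrArg (fun z : CatCenter _ => ((z.app F).hom.app P).hom y) (horth i j hj.symm)
    have h2 := congrArg (fun k => (k.hom.app P).hom x) (CatCenter.app_comp_app (hidem i) F)
    exact h2.symm.trans (h1 hx)
  · rw [eq_top_iff]
    intro x _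
    obtain ⟨s, hs⟩ := he P
    have h := congrArg (fun k => k.hom x) (hs F).2
    rw [ModuleCat.hom_sum, LinearMap.sum_apply, ModuleCat.id_apply] at h
    rw [← h]
    exact Submodule.sum_mem _ fun i _ =>
      Submodule.mem_iSup_of_mem i (LinearMap.mem_range_self _ x)

theorem IsLocallyFinitePartition.nonempty_isColimit (he : IsLocallyFinitePartition e)
    (hidem : ∀ i, IsIdempotentElem (e i)) (horth : ∀ i j, i ≠ j → e i * e j = 0)
    (F : PBisetFunctor.{w, u, v} R p) :
    Nonempty (IsColimit (Cofan.mk F fun i => imageι ((e i).app F))) := by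
  -- The map out of `F` induced by a cofan is glued from its legs precomposed with the projections
  -- onto the images.
  have hglue := fun s : Cofan fun i => image ((e i).app F) =>
    he.exists_glue hidem horth fun i => imageπ ((e i).app F) ≫ s.inj i
  choose d hd using hglue
  refine ⟨Cofan.IsColimit.mk _ d (fun s i => ?_) fun s m hm => he.hom_ext fun i => ?_⟩
  · change imageι ((e i).app F) ≫ d s = s.inj i
    have h := CatCenter.app_comp_app (hidem i) F
    rw [← imageι_comp_comp h, hd, imageι_comp_comp h, imageι_comp_imageπ_comp h]
  · refine Eq.trans (congrArg (fun k => imageπ ((e i).app F) ≫ k) (hm i)) ?_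
    exact ((hd s i).trans (by
      rw [← Category.assoc, comp_imageπ (CatCenter.app_comp_app (hidem i) F)])).symm

/-! ### The decomposition of the category -/

theorem IsLocallyFinitePartition.faithful (he : IsLocallyFinitePartition e)
    (hidem : ∀ i, IsIdempotentElem (e i)) :
    (Functor.pi' fun i => toSummand (e i) (hidem i)).Faithful where
  map_injective {F G θ θ'} h := he.hom_ext fun i => by
    have h1 := congrArg (fun k => imageπ ((e i).app F) ≫ (k i).hom ≫ imageι ((e i).app G)) h
    exact h1

theorem IsLocallyFinitePartition.full (he : IsLocallyFinitePartition e)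
    (hidem : ∀ i, IsIdempotentElem (e i)) (horth : ∀ i j, i ≠ j → e i * e j = 0) :
    (Functor.pi' fun i => toSummand (e i) (hidem i)).Full where
  map_surjective {F G} φ := by
    obtain ⟨θ, hθ⟩ := he.exists_glue hidem horth fun i =>
      imageπ ((e i).app F) ≫ (φ i).hom ≫ imageι ((e i).app G)
    refine ⟨θ, funext fun i => ObjectProperty.hom_ext _ ?_⟩
    have h := CatCenter.app_comp_app (hidem i) F
    refine (cancel_mono (imageι ((e i).app G))).1 ?_
    change imageι ((e i).app F) ≫ θ = (φ i).hom ≫ imageι ((e i).app G)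
    rw [← imageι_comp_comp h, hθ, imageι_comp_comp h]
    exact imageι_comp_imageπ_comp h ((φ i).hom ≫ imageι ((e i).app G))

/-- The index type `I` may live in any universe. At each `P` all but finitely many factors are zero,
so the pointwise product of modules is nevertheless small, and it is again a linear functor. -/
theorem IsLocallyFinitePartition.hasProduct (he : IsLocallyFinitePartition e)
    (K : ∀ i, Summand (e i)) : HasProduct fun i => (K i).obj := by
  let D : Discrete I ⥤ PBisetFunctor.{w, u, v} R p := Discrete.functor fun i => (K i).obj
  let ι := ObjectProperty.ι
    fun F : PBisetCat.{w} R p ⥤ ModuleCat.{v} R => F.Additive ∧ F.Linear R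
  have hsmall : ∀ P, Small.{v} (((D ⋙ ι).flip.obj P) ⋙ forget (ModuleCat.{v} R)).sections := by
    intro P
    obtain ⟨s, hs⟩ := he P
    let f : (((D ⋙ ι).flip.obj P) ⋙ forget (ModuleCat.{v} R)).sections →
      ∀ i : s, (K i.1).obj.obj.obj P := fun x i => x.1 ⟨i.1⟩
    refine small_of_injective (f := f) fun x y hxy => Subtype.ext (funext fun ⟨i⟩ => ?_)
    by_cases hi : i ∈ s
    · exact congrFun hxy ⟨i, hi⟩
    · have h0 : ∀ z : (K i).obj.obj.obj P, z = 0 := by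
        intro z
        obtain ⟨y, rfl⟩ := LinearMap.range_eq_top.1 ((K i).property P) z
        exact congrArg (fun k => k.hom y) ((hs (K i).obj).1 i hi)
      exact (h0 _).trans (h0 _).symm
  have h1 : ∀ P, HasLimit ((D ⋙ ι).flip.obj P) := fun P => inferInstance
  have h2 := createsLimitFullSubcategoryInclusion D
    (linear_of_isLimit (R := R) (limit.isLimit (D ⋙ ι)) fun j => (D.obj j).property)
  exact hasLimit_of_created D ι

theorem IsLocallyFinitePartition.essSurj (he : IsLocallyFinitePartition e)
    (hidem : ∀ i, IsIdempotentElem (e i)) (horth : ∀ i j, i ≠ j → e i * e j = 0) :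
    (Functor.pi' fun i => toSummand (e i) (hidem i)).EssSurj where
  mem_essImage K := by
    classical
    have := he.hasProduct K
    -- The preimage of the family `K` is its product. The canonical maps `ρ i` and `σ i` split off
    -- `K i`, and `ρ i ≫ σ i` turns out to be `e i` on `X`, so the image of `e i` is `K i`.
    let X : PBisetFunctor.{w, u, v} R p := ∏ᶜ fun i => (K i).obj
    let ρ (i : I) : X ⟶ (K i).obj := Pi.π _ i
    let σ (i : I) : (K i).obj ⟶ X := Pi.lift fun j =>
      if h : i = j then eqToHom (by rw [h]) else 0
    have hK : ∀ i, (e i).app (K i).obj = 𝟙 _ := fun i =>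
      (forall_imageSub_eq_top_iff (CatCenter.app_comp_app (hidem i) _)).1 (K i).property
    have hK' : ∀ i j, i ≠ j → (e i).app (K j).obj = 0 := fun i j hij => by
      have h := congrArg (fun z : CatCenter _ => z.app (K j).obj) (horth i j hij)
      rw [← Category.id_comp ((e i).app (K j).obj), ← hK j]
      exact h
    have hσ : ∀ i, σ i ≫ ρ i = 𝟙 _ := fun i => by simp [σ, ρ]
    have hσ' : ∀ i j, i ≠ j → σ i ≫ ρ j = 0 := fun i j hij => by simp [σ, ρ, hij]
    have hρσ : ∀ i, ρ i ≫ σ i = (e i).app X := by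
      -- By naturality, the `j`-th component of `e i` on `X` is governed by `e i` on `K j`, which is
      -- the identity for `i = j` and zero otherwise.
      refine fun i => Pi.hom_ext _ _ fun j => ?_
      change (ρ i ≫ σ i) ≫ ρ j = (e i).app X ≫ ρ j
      rw [← (e i).naturality, Category.assoc]
      by_cases hij : i = j
      · subst hij
        rw [hσ, hK]
      · rw [hσ' i j hij, hK' i j hij, comp_zero, comp_zero]
    refine ⟨X, ⟨Pi.isoMk fun i =>
      { hom := ObjectProperty.homMk (imageι ((e i).app X) ≫ ρ i)
        inv := ObjectProperty.homMk (σ i ≫ imageπ ((e i).app X))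
        hom_inv_id := ObjectProperty.hom_ext _ ?_
        inv_hom_id := ObjectProperty.hom_ext _ ?_ }⟩⟩
    · have h := CatCenter.app_comp_app (hidem i) X
      change (imageι ((e i).app X) ≫ ρ i) ≫ σ i ≫ imageπ ((e i).app X) = 𝟙 _
      rw [Category.assoc, ← Category.assoc (ρ i), hρσ, comp_imageπ h, imageι_comp_imageπ h]
    · change (σ i ≫ imageπ ((e i).app X)) ≫ imageι ((e i).app X) ≫ ρ i = 𝟙 _
      rw [Category.assoc, ← Category.assoc (imageπ _), imageπ_comp_imageι, ← hρσ, Category.assoc,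
        hσ, Category.comp_id, hσ]

theorem IsLocallyFinitePartition.isEquivalence (he : IsLocallyFinitePartition e)
    (hidem : ∀ i, IsIdempotentElem (e i)) (horth : ∀ i j, i ≠ j → e i * e j = 0) :
    (Functor.pi' fun i => toSummand (e i) (hidem i)).IsEquivalence where
  faithful := he.faithful hidem
  full := he.full hidem horth
  essSurj := he.essSurj hidem horth

end LocallyFinite

end

end BisetFun

theorem mainTheorem4 (p : ℕ) [Fact p.Prime] (R : Type u) [CommRing R]
    (hp : IsUnit (p : R)) :
    ∃ (bhat : AtoricGroup.{w} p → CatCenter (PBisetFunctor.{w, u, v} R p))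
      (hidem : ∀ L, IsIdempotentElem (bhat L)),
      -- `(b̂_L)_F = F(b_L)` has the component `F(b_L^P)` at `P`
      (∀ (L : AtoricGroup.{w} p) (F : PBisetFunctor.{w, u, v} R p) (P : PBisetCat.{w} R p),
        ((bhat L).app F).hom.app P = F.obj.map (bEnd R L P)) ∧
      -- `b̂_L F_{p,R}` is an abelian subcategory
      (∀ L : AtoricGroup.{w} p,
        (∃ A : Abelian (Summand (bhat L)), A.toPreadditive = summandPreadditive (bhat L)) ∧
        PreservesFiniteLimits (Summand.ι (bhat L)) ∧
        PreservesFiniteColimits (Summand.ι (bhat L))) ∧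
      -- for every family `(L i)` of representatives of the isomorphism classes of atoric `p`-groups
      ∀ (I : Type t) [DecidableEq I] (L : I → AtoricGroup.{w} p),
        (∀ M : AtoricGroup.{w} p, ∃! i, Nonempty (M.carrier ≃* (L i).carrier)) →
        -- orthogonality
        (∀ i j, i ≠ j → bhat (L i) * bhat (L j) = 0) ∧
        -- the (locally finite) sum of the idempotents is the identity
        (∀ P : PBisetCat.{w} R p, ∃ s : Finset I, ∀ F : PBisetFunctor.{w, u, v} R p,
          (∀ i ∉ s, ((bhat (L i)).app F).hom.app P = 0) ∧
          ∑ i ∈ s, ((bhat (L i)).app F).hom.app P = 𝟙 (F.obj.obj P)) ∧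
        -- `F` is the direct sum of its subfunctors `b̂_{L i} F`
        (∀ F : PBisetFunctor.{w, u, v} R p,
          (∀ P, DirectSum.IsInternal fun i => imageSub ((bhat (L i)).app F) P) ∧
          Nonempty (IsColimit (Cofan.mk F fun i => imageι ((bhat (L i)).app F)))) ∧
        -- `F ↦ (b̂_{L i} F)_i` is an equivalence of categories
        (Functor.pi' fun i => toSummand (bhat (L i)) (hidem (L i))).IsEquivalence := by
  refine ⟨bhat hp, isIdempotentElem_bhat hp, fun _ _ _ => rfl, fun L =>
    ⟨exists_abelian_summand (isIdempotentElem_bhat hp L),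
      preservesFiniteLimits_summand (isIdempotentElem_bhat hp L),
      preservesFiniteColimits_summand (isIdempotentElem_bhat hp L)⟩, fun I _ L hL => ?_⟩
  have hidem := fun i => isIdempotentElem_bhat hp (L i)
  -- By uniqueness of the representative, distinct indices carry non-isomorphic groups.
  have horth : ∀ i j, i ≠ j → bhat hp (L i) * bhat hp (L j) = 0 := fun i j hij =>
    bhat_mul_bhat hp fun h => hij ((hL (L i)).unique ⟨MulEquiv.refl _⟩ h)
  have he : IsLocallyFinitePartition fun i => bhat hp (L i) := exists_finset_sum_bhat hp L hL
  exact ⟨horth, he, fun F => ⟨he.isInternal hidem horth F, he.nonempty_isColimit hidem horth F⟩,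
    he.isEquivalence hidem horth⟩
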